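/- Conventions. Graphs are finite and connected, possibly with loops and multiple edges. A stable weighted graph of genus $g$ with one leg is a graph $\Gamma$ with a weight $w\colon V(\Gamma)\to\mathbb Z_{\ge0}$ and a marked vertex $v_0$ (the vertex carrying the leg), such that $\sum_v w(v)+b_1(\Gamma)=g$ and $\mathrm{val}(v)+2w(v)+|L(v)|\ge 3$ for every vertex $v$, where $L(v)$ is the set of legs at $v$. A specialization $\iota\colon\Gamma\to\Gamma'$ is an identification of $\Gamma'$ with the graph obtained from $\Gamma$ by contracting some edges, such that $\iota(v_0)=v_0'$ and $w'(v')$ is the genus of $\iota^{-1}(v')$; it induces $V(\Gamma)\to V(\Gamma')$ and $E(\Gamma')\hookrightarrow E(\Gamma)$, and it remembers the direction in which loops are identified. For a function $f$ on $V(\Gamma)$, $\iota_*f(v')=\sum_{\iota(v)=v'}f(v)$. A universal genus-$g$ polarization $\mu$ of degree $d\in\mathbb Z$ is a family of functions $\mu_\Gamma\colon V(\Gamma)\to\mathbb R$ with $\sum_v\mu_\Gamma(v)=d$, one for each stable weighted graph $\Gamma$ of genus $g$ with one leg, such that $\mu_{\Gamma'}=\iota_*\mu_\Gamma$ for every specialization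 $\iota\colon\Gamma\to\Gamma'$. For $\mathcal E\subset E(\Gamma)$ let $\Gamma^{\mathcal E}$ be the graph obtained by inserting one (exceptional) vertex in each edge of $\mathcal E$, and extend $\mu_\Gamma$ to it by $0$. A $(v_0,\mu_\Gamma)$-quasistable pseudo-divisor on $\Gamma$ is a pair $(\mathcal E,D)$ with $D\colon V(\Gamma^{\mathcal E})\to\mathbb Z$ of degree $d$, $D=-1$ at all exceptional vertices, and $$\beta_D(W):=\sum_{v\in W}\bigl(D(v)-\mu_\Gamma(v)\bigr)+\tfrac12\,|E(W,W^c)|\ \ge 0\quad\text{for all } W\subsetneq V(\Gamma^{\mathcal E}),$$ with strict inequality if $v_0\in W$. A specialization $(\Gamma,\mathcal E,D)\to(\Gamma',\mathcal E',D')$ is a specialization $\iota\colon\Gamma\to\Gamma'$ with $\mathcal E'\subset\mathcal E\cap E(\Gamma')$, together with a specialization $\iota^{\mathcal E}\colon\Gamma^{\mathcal E}\to\Gamma'^{\mathcal E'}$ compatible with $\iota$ (on vertices and on directed edges) such that $\iota^{\mathcal E}_*D=D'$. A generalized cone complex is the colimit, as a topological space, of a finite diagram of rational polyhedral cones with face morphisms.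 A cone of the diagram is maximal if no morphism of the diagram maps it onto a proper face; the complex is of pure dimension $k$ if all maximal cones have dimension $k$, and connected in codimension $1$ if any two maximal cones are joined by a finite sequence of maximal cones such that consecutive ones receive face morphisms of the diagram from a common cone of codimension $1$. A morphism of generalized cone complexes is a continuous map whose restriction to each cone factors through a morphism of cones (the restriction of an integral linear map) to a cone of the target. Let $$M^{\mathrm{trop}}_{g,1}=\varinjlim_{\Gamma}\mathbb R_{\ge0}^{E(\Gamma)},\qquad J^{\mathrm{trop}}_{\mu,g}=\varinjlim_{(\Gamma,\mathcal E,D)}\mathbb R_{\ge0}^{E(\Gamma^{\mathcal E})},$$ where $\Gamma$ runs through the stable weighted graphs of genus $g$ with one leg and $(\mathcal E,D)$ through the $(v_0,\mu_\Gamma)$-quasistable pseudo-divisors on $\Gamma$; the morphisms are the inclusions of faces induced by all specializations. The forgetful map $\pi^{\mathrm{trop}}\colon J^{\mathrm{trop}}_{\mu,g}\to M^{\mathrm{trop}}_{g,1}$ is given on cones by $(x_{e'})\mapsto (y_e)$, with $y_e$ the sum of the $x_{e'}$ over the edges $e'$ of $\Gamma^{\mathcal E}$ lying over $e$. A stable pointed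 tropical curve $X$ of genus $g$ is the metric space obtained from a stable weighted graph $\Gamma$ of genus $g$ with one leg (its stable model) and edge lengths $\ell(e)>0$, with marked point $p_0=v_0$ and the weight function of $\Gamma$ (zero off the vertices); $[X]\in M^{\mathrm{trop}}_{g,1}$ is the class of $\ell$. $\mathrm{Aut}(X)$ is the group of isometries of $X$ that preserve $p_0$ and the weights. The polyhedral complex $J^{\mathrm{trop}}_{p_0,\mu}(X)$ is the colimit of the polyhedra $\prod_{e\in\mathcal E}[0,\ell(e)]$ over all $(v_0,\mu_\Gamma)$-quasistable pseudo-divisors $(\mathcal E,D)$ on $\Gamma$, with the face morphisms given by all specializations $(\Gamma,\mathcal E,D)\to(\Gamma,\mathcal E',D')$ over the identity of $\Gamma$. A point $(x_e)_e$ of such a polyhedron represents the divisor $\sum_{v\in V(\Gamma)}D(v)\,v-\sum_{e\in\mathcal E}p_{e,x_e}$ on $X$, where $p_{e,x_e}$ is the point of $e$ at position $x_e$, and $\mathrm{Aut}(X)$ acts on $J^{\mathrm{trop}}_{p_0,\mu}(X)$ by push-forward of divisors. Theorem. Let $\mu$ be a universal genus-$g$ polarization of degree $d$. Then $M^{\mathrm{trop}}_{g,1}$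 and $J^{\mathrm{trop}}_{\mu,g}$ are generalized cone complexes, $J^{\mathrm{trop}}_{\mu,g}$ has pure dimension $4g-2$ and is connected in codimension $1$, and the forgetful map $\pi^{\mathrm{trop}}\colon J^{\mathrm{trop}}_{\mu,g}\to M^{\mathrm{trop}}_{g,1}$ is a morphism of generalized cone complexes. For every stable pointed tropical curve $X$ of genus $g$ there is a homeomorphism $$(\pi^{\mathrm{trop}})^{-1}([X])\simeq J^{\mathrm{trop}}_{p_0,\mu}(X)/\mathrm{Aut}(X).$$ -/

import Mathlib

noncomputable section

namespace TropJac

/-! ### Rational polyhedral cones and generalized cone complexes -/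

/-- `σ` is the set of nonnegative real combinations of a finite set of integral vectors. -/
def IsRationalCone {ι : Type} (σ : Set (ι → ℝ)) : Prop :=
  ∃ S : Finset (ι → ℤ), σ = {x | ∃ c : (ι → ℤ) → ℝ, (∀ s, 0 ≤ c s) ∧
    x = ∑ s ∈ S, c s • fun i => (s i : ℝ)}

/-- The dimension of a cone: the dimension of its linear span. -/
def coneDim {ι : Type} (σ : Set (ι → ℝ)) : ℕ := Module.finrank ℝ (Submodule.span ℝ σ)

/-- `F` is a (not necessarily proper) face of `σ`. -/
def IsFace {ι : Type} (F σ : Set (ι → ℝ)) : Prop :=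
  ∃ u : (ι → ℝ) →ₗ[ℝ] ℝ, (∀ x ∈ σ, 0 ≤ u x) ∧ F = {x | x ∈ σ ∧ u x = 0}

/-- A morphism of cones: the restriction of a linear map given by an integral matrix. -/
def IsConeMorphism {ι κ : Type} [Fintype ι] {τ : Set (ι → ℝ)} {σ : Set (κ → ℝ)}
    (f : τ → σ) : Prop :=
  ∃ A : Matrix κ ι ℤ, ∀ x : τ, (f x : κ → ℝ) = (A.map (Int.cast : ℤ → ℝ)).mulVec (x : ι → ℝ)

/-- A face morphism: a morphism of cones that is an isomorphism onto a face of the target. -/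
def IsFaceMorphism {ι κ : Type} [Fintype ι] [Fintype κ] {τ : Set (ι → ℝ)} {σ : Set (κ → ℝ)}
    (f : τ → σ) : Prop :=
  IsConeMorphism f ∧ IsFace {y | ∃ x : τ, (f x : κ → ℝ) = y} σ ∧
    ∃ B : Matrix ι κ ℤ, ∀ x : τ, (B.map (Int.cast : ℤ → ℝ)).mulVec (f x : κ → ℝ) = x

/-- A diagram of subsets of coordinate spaces and maps between them. (Only the arrows of the
indexing category are recorded: they determine the colimit as well as all notions below.) -/
structure ConeDiagram where
  Obj : Type
  Coord : Obj → Type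
  [fin : ∀ i, Fintype (Coord i)]
  cone : ∀ i, Set (Coord i → ℝ)
  Hom : Obj → Obj → Type
  map : ∀ {i j : Obj}, Hom i j → cone i → cone j

namespace ConeDiagram

instance (D : ConeDiagram) (i : D.Obj) : Fintype (D.Coord i) := D.fin i

/-- A finite diagram of rational polyhedral cones with face morphisms. -/
def IsGeneralizedConeComplex (D : ConeDiagram) : Prop :=
  Finite D.Obj ∧ (∀ i j, Finite (D.Hom i j)) ∧ (∀ i, IsRationalCone (D.cone i)) ∧
    ∀ (i j : D.Obj) (f : D.Hom i j), IsFaceMorphism (D.map f)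

/-- One-step identifications in the colimit. -/
inductive Glue (D : ConeDiagram) : (Σ i, D.cone i) → (Σ i, D.cone i) → Prop
  | mk {i j : D.Obj} (f : D.Hom i j) (x : D.cone i) : Glue D ⟨i, x⟩ ⟨j, D.map f x⟩

/-- The colimit of the diagram as a set: the quotient of the disjoint union of the cones by the
equivalence relation generated by `Glue`. -/
def Colimit (D : ConeDiagram) : Type := Quot D.Glue

/-- The colimit topology. -/
instance (D : ConeDiagram) : TopologicalSpace D.Colimit :=
  inferInstanceAs (TopologicalSpace (Quot D.Glue))

/-- The canonical map of a cone to the colimit. -/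
def incl (D : ConeDiagram) (i : D.Obj) (x : D.cone i) : D.Colimit := Quot.mk _ ⟨i, x⟩

/-- There is no morphism of the diagram from `i` onto a proper face. -/
def IsMaximal (D : ConeDiagram) (i : D.Obj) : Prop :=
  ∀ (j : D.Obj) (f : D.Hom i j), Function.Surjective (D.map f)

/-- All maximal cones have dimension `k`. -/
def HasPureDimension (D : ConeDiagram) (k : ℤ) : Prop :=
  ∀ i, D.IsMaximal i → (coneDim (D.cone i) : ℤ) = k

/-- Two maximal cones with a common face of codimension one. -/
def Adjacent (D : ConeDiagram) (i i' : D.Obj) : Prop :=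
  D.IsMaximal i ∧ D.IsMaximal i' ∧ ∃ t : D.Obj,
    coneDim (D.cone t) + 1 = coneDim (D.cone i) ∧ coneDim (D.cone t) + 1 = coneDim (D.cone i') ∧
    Nonempty (D.Hom t i) ∧ Nonempty (D.Hom t i')

/-- Any two maximal cones are joined by a finite sequence of maximal cones in which neighbours
have a common face of codimension one. -/
def IsConnectedThroughCodimOne (D : ConeDiagram) : Prop :=
  ∀ i i', D.IsMaximal i → D.IsMaximal i' → Relation.ReflTransGen D.Adjacent i i'

/-- A morphism of generalized cone complexes: a continuous map which on each cone lifts to a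
morphism to a cone of the target. -/
def IsMorphism (D D' : ConeDiagram) (f : D.Colimit → D'.Colimit) : Prop :=
  Continuous f ∧ ∀ i : D.Obj, ∃ (j : D'.Obj) (T : D.cone i → D'.cone j),
    IsConeMorphism T ∧ ∀ x, f (D.incl i x) = D'.incl j (T x)

end ConeDiagram

/-! ### Graphs, specializations and subdivisions -/

/-- A graph with vertex set `V` and edge set `E`; loops and multiple edges are allowed. The two
ends of the edge `e` are `ends e false` and `ends e true`. Morphisms may reverse edges, so the
labelling of the ends is auxiliary. -/
structure Multigraph (V E : Type) where
  ends : E → Bool → V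

namespace Multigraph

variable {V E V' E' : Type}

/-- `v` and `w` are joined by a path using only edges of `S`. -/
def Reach (G : Multigraph V E) (S : Set E) : V → V → Prop :=
  Relation.EqvGen fun v w => ∃ e ∈ S, G.ends e false = v ∧ G.ends e true = w

def Connected (G : Multigraph V E) : Prop := ∀ v w, G.Reach Set.univ v w

open scoped Classical in
/-- The valence of a vertex, loops counting twice. -/
def val [Fintype E] (G : Multigraph V E) (v : V) : ℕ :=
  (Finset.univ.filter fun p : E × Bool => G.ends p.1 p.2 = v).card

open scoped Classical in
/-- The number of edges joining a vertex in `W` to one outside `W`. -/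
def delta [Fintype E] (G : Multigraph V E) (W : Finset V) : ℕ :=
  (Finset.univ.filter fun e : E => ¬ (G.ends e false ∈ W ↔ G.ends e true ∈ W)).card

/-- Vertices of the `S`-subdivision. -/
abbrev SubVertex (V : Type) {E : Type} (S : Finset E) : Type := V ⊕ {e // e ∈ S}

/-- Edges of the `S`-subdivision. -/
abbrev SubEdge {E : Type} (S : Finset E) : Type := {e // e ∉ S} ⊕ ({e // e ∈ S} × Bool)

/-- The `S`-subdivision: one new vertex `inr e` is inserted in each edge `e` in `S`, which is
replaced by two edges `inr (e, h)`, the one with index `h` being incident to `ends e h`. Both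
inherit the direction of `e`. -/
def subdiv (G : Multigraph V E) (S : Finset E) :
    Multigraph (SubVertex V S) (SubEdge S) where
  ends
    | .inl e, b => .inl (G.ends e b)
    | .inr (e, h), b => if b = h then .inl (G.ends e h) else .inr e

/-- The edge of the graph over which an edge of the subdivision lies. -/
def overEdge (S : Finset E) : SubEdge S → E
  | .inl e => e
  | .inr (e, _) => e

end Multigraph

/-- A specialization `G → G'`, i.e. an isomorphism of `G'` with the contraction of the edges of
`G` outside the range of `emap`. The two ends of `emap e'` correspond to those of `e'`, in
reversed order if `flip e' = true` (only for loops is this additional information). -/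
structure Specialization {V E V' E' : Type} (G : Multigraph V E) (G' : Multigraph V' E') where
  vmap : V → V'
  emap : E' → E
  flip : E' → Bool
  vmap_surjective : Function.Surjective vmap
  emap_injective : Function.Injective emap
  vmap_ends : ∀ e' b, vmap (G.ends (emap e') b) = G'.ends e' (xor b (flip e'))
  vmap_eq_iff : ∀ v w, vmap v = vmap w ↔ G.Reach (Set.range emap)ᶜ v w

/-- The identity specialization. -/
def Specialization.id {V E : Type} (G : Multigraph V E) : Specialization G G where
  vmap := fun v => v
  emap := fun e => e
  flip := fun _ => false
  vmap_surjective := fun v => ⟨v, rfl⟩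
  emap_injective := fun _ _ h => h
  vmap_ends := by simp
  vmap_eq_iff := by
    intro v w
    constructor
    · rintro rfl
      exact Relation.EqvGen.refl _
    · intro h
      induction h with
      | rel x y h => simp at h
      | refl x => rfl
      | symm x y _ ih => exact ih.symm
      | trans x y z _ _ ih₁ ih₂ => exact ih₁.trans ih₂

open scoped Classical in
/-- Push-forward of integer or real valued functions on the vertices (divisors, polarizations). -/
def pushforward {A V V' : Type} [AddCommMonoid A] [Fintype V] (f : V → V') (D : V → A) (v' : V') :
    A :=
  ∑ v with f v = v', D v

/-! ### Stable weighted graphs with one leg and the moduli space of tropical curves -/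

open scoped Classical in
/-- Stable weighted graphs with one leg of genus `g`; vertices and edges are numbered, so that
there is only a finite number of such objects. For connected graphs the genus is
`∑ v, weight v + (m - n + 1)`. -/
structure StableGraph (g : ℕ) where
  n : ℕ
  m : ℕ
  graph : Multigraph (Fin n) (Fin m)
  weight : Fin n → ℕ
  leg : Fin n
  connected : graph.Connected
  genus_eq : ∑ v, weight v + m + 1 = g + n
  stable : ∀ v, 3 ≤ graph.val v + 2 * weight v + if v = leg then 1 else 0

open scoped Classical in
/-- Specializations of weighted graphs with one leg: the leg is preserved and the weight of `v'` is
the genus of the connected graph contracted to `v'`, whose vertices are those in the fibre over `v'`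
and whose edges are the contracted ones between them. -/
structure StableGraph.Hom {g : ℕ} (Γ Γ' : StableGraph g) extends
    Specialization Γ.graph Γ'.graph where
  map_leg : vmap Γ.leg = Γ'.leg
  map_weight : ∀ v', Γ'.weight v' + (Finset.univ.filter fun v => vmap v = v').card =
    (∑ v with vmap v = v', Γ.weight v) +
      (Finset.univ.filter fun e => e ∉ Set.range emap ∧ vmap (Γ.graph.ends e false) = v').card + 1

/-- The orthant of nonnegative vectors. -/
def orthant (ι : Type) : Set (ι → ℝ) := {x | ∀ i, 0 ≤ x i}

/-- The inclusion of orthants as a face (extension by zero) given by an inclusion of coordinates. -/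
def extendByZero {ι κ : Type} (i : ι → κ) (x : orthant ι) : orthant κ :=
  ⟨Function.extend i x 0, fun k => by
    classical
    rw [Function.extend_def]
    split_ifs with h
    · exact x.2 _
    · exact le_rfl⟩

/-- The moduli space of stable pointed tropical curves of genus `g`: the colimit of the orthants
with coordinates indexed by the edges of the stable graphs; the arrows are the specializations,
reversed. -/
def moduliDiagram (g : ℕ) : ConeDiagram where
  Obj := StableGraph g
  Coord Γ := Fin Γ.m
  cone Γ := orthant (Fin Γ.m)
  Hom Γ' Γ := StableGraph.Hom Γ Γ'
  map ι := extendByZero ι.emap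

abbrev Mtrop (g : ℕ) : Type := (moduliDiagram g).Colimit

/-! ### Polarizations and quasistable pseudo-divisors -/

/-- A universal genus-`g` polarization of degree `d`. -/
structure UniversalPolarization (g : ℕ) (d : ℤ) where
  μ : ∀ Γ : StableGraph g, Fin Γ.n → ℝ
  degree_eq : ∀ Γ, ∑ v, μ Γ v = d
  map_eq : ∀ {Γ Γ' : StableGraph g} (ι : StableGraph.Hom Γ Γ'), μ Γ' = pushforward ι.vmap (μ Γ)

/-- `β_D(W) = deg (D|_W) - μ(W) + δ_W / 2`. -/
def beta {V E : Type} [Fintype E] (G : Multigraph V E) (μ : V → ℝ) (D : V → ℤ) (W : Finset V) : ℝ :=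
  (∑ v ∈ W, (D v : ℝ)) - (∑ v ∈ W, μ v) + (G.delta W : ℝ) / 2

/-- `(v₀, μ)`-quasistable divisors of degree `d`. -/
def IsQuasistable {V E : Type} [Fintype V] [Fintype E] (G : Multigraph V E) (v₀ : V)
    (μ : V → ℝ) (d : ℤ) (D : V → ℤ) : Prop :=
  ∑ v, D v = d ∧ ∀ W : Finset V, W ≠ Finset.univ →
    0 ≤ beta G μ D W ∧ (v₀ ∈ W → 0 < beta G μ D W)

/-- Quasistable pseudo-divisors `(S, D)` on `G`: the divisor `D` on the `S`-subdivision has value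
`-1` at the exceptional vertices and is quasistable for `μ` extended by zero. -/
structure QD {V E : Type} [Fintype V] [Fintype E] [DecidableEq E] (G : Multigraph V E) (v₀ : V)
    (μ : V → ℝ) (d : ℤ) where
  S : Finset E
  D : Multigraph.SubVertex V S → ℤ
  exceptional : ∀ e, D (.inr e) = -1
  quasistable : IsQuasistable (G.subdiv S) (.inl v₀) (Sum.elim μ fun _ => 0) d D

/-- A specialization of pseudo-divisors over the specialization `ι`: a specialization of the
subdivisions compatible with `ι` on vertices and on directed edges which maps `D` to `D'`. -/
structure QD.HomOver {V E V' E' : Type} [Fintype V] [Fintype E] [DecidableEq E] [Fintype V']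
    [Fintype E'] [DecidableEq E']
    {G : Multigraph V E} {G' : Multigraph V' E'} {v₀ : V} {v₀' : V'} {μ : V → ℝ} {μ' : V' → ℝ}
    {d : ℤ} (ι : Specialization G G') (P : QD G v₀ μ d) (P' : QD G' v₀' μ' d) extends
    Specialization (G.subdiv P.S) (G'.subdiv P'.S) where
  subset : ∀ e' ∈ P'.S, ι.emap e' ∈ P.S
  vmap_inl : ∀ v, vmap (.inl v) = .inl (ι.vmap v)
  overEdge_emap : ∀ f', Multigraph.overEdge P.S (emap f') = ι.emap (Multigraph.overEdge P'.S f')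
  flip_eq : ∀ f', flip f' = ι.flip (Multigraph.overEdge P'.S f')
  map_divisor : P'.D = pushforward vmap P.D

/-! ### The universal tropical Jacobian -/

/-- Objects `(Γ, S, D)`: a stable graph of genus `g` with one leg and a quasistable
pseudo-divisor on it. -/
structure QDObj {g : ℕ} {d : ℤ} (μ : UniversalPolarization g d) where
  Γ : StableGraph g
  P : QD Γ.graph Γ.leg (μ.μ Γ) d

/-- Edges of the subdivision of the graph underlying `(Γ, S, D)`. -/
abbrev QDObj.Edge {g : ℕ} {d : ℤ} {μ : UniversalPolarization g d} (a : QDObj μ) : Type :=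
  Multigraph.SubEdge a.P.S

/-- Specializations `(Γ, S, D) → (Γ', S', D')`. -/
structure QDObj.Hom {g : ℕ} {d : ℤ} {μ : UniversalPolarization g d} (a a' : QDObj μ) where
  ι : StableGraph.Hom a.Γ a'.Γ
  τ : QD.HomOver ι.toSpecialization a.P a'.P

/-- The diagram of orthants with coordinates indexed by the edges of the subdivisions. -/
def jacobianDiagram {g : ℕ} {d : ℤ} (μ : UniversalPolarization g d) : ConeDiagram where
  Obj := QDObj μ
  Coord a := a.Edge
  cone a := orthant a.Edge
  Hom a' a := QDObj.Hom a a'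
  map φ := extendByZero φ.τ.emap

/-- The universal tropical Jacobian. -/
abbrev Jtrop {g : ℕ} {d : ℤ} (μ : UniversalPolarization g d) : Type := (jacobianDiagram μ).Colimit

/-- The length of an edge is the sum of the lengths of the edges of the subdivision over it. -/
def totalLength {E : Type} [Fintype E] [DecidableEq E] (S : Finset E)
    (x : orthant (Multigraph.SubEdge S)) : orthant E :=
  ⟨fun e => ∑ f with Multigraph.overEdge S f = e, x.1 f,
    fun _ => Finset.sum_nonneg fun f _ => x.2 f⟩

theorem extend_eq_sum {ι κ : Type} [Fintype ι] [DecidableEq κ] {i : ι → κ} (hi : Function.Injective i)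
    (x : ι → ℝ) (k : κ) : Function.extend i x 0 k = ∑ j with i j = k, x j := by
  by_cases h : ∃ j, i j = k
  · obtain ⟨j, rfl⟩ := h
    rw [hi.extend_apply, Finset.sum_filter, Finset.sum_eq_single j]
    · simp
    · intro b _ hb
      exact if_neg fun h => hb (hi h)
    · simp
  · rw [Function.extend_apply' _ _ _ h, Finset.sum_filter, Finset.sum_eq_zero]
    · rfl
    · intro j _
      exact if_neg fun hj => h ⟨j, hj⟩

theorem totalLength_extendByZero {E E' : Type} [Fintype E] [DecidableEq E] [Fintype E']
    [DecidableEq E'] {S : Finset E}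
    {S' : Finset E'} {i : E' → E} (hi : Function.Injective i)
    {j : Multigraph.SubEdge S' → Multigraph.SubEdge S}
    (hj : Function.Injective j)
    (h : ∀ f, Multigraph.overEdge S (j f) = i (Multigraph.overEdge S' f))
    (x : orthant (Multigraph.SubEdge S')) :
    totalLength S (extendByZero j x) = extendByZero i (totalLength S' x) := by
  apply Subtype.ext
  funext e
  simp only [totalLength, extendByZero]
  rw [extend_eq_sum hi]
  simp only [extend_eq_sum hj, Finset.sum_filter]
  have h1 : ∀ f, (if Multigraph.overEdge S f = e then
      ∑ a, (if j a = f then x.1 a else 0) else 0) =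
      ∑ a, if j a = f then (if Multigraph.overEdge S f = e then x.1 a else 0) else 0 := by
    intro f
    split_ifs <;> simp
  have h2 : ∀ e', (if i e' = e then
      ∑ a, (if Multigraph.overEdge S' a = e' then x.1 a else 0) else 0) =
      ∑ a, if Multigraph.overEdge S' a = e' then (if i e' = e then x.1 a else 0) else 0 := by
    intro e'
    split_ifs <;> simp
  simp only [h1, h2]
  rw [Finset.sum_comm, Finset.sum_comm (s := (Finset.univ : Finset E'))]
  refine Finset.sum_congr rfl fun a _ => ?_
  rw [Finset.sum_ite_eq, Finset.sum_ite_eq]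
  simp [h]

/-- The forgetful map from the universal tropical Jacobian to the moduli space. -/
def forget {g : ℕ} {d : ℤ} (μ : UniversalPolarization g d) : Jtrop μ → Mtrop g :=
  Quot.lift (fun p => (moduliDiagram g).incl p.1.Γ (totalLength (E := Fin _) p.1.P.S p.2)) (by
    rintro _ _ ⟨f, x⟩
    refine (Quot.sound (ConeDiagram.Glue.mk (D := moduliDiagram g) f.ι
      (totalLength (E := Fin _) _ x))).trans ?_
    exact congrArg ((moduliDiagram g).incl _) (totalLength_extendByZero f.ι.emap_injective f.τ.emap_injective
      f.τ.overEdge_emap x).symm)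

/-! ### Stable pointed tropical curves and their Jacobians -/

/-- A stable pointed tropical curve of genus `g`, given by its stable model and edge lengths. -/
structure StableCurve (g : ℕ) where
  Γ : StableGraph g
  len : Fin Γ.m → ℝ
  len_pos : ∀ e, 0 < len e

namespace StableCurve

variable {g : ℕ} {d : ℤ} (X : StableCurve g)

/-- The intervals `[0, len e]` together with the vertices. -/
abbrev PrePoint : Type := Fin X.Γ.n ⊕ Σ e : Fin X.Γ.m, Set.Icc 0 (X.len e)

/-- The endpoints of the interval of `e` are glued to the ends of `e`. -/
inductive GluePoint : X.PrePoint → X.PrePoint → Prop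
  | left (e) : GluePoint (.inr ⟨e, 0, Set.left_mem_Icc.2 (X.len_pos e).le⟩)
      (.inl (X.Γ.graph.ends e false))
  | right (e) : GluePoint (.inr ⟨e, X.len e, Set.right_mem_Icc.2 (X.len_pos e).le⟩)
      (.inl (X.Γ.graph.ends e true))

/-- The points of the tropical curve. -/
def Point : Type := Quot X.GluePoint

def vertex (v : Fin X.Γ.n) : X.Point := Quot.mk _ (.inl v)

def onEdge (e : Fin X.Γ.m) (a : Set.Icc 0 (X.len e)) : X.Point := Quot.mk _ (.inr ⟨e, a⟩)

/-- `PathLength p q L`: there is a path of length `L` from `p` to `q`, composed of finitely many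
segments of edges. -/
inductive PathLength : X.Point → X.Point → ℝ → Prop
  | refl (p) : PathLength p p 0
  | step (p e) (a b : Set.Icc 0 (X.len e)) (L : ℝ) : PathLength p (X.onEdge e a) L →
      PathLength p (X.onEdge e b) (L + |(b : ℝ) - a|)

/-- The path metric of the tropical curve. -/
def dist (p q : X.Point) : ℝ := sInf {L | X.PathLength p q L}

open scoped Classical in
/-- The weight function on the points of the curve; it vanishes off the vertices. -/
def weight (p : X.Point) : ℕ := ∑ v with X.vertex v = p, X.Γ.weight v

/-- Automorphisms of the pointed weighted tropical curve: bijective isometries that preserve the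
marked point and the weight. -/
structure Aut where
  toEquiv : X.Point ≃ X.Point
  isometry : ∀ p q, X.dist (toEquiv p) (toEquiv q) = X.dist p q
  map_mark : toEquiv (X.vertex X.Γ.leg) = X.vertex X.Γ.leg
  map_weight : ∀ p, X.weight (toEquiv p) = X.weight p

/-- The quasistable pseudo-divisors on the stable model, whose vertices are the relevant points of
the curve. -/
abbrev Cell (X : StableCurve g) (μ : UniversalPolarization g d) : Type :=
  QD X.Γ.graph X.Γ.leg (μ.μ X.Γ) d

/-- The polyhedron `∏_{e ∈ S} [0, len e]` of `(S, D)`; a point of it gives the positions of the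
exceptional vertices on the edges. -/
abbrev Polyhedron {μ : UniversalPolarization g d} (P : X.Cell μ) : Type :=
  ∀ e : {e // e ∈ P.S}, Set.Icc 0 (X.len e)

/-- The face morphism of polyhedra of a specialization `(S, D) → (S', D')` over the identity. For
`e` in `S` but not in `S'` the edge `e` of the `S'`-subdivision comes from one of the two edges
`(e, false)`, `(e, true)`. If it is `(e, false)`, then `(e, true)` is contracted, and the
exceptional vertex moves to the end `len e`; otherwise it moves to the end `0`. -/
def faceMap {μ : UniversalPolarization g d} {P P' : X.Cell μ}
    (τ : QD.HomOver (Specialization.id X.Γ.graph) P P') (x : X.Polyhedron P') : X.Polyhedron P :=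
  open scoped Classical in
  fun e => if h : (e : Fin X.Γ.m) ∈ P'.S then x ⟨e, h⟩
    else if τ.emap (.inl ⟨e, h⟩) = .inr (e, false)
      then ⟨X.len e, Set.right_mem_Icc.2 (X.len_pos e).le⟩
      else ⟨0, Set.left_mem_Icc.2 (X.len_pos e).le⟩

/-- One-step identifications in the colimit of the polyhedra. -/
inductive GlueCell (μ : UniversalPolarization g d) :
    (Σ P : X.Cell μ, X.Polyhedron P) → (Σ P : X.Cell μ, X.Polyhedron P) → Prop
  | mk {P P' : X.Cell μ} (τ : QD.HomOver (Specialization.id X.Γ.graph) P P')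
      (x : X.Polyhedron P') : GlueCell μ ⟨P', x⟩ ⟨P, X.faceMap τ x⟩

/-- The Jacobian of the curve with respect to the marked point and `μ`: the colimit of the
polyhedra. -/
def Jacobian (μ : UniversalPolarization g d) : Type := Quot (X.GlueCell μ)

instance (μ : UniversalPolarization g d) : TopologicalSpace (X.Jacobian μ) :=
  inferInstanceAs (TopologicalSpace (Quot (X.GlueCell μ)))

open scoped Classical in
/-- The divisor on the curve parametrized by a point of a polyhedron. -/
def divisor {μ : UniversalPolarization g d} (z : Σ P : X.Cell μ, X.Polyhedron P) (p : X.Point) :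
    ℤ :=
  (∑ v with X.vertex v = p, z.1.D (.inl v)) +
    ∑ e with X.onEdge (Subtype.val e) (z.2 e) = p, z.1.D (.inr e)

/-- Two points of the Jacobian are in the same orbit of the automorphism group, which acts by
push-forward of divisors. -/
def SameOrbit (μ : UniversalPolarization g d) (y y' : X.Jacobian μ) : Prop :=
  ∃ (α : X.Aut) (z z' : Σ P : X.Cell μ, X.Polyhedron P), Quot.mk _ z = y ∧ Quot.mk _ z' = y' ∧
    ∀ p, X.divisor z' (α.toEquiv p) = X.divisor z p

/-- The quotient of the Jacobian by the automorphism group of the curve. -/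
def JacobianModAut (μ : UniversalPolarization g d) : Type := Quot (X.SameOrbit μ)

instance (μ : UniversalPolarization g d) : TopologicalSpace (X.JacobianModAut μ) :=
  inferInstanceAs (TopologicalSpace (Quot (X.SameOrbit μ)))

/-- The point of the moduli space that corresponds to the curve. -/
def moduliPoint : Mtrop g := (moduliDiagram g).incl X.Γ ⟨X.len, fun e => (X.len_pos e).le⟩

end StableCurve

end TropJac

end

noncomputable section

namespace TropJac

open scoped Classical

/-! ### Orthants and their faces -/

/-! All cones are orthants and all arrows are extensions by zero along injections of edge sets, so
the arrows are face morphisms. The diagrams are finite because stability bounds the size of a graph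
of given genus, and quasistability bounds a divisor from below at each vertex
(`QD.finite_quasistable`).

Dimension. The cone of (Γ, S, D) has dimension m + |S|. Removing S leaves Γ connected
(`QD.connected_compl`): otherwise the inequalities for the component of v₀ and for its complement,
one of them strict, would concern two numbers with sum zero. Hence |S| ≤ m - n + 1, and with
stability the dimension is at most 4g - 2 (`card_edge_le`). Conversely, a cone of smaller dimension
is a proper face of another one. A vertex of positive weight can be given a loop, a vertex of too
large valence can be split, and D lifts along these expansions (`QD.exists_lift`); if the complement
of S contains a cycle, some edge can be added to S (`QD.exists_larger`). Both existence results rest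
on the submodularity of the cut function, applied after a small perturbation that makes all
inequalities weak.

Connectedness. In a maximal cone all weights vanish, Γ is trivalent with the leg counted, the
complement of S is a spanning tree, and D is determined by S (`QD.eq_of_tree`). Up to isomorphism
the cone is thus a trivalent tree whose leaves are the leg and the halves of the edges in S.
Contracting a tree edge and expanding it differently crosses a wall (`QDObj.exists_exchange`), and
such exchanges transform every tree into one caterpillar with prescribed labels
(`Flag.Closed.caterpillar_mem`).

Fibre. Every point of the colimit has a representative with positive coordinates, unique up to
isomorphism; hence two points agree exactly if they come from one point of a common cone
(`spanProperty_jacobianDiagram`). Positions of exceptional vertices on X amount to lengths on the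
subdivided graph whose totals are the lengths of X, so the disjoint union of the polyhedra maps onto
the fibre. This map is closed, hence a quotient map, and it remains to see that it identifies
exactly the points of one orbit. Points with equal image differ by an isomorphism of the stable
model that preserves lengths. Conversely, stability makes the vertices recognisable from metric,
weights and mark, so every isometry comes from such an isomorphism (`StableCurve.Aut.exists_iso`),
and a point interior to its polyhedron is determined by its divisor
(`StableCurve.IsInterior.eq_of_divisor_eq`). -/

theorem orthant_isRationalCone (ι : Type) [Fintype ι] : IsRationalCone (orthant ι) := by
  refine ⟨Finset.univ.image fun i => Pi.single i 1, Set.ext fun x => ⟨fun hx => ?_, ?_⟩⟩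
  -- Coefficients are needed for all integral vectors. Pairing with x gives the coordinate of x at a
  -- unit vector, and the maximum with 0 ensures nonnegativity at the others.
  · refine ⟨fun s => max 0 (∑ i, (s i : ℝ) * x i), fun s => le_max_left _ _, ?_⟩
    rw [Finset.sum_image (fun i _ j _ h => by
      by_contra hij
      have := congrFun h i
      simp [hij] at this)]
    funext k
    have h : ∀ i : ι, max 0 (∑ j, ((Pi.single i (1 : ℤ) : ι → ℤ) j : ℝ) * x j) = x i := by
      intro i
      rw [Finset.sum_eq_single i]
      · simpa using hx i
      · intro j _ hj; simp [hj]
      · simp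
    simp only [h, Finset.sum_apply, Pi.smul_apply, smul_eq_mul]
    rw [Finset.sum_eq_single k]
    · simp
    · intro j _ hj; simp [hj.symm]
    · simp
  · rintro ⟨c, hc, rfl⟩ i
    simp only [Finset.sum_apply, Pi.smul_apply, smul_eq_mul]
    refine Finset.sum_nonneg fun s hs => mul_nonneg (hc s) ?_
    obtain ⟨j, -, rfl⟩ := Finset.mem_image.1 hs
    by_cases h : i = j
    · subst h; simp
    · simp [h]

theorem coneDim_orthant (ι : Type) [Fintype ι] : coneDim (orthant ι) = Fintype.card ι := by
  have h : Submodule.span ℝ (orthant ι) = ⊤ := by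
    rw [eq_top_iff, ← (Pi.basisFun ℝ ι).span_eq]
    refine Submodule.span_mono ?_
    rintro _ ⟨i, rfl⟩ j
    rw [Pi.basisFun_apply]
    by_cases h : j = i
    · subst h; simp
    · simp [h]
  rw [coneDim, h, finrank_top, Module.finrank_fintype_fun_eq_card]

section ExtendByZero

variable {ι κ : Type}

theorem extendByZero_apply {i : ι → κ} (hi : Function.Injective i) (x : orthant ι) (k : ι) :
    (extendByZero i x).1 (i k) = x.1 k := hi.extend_apply _ _ _

theorem extendByZero_apply_of_notMem {i : ι → κ} (x : orthant ι) {k : κ}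
    (hk : k ∉ Set.range i) : (extendByZero i x).1 k = 0 :=
  Function.extend_apply' _ _ _ fun ⟨a, ha⟩ => hk ⟨a, ha⟩

theorem extendByZero_eq_iff {i : ι → κ} (hi : Function.Injective i) (x : orthant ι)
    (y : orthant κ) :
    extendByZero i x = y ↔ (∀ k, y.1 (i k) = x.1 k) ∧ ∀ k ∉ Set.range i, y.1 k = 0 := by
  constructor
  · rintro rfl
    exact ⟨extendByZero_apply hi x, fun k hk => extendByZero_apply_of_notMem x hk⟩
  · rintro ⟨h1, h2⟩
    refine Subtype.ext (funext fun k => ?_)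
    by_cases hk : k ∈ Set.range i
    · obtain ⟨a, rfl⟩ := hk
      rw [extendByZero_apply hi, h1]
    · rw [extendByZero_apply_of_notMem _ hk, h2 k hk]

theorem extendByZero_comp {ρ : Type} {i : ι → κ} {j : κ → ρ} (hi : Function.Injective i)
    (hj : Function.Injective j) (x : orthant ι) :
    extendByZero j (extendByZero i x) = extendByZero (j ∘ i) x := by
  symm
  rw [extendByZero_eq_iff (hj.comp hi)]
  refine ⟨fun k => by simp [extendByZero_apply hj, extendByZero_apply hi], fun k hk => ?_⟩
  by_cases h : k ∈ Set.range j
  · obtain ⟨a, rfl⟩ := h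
    rw [extendByZero_apply hj, extendByZero_apply_of_notMem]
    rintro ⟨b, rfl⟩
    exact hk ⟨b, rfl⟩
  · rw [extendByZero_apply_of_notMem _ h]

theorem continuous_extendByZero {i : ι → κ} (hi : Function.Injective i) :
    Continuous (extendByZero i) := by
  refine Continuous.subtype_mk (continuous_pi fun k => ?_) _
  by_cases hk : k ∈ Set.range i
  · obtain ⟨a, rfl⟩ := hk
    simp only [hi.extend_apply]
    exact (continuous_apply a).comp continuous_subtype_val
  · have : ∀ x : orthant ι, Function.extend i x.1 0 k = 0 := fun x =>
      Function.extend_apply' _ _ _ fun ⟨a, ha⟩ => hk ⟨a, ha⟩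
    simp only [this]
    exact continuous_const

theorem isClosedMap_extendByZero {i : ι → κ} (hi : Function.Injective i) :
    IsClosedMap (extendByZero i) := by
  intro C hC
  let r : orthant κ → orthant ι := fun y => ⟨fun k => y.1 (i k), fun k => y.2 _⟩
  have hr : Continuous r := by
    refine continuous_induced_rng.2 (continuous_pi fun k => ?_)
    exact (continuous_apply (i k)).comp continuous_subtype_val
  have h : extendByZero i '' C = r ⁻¹' C ∩ ⋂ k ∈ (Set.range i)ᶜ, {y | y.1 k = 0} := by
    ext y
    simp only [Set.mem_image, Set.mem_inter_iff, Set.mem_preimage, Set.mem_iInter,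
      Set.mem_ofPred_eq, extendByZero_eq_iff hi]
    constructor
    · rintro ⟨x, hx, h1, h2⟩
      have : r y = x := Subtype.ext (funext h1)
      exact ⟨this ▸ hx, h2⟩
    · rintro ⟨h1, h2⟩
      exact ⟨r y, h1, fun k => rfl, h2⟩
  rw [h]
  refine (hC.preimage hr).inter (isClosed_biInter fun k _ => ?_)
  exact isClosed_eq ((continuous_apply k).comp continuous_subtype_val) continuous_const

theorem extendByZero_surjective_iff {i : ι → κ} (hi : Function.Injective i) :
    Function.Surjective (extendByZero i) ↔ Function.Surjective i := by
  constructor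
  · intro h k
    obtain ⟨x, hx⟩ := h ⟨fun _ => 1, fun _ => zero_le_one⟩
    by_contra hk
    have := extendByZero_apply_of_notMem x (k := k) (i := i) hk
    rw [hx] at this
    exact one_ne_zero this
  · intro h y
    refine ⟨⟨fun k => y.1 (i k), fun k => y.2 _⟩, ?_⟩
    rw [extendByZero_eq_iff hi]
    exact ⟨fun k => rfl, fun k hk => (hk (h k)).elim⟩

theorem isFaceMorphism_extendByZero [Fintype ι] [Fintype κ] {i : ι → κ}
    (hi : Function.Injective i) : IsFaceMorphism (extendByZero i) := by
  refine ⟨⟨Matrix.of fun k a => if i a = k then 1 else 0, fun x => ?_⟩, ?_,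
    Matrix.of fun a k => if i a = k then 1 else 0, fun x => ?_⟩
  · funext k
    change Function.extend i x.1 0 k = _
    rw [extend_eq_sum hi, Finset.sum_filter]
    simp [Matrix.mulVec, dotProduct]
  -- The sum of the coordinates off the range is nonnegative on the orthant and vanishes exactly on
  -- the image.
  · refine ⟨∑ k ∈ Finset.univ.filter (fun k => k ∉ Set.range i), LinearMap.proj k,
      fun x hx => ?_, ?_⟩
    · simpa using Finset.sum_nonneg fun k _ => hx k
    · ext y
      simp only [Set.mem_ofPred_eq, LinearMap.coe_sum, Finset.sum_apply, LinearMap.coe_proj,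
        Function.eval]
      constructor
      · rintro ⟨x, rfl⟩
        refine ⟨(extendByZero i x).2, Finset.sum_eq_zero fun k hk => ?_⟩
        exact extendByZero_apply_of_notMem x (Finset.mem_filter.1 hk).2
      · rintro ⟨hy, h⟩
        rw [Finset.sum_eq_zero_iff_of_nonneg fun k _ => hy k] at h
        refine ⟨⟨fun a => y (i a), fun a => hy _⟩, ?_⟩
        have := (extendByZero_eq_iff hi ⟨fun a => y (i a), fun a => hy _⟩ ⟨y, hy⟩).2
          ⟨fun k => rfl, fun k hk => h k (by simpa using hk)⟩
        exact congrArg Subtype.val this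
  · funext a
    simp only [Matrix.mulVec, dotProduct, Matrix.map_apply, Matrix.of_apply]
    rw [Finset.sum_eq_single (i a)]
    · simp [extendByZero_apply hi]
    · intro b _ hb; simp [hb.symm]
    · simp

end ExtendByZero

/-! ### Colimits of cone diagrams -/

namespace ConeDiagram

variable (D : ConeDiagram)

theorem incl_map {i j : D.Obj} (f : D.Hom i j) (x : D.cone i) :
    D.incl j (D.map f x) = D.incl i x := (Quot.sound (Glue.mk f x)).symm

/-- Points that are identified in the colimit are the images of a point of a common cone. -/
def SpanProperty : Prop :=
  ∀ (i j : D.Obj) (x : D.cone i) (y : D.cone j), D.incl i x = D.incl j y →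
    ∃ (c : D.Obj) (f : D.Hom c i) (g : D.Hom c j) (z : D.cone c), D.map f z = x ∧ D.map g z = y

/-- If every point comes from a point in a smallest cone and these are unique, then the
identifications in the colimit are given by spans. -/
theorem spanProperty_of_normalForm (pos : ∀ c, D.cone c → Prop)
    (normal : ∀ i (x : D.cone i), ∃ (c : D.Obj) (f : D.Hom c i) (z : D.cone c),
      pos c z ∧ D.map f z = x)
    (comp : ∀ {i j k : D.Obj} (f : D.Hom i j) (g : D.Hom j k), ∃ h : D.Hom i k,
      ∀ x, D.map h x = D.map g (D.map f x))
    (unique : ∀ {c c' i : D.Obj} (f : D.Hom c i) (f' : D.Hom c' i) (z : D.cone c)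
      (z' : D.cone c'), pos c z → pos c' z' → D.map f z = D.map f' z' →
      ∃ h : D.Hom c c', D.map h z = z') : D.SpanProperty := by
  -- Requiring the common point to be in normal form makes the relation transitive: two normal forms
  -- of the middle point are related by an arrow.
  let R : (Σ i, D.cone i) → (Σ i, D.cone i) → Prop := fun p q =>
    ∃ (c : D.Obj) (f : D.Hom c p.1) (g : D.Hom c q.1) (z : D.cone c),
      pos c z ∧ D.map f z = p.2 ∧ D.map g z = q.2
  have hR : ∀ p q, Relation.EqvGen D.Glue p q → R p q := by
    intro p q h
    induction h with
    | rel p q h =>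
      obtain ⟨k, x⟩ := h
      obtain ⟨c, f, z, hz, rfl⟩ := normal _ x
      obtain ⟨h, hh⟩ := comp f k
      exact ⟨c, f, h, z, hz, rfl, hh z⟩
    | refl p =>
      obtain ⟨c, f, z, hz, h⟩ := normal _ p.2
      exact ⟨c, f, f, z, hz, h, h⟩
    | symm p q _ ih =>
      obtain ⟨c, f, g, z, hz, h1, h2⟩ := ih
      exact ⟨c, g, f, z, hz, h2, h1⟩
    | trans p q r _ _ ih1 ih2 =>
      obtain ⟨c, f, g, z, hz, h1, h2⟩ := ih1
      obtain ⟨c', f', g', z', hz', h1', h2'⟩ := ih2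
      obtain ⟨k, hk⟩ := unique g f' z z' hz hz' (h2.trans h1'.symm)
      obtain ⟨l, hl⟩ := comp k g'
      exact ⟨c, f, l, z, hz, h1, by rw [hl, hk, h2']⟩
  intro i j x y h
  obtain ⟨c, f, g, z, -, h1, h2⟩ := hR _ _ (Quot.eqvGen_exact h)
  exact ⟨c, f, g, z, h1, h2⟩

variable {D}

theorem continuous_incl (i : D.Obj) : Continuous (D.incl i) :=
  continuous_quot_mk.comp continuous_sigmaMk

theorem isClosed_iff {s : Set D.Colimit} : IsClosed s ↔ ∀ i, IsClosed (D.incl i ⁻¹' s) := by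
  refine (isQuotientMap_quot_mk (r := D.Glue)).isClosed_preimage.symm.trans ?_
  exact isClosed_sigma_iff

/-- Closedness is tested on each cone. By the span property the preimage of the image of `C` in
another cone is a finite union, over the spans, of images under closed maps of preimages of `C`.
This later makes the parametrization of a fibre a quotient map. -/
theorem isClosedMap_incl (hD : D.SpanProperty) (hobj : Finite D.Obj)
    (hhom : ∀ i j, Finite (D.Hom i j)) (hcont : ∀ {i j} (f : D.Hom i j), Continuous (D.map f))
    (hclosed : ∀ {i j} (f : D.Hom i j), IsClosedMap (D.map f)) (i : D.Obj) :
    IsClosedMap (D.incl i) := by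
  intro C hC
  rw [isClosed_iff]
  intro j
  have h : D.incl j ⁻¹' (D.incl i '' C) =
      ⋃ (p : Σ c : D.Obj, D.Hom c i × D.Hom c j), D.map p.2.2 '' (D.map p.2.1 ⁻¹' C) := by
    ext y
    simp only [Set.mem_preimage, Set.mem_image, Set.mem_iUnion]
    constructor
    · rintro ⟨x, hx, h⟩
      obtain ⟨c, f, g, z, rfl, rfl⟩ := hD _ _ _ _ h
      exact ⟨⟨c, f, g⟩, z, hx, rfl⟩
    · rintro ⟨⟨c, f, g⟩, z, hz, rfl⟩
      exact ⟨D.map f z, hz, by rw [incl_map, incl_map]⟩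
  rw [h]
  exact isClosed_iUnion_of_finite fun p => hclosed _ _ (hC.preimage (hcont _))

end ConeDiagram

end TropJac

end

/-! ### Paths, cuts and bridges in multigraphs. -/

noncomputable section

namespace TropJac

open scoped Classical

namespace Multigraph

variable {V E V' E' : Type} {G : Multigraph V E} {S T : Set E}

theorem Reach.refl (v : V) : G.Reach S v v := Relation.EqvGen.refl v

theorem Reach.symm {v w : V} (h : G.Reach S v w) : G.Reach S w v := Relation.EqvGen.symm _ _ h

theorem Reach.trans {u v w : V} (h : G.Reach S u v) (h' : G.Reach S v w) : G.Reach S u w :=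
  Relation.EqvGen.trans _ _ _ h h'

theorem reach_ends_false_true {e : E} (he : e ∈ S) : G.Reach S (G.ends e false) (G.ends e true) :=
  Relation.EqvGen.rel _ _ ⟨e, he, rfl, rfl⟩

theorem reach_ends {e : E} (he : e ∈ S) (b b' : Bool) : G.Reach S (G.ends e b) (G.ends e b') := by
  cases b <;> cases b'
  exacts [Reach.refl _, reach_ends_false_true he, (reach_ends_false_true he).symm, Reach.refl _]

theorem Reach.map {G' : Multigraph V' E'} {S' : Set E'} (f : V → V')
    (h : ∀ e ∈ S, G'.Reach S' (f (G.ends e false)) (f (G.ends e true))) {v w : V}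
    (hvw : G.Reach S v w) : G'.Reach S' (f v) (f w) := by
  induction hvw with
  | rel v w h' => obtain ⟨e, he, rfl, rfl⟩ := h'; exact h e he
  | refl v => exact Reach.refl _
  | symm v w _ ih => exact ih.symm
  | trans u v w _ _ ih ih' => exact ih.trans ih'

theorem Reach.mono (h : S ⊆ T) {v w : V} (hvw : G.Reach S v w) : G.Reach T v w :=
  Reach.map id (fun _ he => reach_ends_false_true (h he)) hvw

theorem Reach.apply_eq {α : Type*} (f : V → α)
    (h : ∀ e ∈ S, f (G.ends e false) = f (G.ends e true)) {v w : V} (hvw : G.Reach S v w) :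
    f v = f w := by
  induction hvw with
  | rel v w h' => obtain ⟨e, he, rfl, rfl⟩ := h'; exact h e he
  | refl v => rfl
  | symm v w _ ih => exact ih.symm
  | trans u v w _ _ ih ih' => exact ih.trans ih'

/-- The edge `e` joins a vertex in `W` to one outside `W`. -/
def Crosses (G : Multigraph V E) (W : Finset V) (e : E) : Prop :=
  ¬ (G.ends e false ∈ W ↔ G.ends e true ∈ W)

section Counting

/-- The coboundary of a function on the vertices, restricted to a set of edges. -/
def coboundary (G : Multigraph V E) (F : Finset E) : (V → ℝ) →ₗ[ℝ] (F → ℝ) where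
  toFun h e := h (G.ends e true) - h (G.ends e false)
  map_add' h h' := by funext e; simp; ring
  map_smul' c h := by funext e; simp; ring

/-- The coboundary together with evaluation at a vertex. -/
def coboundaryAt (G : Multigraph V E) (F : Finset E) (v₀ : V) :
    (V → ℝ) →ₗ[ℝ] (F → ℝ) × ℝ :=
  (G.coboundary F).prod (LinearMap.proj v₀)

theorem finrank_coboundaryAt_target (F : Finset E) :
    Module.finrank ℝ ((F → ℝ) × ℝ) = F.card + 1 := by
  simp

theorem coboundaryAt_injective {F : Finset E} (hF : ∀ v w, G.Reach (F : Set E) v w) (v₀ : V) :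
    Function.Injective (G.coboundaryAt F v₀) := by
  rw [injective_iff_map_eq_zero]
  intro h hh
  have h1 : ∀ e ∈ (F : Set E), h (G.ends e false) = h (G.ends e true) := fun e he =>
    (sub_eq_zero.1 (congrFun (congrArg Prod.fst hh) ⟨e, he⟩)).symm
  have h2 : h v₀ = 0 := congrArg Prod.snd hh
  funext v
  rw [(hF v v₀).apply_eq h h1, h2]
  rfl

/-- A function with zero coboundary on a connected graph is constant, so coboundary and evaluation
at one vertex together are injective; dimensions are compared. -/
theorem card_le_of_connected [Fintype V] {F : Finset E} (hF : ∀ v w, G.Reach (F : Set E) v w) :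
    Fintype.card V ≤ F.card + 1 := by
  rcases isEmpty_or_nonempty V with h | ⟨⟨v₀⟩⟩
  · simp
  · rw [← finrank_coboundaryAt_target F, ← Module.finrank_fintype_fun_eq_card ℝ]
    exact LinearMap.finrank_le_finrank_of_injective (coboundaryAt_injective hF v₀)

theorem coboundary_indicator (F : Finset E) (W : Finset V) (e : F) :
    (G.Crosses W e → G.coboundary F (fun v => if v ∈ W then 1 else 0) e = 1 ∨
      G.coboundary F (fun v => if v ∈ W then 1 else 0) e = -1) ∧
    (¬ G.Crosses W e → G.coboundary F (fun v => if v ∈ W then 1 else 0) e = 0) := by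
  simp only [Crosses, coboundary, LinearMap.coe_mk, AddHom.coe_mk]
  by_cases h1 : G.ends e false ∈ W <;> by_cases h2 : G.ends e true ∈ W <;> simp [h1, h2]

/-- A set of edges of cardinality at least the number of vertices contains an edge that is not a
bridge. -/
theorem exists_not_bridge [Fintype V] [Nonempty V] {F : Finset E} (hF : Fintype.card V ≤ F.card) :
    ∃ e ∈ F, ∀ W, G.Crosses W e → ∃ e' ∈ F, e' ≠ e ∧ G.Crosses W e' := by
  -- If each edge of `F` is the only one crossing some cut, the coboundaries of the indicators of
  -- these cuts are the unit vectors up to sign. Then the coboundary and, using constants, also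
  -- `coboundaryAt` are surjective, so |F| + 1 ≤ |V|.
  by_contra! hcon
  obtain ⟨v₀⟩ := ‹Nonempty V›
  choose W hW hW' using hcon
  have hsurj : Function.Surjective (G.coboundary F) := by
    intro y
    refine ⟨∑ e : F, (y e * G.coboundary F (fun v => if v ∈ W e e.2 then 1 else 0) e) •
      (fun v => if v ∈ W e e.2 then (1 : ℝ) else 0), ?_⟩
    funext f
    rw [map_sum, Finset.sum_apply, Finset.sum_eq_single f]
    · rw [map_smul, Pi.smul_apply, smul_eq_mul]
      rcases (coboundary_indicator F (W f f.2) f).1 (hW f f.2) with h | h <;> rw [h] <;> ring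
    · intro e _ he
      rw [map_smul, Pi.smul_apply, (coboundary_indicator F (W e e.2) f).2, smul_zero]
      exact hW' e e.2 f f.2 (fun h => he (Subtype.ext h.symm))
    · simp
  have hsurj' : Function.Surjective (G.coboundaryAt F v₀) := by
    rintro ⟨y, t⟩
    obtain ⟨h, rfl⟩ := hsurj y
    refine ⟨fun v => h v + (t - h v₀), Prod.ext ?_ ?_⟩
    · funext e
      simp [coboundaryAt, coboundary]
    · simp [coboundaryAt]
  have := LinearMap.finrank_le_finrank_of_surjective hsurj'
  rw [finrank_coboundaryAt_target, Module.finrank_fintype_fun_eq_card] at this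
  omega

/-- Every edge of a tree is a bridge. -/
theorem exists_cut_of_tree [Fintype V] {F : Finset E} (hF : ∀ v w, G.Reach (F : Set E) v w)
    (hcard : Fintype.card V = F.card + 1) {e : E} (he : e ∈ F) :
    ∃ W, G.Crosses W e ∧ ∀ e' ∈ F, e' ≠ e → ¬ G.Crosses W e' := by
  let v₀ := G.ends e false
  have hinj := coboundaryAt_injective hF v₀
  have hsurj : Function.Surjective (G.coboundaryAt F v₀) :=
    (LinearMap.injective_iff_surjective_of_finrank_eq_finrank
      (by rw [finrank_coboundaryAt_target, Module.finrank_fintype_fun_eq_card, hcard])).1 hinj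
  obtain ⟨h, hh⟩ := hsurj (Pi.single ⟨e, he⟩ 1, 0)
  have h1 : ∀ f (hf : f ∈ F), h (G.ends f true) - h (G.ends f false) =
      (Pi.single ⟨e, he⟩ 1 : F → ℝ) ⟨f, hf⟩ := fun f hf =>
    congrFun (congrArg Prod.fst hh) ⟨f, hf⟩
  -- For a tree `coboundaryAt` is bijective. The function `h` jumps by 1 along `e` and is constant
  -- along all other edges of `F`, so its level sets are cut out by `e` alone.
  refine ⟨Finset.univ.filter fun v => h v = h (G.ends e true), ?_, fun f hf hfe => ?_⟩
  · have := h1 e he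
    rw [Pi.single_eq_same] at this
    simp only [Crosses, Finset.mem_filter, Finset.mem_univ, true_and]
    intro h2
    have := h2.2 trivial
    linarith
  · have := h1 f hf
    rw [Pi.single_eq_of_ne (by simpa using hfe), sub_eq_zero] at this
    simp [Crosses, this]

/-- The indicator of a vertex minus a suitable combination of the cut indicators has zero
coboundary, hence is constant. Since `x` is orthogonal to constants and to the cuts, it vanishes at
that vertex. -/
theorem eq_zero_of_cut_sums [Fintype V] {F : Finset E} (hF : ∀ v w, G.Reach (F : Set E) v w) (x : V → ℝ)
    (hx : ∑ v, x v = 0)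
    (hcut : ∀ e ∈ F, ∃ W, G.Crosses W e ∧ (∀ e' ∈ F, e' ≠ e → ¬ G.Crosses W e') ∧
      ∑ v ∈ W, x v = 0) : x = 0 := by
  choose! W hW1 hW2 hW3 using hcut
  let ind : E → V → ℝ := fun e v => if v ∈ W e then 1 else 0
  have hind : ∀ e ∈ F, ∑ v, x v * ind e v = 0 := by
    intro e he
    rw [← hW3 e he]
    simp [ind]
  funext v₀
  let h₀ : V → ℝ := Pi.single v₀ 1
  let h : V → ℝ := h₀ - ∑ e : F, (G.coboundary F h₀ e * G.coboundary F (ind e) e) • ind e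
  have hh : G.coboundary F h = 0 := by
    funext f
    rw [map_sub, map_sum, Pi.sub_apply, Finset.sum_apply, Finset.sum_eq_single f]
    · rw [map_smul, Pi.smul_apply, smul_eq_mul, Pi.zero_apply]
      rcases (coboundary_indicator F (W f) f).1 (hW1 f f.2) with h | h <;> simp only [ind, h] <;>
        ring
    · intro e _ he
      rw [map_smul, Pi.smul_apply, (coboundary_indicator F (W e) f).2, smul_zero]
      exact hW2 e e.2 f f.2 (fun h => he (Subtype.ext h.symm))
    · simp
  have hconst : ∀ v, h v = h v₀ := fun v => (hF v v₀).apply_eq h fun e he =>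
    (sub_eq_zero.1 (congrFun hh ⟨e, he⟩)).symm
  have h1 : ∑ v, x v * h v = 0 := by
    simp only [hconst, ← Finset.sum_mul, hx, zero_mul]
  have h2 : ∑ v, x v * h v = x v₀ := by
    simp only [h, Pi.sub_apply, mul_sub, Finset.sum_sub_distrib, Finset.sum_apply, Pi.smul_apply,
      smul_eq_mul, Finset.mul_sum]
    rw [Finset.sum_comm (s := (Finset.univ : Finset V)), Finset.sum_eq_zero (s := Finset.univ (α := F)), sub_zero]
    · simp [h₀, Pi.single_apply]
    · intro e _
      have := hind e e.2
      calc _ = (G.coboundary F h₀ e * G.coboundary F (ind e) e) * ∑ v, x v * ind e v := by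
            rw [Finset.mul_sum]; refine Finset.sum_congr rfl fun v _ => by ring
        _ = 0 := by rw [this, mul_zero]
  rw [← h2, h1]
  rfl

end Counting

end Multigraph

/-! ### Specializations -/

namespace Specialization

open Multigraph

variable {V E V' E' V'' E'' : Type} {G : Multigraph V E} {H : Multigraph V' E'}
  {K : Multigraph V'' E''}

theorem vmap_contracted (φ : Specialization G H) {e : E} (he : e ∉ Set.range φ.emap)
    (b b' : Bool) : φ.vmap (G.ends e b) = φ.vmap (G.ends e b') :=
  (φ.vmap_eq_iff _ _).2 (reach_ends he b b')

/-- Paths lift because the fibres are connected by contracted edges, and these belong to the set on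
the right vacuously. This is what makes compositions and factorizations specializations again. -/
theorem reach_vmap_iff (φ : Specialization G H) (T : Set E') (v w : V) :
    H.Reach T (φ.vmap v) (φ.vmap w) ↔
      G.Reach {e | ∀ e', φ.emap e' = e → e' ∈ T} v w := by
  have hsub : (Set.range φ.emap)ᶜ ⊆ {e | ∀ e', φ.emap e' = e → e' ∈ T} :=
    fun e he e' h => (he ⟨e', h⟩).elim
  constructor
  · intro h
    let s : V' → V := Function.surjInv φ.vmap_surjective
    have hs : ∀ v, G.Reach {e | ∀ e', φ.emap e' = e → e' ∈ T} (s (φ.vmap v)) v := fun v =>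
      ((φ.vmap_eq_iff _ _).1 (Function.surjInv_eq φ.vmap_surjective (φ.vmap v))).mono hsub
    refine (hs v).symm.trans (Reach.trans (Reach.map s (fun e he => ?_) h) (hs w))
    have h1 : ∀ b, H.ends e b = φ.vmap (G.ends (φ.emap e) (xor b (φ.flip e))) := fun b => by
      rw [φ.vmap_ends]; simp
    rw [h1, h1]
    refine (hs _).trans (Reach.trans (reach_ends ?_ _ _) (hs _).symm)
    intro e' h
    rwa [φ.emap_injective h]
  · refine Reach.map _ fun e he => ?_
    by_cases h : e ∈ Set.range φ.emap
    · obtain ⟨e', rfl⟩ := h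
      rw [φ.vmap_ends, φ.vmap_ends]
      exact reach_ends (he _ rfl) _ _
    · rw [φ.vmap_contracted h false true]
      exact Reach.refl _

/-- A specialization given by a section of the map on vertices. -/
def ofSection (vmap : V → V') (emap : E' → E) (flip : E' → Bool) (sec : V' → V)
    (emap_injective : Function.Injective emap)
    (vmap_ends : ∀ e' b, vmap (G.ends (emap e') b) = H.ends e' (xor b (flip e')))
    (contracted : ∀ e ∉ Set.range emap, vmap (G.ends e false) = vmap (G.ends e true))
    (vmap_sec : ∀ v', vmap (sec v') = v')
    (reach_sec : ∀ v, G.Reach (Set.range emap)ᶜ v (sec (vmap v))) : Specialization G H where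
  vmap := vmap
  emap := emap
  flip := flip
  vmap_surjective v' := ⟨sec v', vmap_sec v'⟩
  emap_injective := emap_injective
  vmap_ends := vmap_ends
  vmap_eq_iff v w := by
    constructor
    · intro h
      exact (reach_sec v).trans (h ▸ (reach_sec w).symm)
    · exact Reach.apply_eq vmap contracted

/-- Composition of specializations. -/
def comp (ψ : Specialization H K) (φ : Specialization G H) : Specialization G K where
  vmap := ψ.vmap ∘ φ.vmap
  emap := φ.emap ∘ ψ.emap
  flip e := xor (φ.flip (ψ.emap e)) (ψ.flip e)
  vmap_surjective := ψ.vmap_surjective.comp φ.vmap_surjective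
  emap_injective := φ.emap_injective.comp ψ.emap_injective
  vmap_ends e b := by
    simp only [Function.comp_apply, φ.vmap_ends, ψ.vmap_ends, Bool.xor_assoc]
  vmap_eq_iff v w := by
    simp only [Function.comp_apply]
    rw [ψ.vmap_eq_iff, φ.reach_vmap_iff]
    refine iff_of_eq (congrArg (fun S => G.Reach S v w) ?_)
    ext e
    simp only [Set.mem_ofPred_eq, Set.mem_compl_iff, Set.mem_range, Function.comp_apply, not_exists]
    exact ⟨fun h x hx => h _ hx x rfl, fun h e' he' x hx => h x (by rw [hx, he'])⟩

/-- As `ψ` contracts all edges contracted by `φ`, it is constant on the fibres of `φ` and descends.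
This universal property yields the uniqueness of normal forms in the colimits. -/
theorem exists_factor (φ : Specialization G H) (ψ : Specialization G K)
    (h : Set.range ψ.emap ⊆ Set.range φ.emap) :
    ∃ χ : Specialization H K, (∀ v, χ.vmap (φ.vmap v) = ψ.vmap v) ∧
      (∀ e, φ.emap (χ.emap e) = ψ.emap e) ∧
      ∀ e, χ.flip e = xor (φ.flip (χ.emap e)) (ψ.flip e) := by
  have hle : ∀ v w, φ.vmap v = φ.vmap w → ψ.vmap v = ψ.vmap w := fun v w hvw =>
    (ψ.vmap_eq_iff _ _).2 (((φ.vmap_eq_iff _ _).1 hvw).mono (Set.compl_subset_compl.2 h))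
  let s : V' → V := Function.surjInv φ.vmap_surjective
  have hs : ∀ v, φ.vmap (s v) = v := Function.surjInv_eq φ.vmap_surjective
  have h' : ∀ e, ∃ e', φ.emap e' = ψ.emap e := fun e => h ⟨e, rfl⟩
  choose ε hε using h'
  have hv : ∀ v, ψ.vmap (s (φ.vmap v)) = ψ.vmap v := fun v => hle _ _ (hs _)
  refine ⟨{ vmap := fun v => ψ.vmap (s v), emap := ε,
            flip := fun e => xor (φ.flip (ε e)) (ψ.flip e),
            vmap_surjective := ?_, emap_injective := ?_, vmap_ends := ?_, vmap_eq_iff := ?_ },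
    hv, hε, fun _ => rfl⟩
  · intro k
    obtain ⟨v, rfl⟩ := ψ.vmap_surjective k
    exact ⟨φ.vmap v, hv v⟩
  · intro e e' hee
    exact ψ.emap_injective (by rw [← hε, ← hε, hee])
  · intro e b
    have h1 : H.ends (ε e) b = φ.vmap (G.ends (φ.emap (ε e)) (xor b (φ.flip (ε e)))) := by
      rw [φ.vmap_ends]; simp
    rw [h1, hv, hε, ψ.vmap_ends, Bool.xor_assoc]
  · intro v w
    rw [ψ.vmap_eq_iff]
    conv_rhs => rw [← hs v, ← hs w, φ.reach_vmap_iff]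
    refine iff_of_eq (congrArg (fun S => G.Reach S _ _) ?_)
    ext e
    simp only [Set.mem_ofPred_eq, Set.mem_compl_iff, Set.mem_range, not_exists]
    constructor
    · rintro h e' rfl x rfl
      exact h x (hε x).symm
    · rintro h' x rfl
      exact h' (ε x) (hε x) x rfl

/-- The contracted edges over a vertex. -/
def contractedOver [Fintype E] (φ : Specialization G H) (v' : V') : Finset E :=
  Finset.univ.filter fun e => e ∉ Set.range φ.emap ∧ φ.vmap (G.ends e false) = v'

theorem mem_contractedOver [Fintype E] {φ : Specialization G H} {v' : V'} {e : E} :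
    e ∈ φ.contractedOver v' ↔ e ∉ Set.range φ.emap ∧ φ.vmap (G.ends e false) = v' := by
  simp [contractedOver]

/-- The compatibility of the weights with a contraction: the weight of a vertex is the genus of its
preimage. -/
def IsWeighted [Fintype V] [Fintype E] (φ : Specialization G H) (w : V → ℕ) (w' : V' → ℕ) : Prop :=
  ∀ v', w' v' + (Finset.univ.filter fun v => φ.vmap v = v').card =
    (∑ v with φ.vmap v = v', w v) + (φ.contractedOver v').card + 1

variable {γ : Type*}

theorem sum_fiber_fiber {α β M : Type*} [Fintype α] [Fintype β] [AddCommMonoid M] (f : α → β)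
    (f' : β → γ) (c : γ) (p : α → Prop) [DecidablePred p] (x : α → M) :
    ∑ b with f' b = c, ∑ a with p a ∧ f a = b, x a = ∑ a with p a ∧ f' (f a) = c, x a := by
  simp only [Finset.sum_filter]
  have : ∀ b, (if f' b = c then ∑ a, (if p a ∧ f a = b then x a else 0) else 0) =
      ∑ a, if b = f a then (if p a ∧ f' (f a) = c then x a else 0) else 0 := by
    intro b
    split_ifs with h
    · refine Finset.sum_congr rfl fun a _ => ?_
      by_cases hb : b = f a
      · subst hb; simp [h]
      · simp [hb, Ne.symm hb]
    · symm
      refine Finset.sum_eq_zero fun a _ => ?_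
      by_cases hb : b = f a
      · subst hb; simp [h]
      · simp [hb]
  simp only [this]
  rw [Finset.sum_comm]
  simp

theorem sum_fiber {α β M : Type*} [Fintype α] [Fintype β] [AddCommMonoid M] (f : α → β)
    (f' : β → γ) (c : γ) (x : α → M) :
    ∑ b with f' b = c, ∑ a with f a = b, x a = ∑ a with f' (f a) = c, x a := by
  simpa using sum_fiber_fiber f f' c (fun _ => True) x

theorem card_fiber_fiber {α β : Type*} [Fintype α] [Fintype β] (f : α → β)
    (f' : β → γ) (c : γ) (p : α → Prop) [DecidablePred p] :
    ∑ b with f' b = c, (Finset.univ.filter fun a => p a ∧ f a = b).card =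
      (Finset.univ.filter fun a => p a ∧ f' (f a) = c).card := by
  simp only [Finset.card_eq_sum_ones]
  exact sum_fiber_fiber f f' c p _

/-- The edges contracted by the composite are those contracted by `φ` and, disjointly, the lifts of
those contracted by `ψ`. -/
theorem card_contractedOver [Fintype V'] [Fintype E] [Fintype E'] {φ : Specialization G H}
    {ψ : Specialization H K} {χ : Specialization G K} (hv : ∀ v, ψ.vmap (φ.vmap v) = χ.vmap v)
    (he : ∀ e, φ.emap (ψ.emap e) = χ.emap e) (k : V'') :
    (χ.contractedOver k).card =
      (∑ v with ψ.vmap v = k, (φ.contractedOver v).card) + (ψ.contractedOver k).card := by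
  have h : ∑ v with ψ.vmap v = k, (φ.contractedOver v).card = (Finset.univ.filter fun e =>
      e ∉ Set.range φ.emap ∧ ψ.vmap (φ.vmap (G.ends e false)) = k).card := by
    rw [← card_fiber_fiber (fun e => φ.vmap (G.ends e false)) ψ.vmap k
      (fun e => e ∉ Set.range φ.emap)]
    refine Finset.sum_congr rfl fun v _ => congrArg Finset.card (Finset.ext fun e => ?_)
    simp [contractedOver]
  rw [h, ← Finset.card_image_of_injective (ψ.contractedOver k) φ.emap_injective,
    ← Finset.card_union_of_disjoint]
  · congr 1
    have hψ : ∀ e ∉ Set.range ψ.emap, ψ.vmap (φ.vmap (G.ends (φ.emap e) false)) =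
        ψ.vmap (H.ends e false) := fun e he => by
      rw [φ.vmap_ends]
      exact ψ.vmap_contracted he _ _
    ext e
    simp only [Finset.mem_filter, Finset.mem_univ, true_and, Finset.mem_union, Finset.mem_image,
      mem_contractedOver, ← hv]
    constructor
    · rintro ⟨h1, h2⟩
      by_cases he' : e ∈ Set.range φ.emap
      · obtain ⟨e', rfl⟩ := he'
        have he' : e' ∉ Set.range ψ.emap := by
          rintro ⟨x, rfl⟩
          exact h1 ⟨x, (he x).symm⟩
        exact Or.inr ⟨e', ⟨he', by rw [← hψ e' he', h2]⟩, rfl⟩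
      · exact Or.inl ⟨he', h2⟩
    · rintro (⟨h1, h2⟩ | ⟨e', ⟨h1, h2⟩, rfl⟩)
      · refine ⟨?_, h2⟩
        rintro ⟨x, rfl⟩
        exact h1 ⟨_, he x⟩
      · refine ⟨?_, by rw [hψ e' h1, h2]⟩
        rintro ⟨x, hx⟩
        exact h1 ⟨x, φ.emap_injective ((he x).trans hx)⟩
  · rw [Finset.disjoint_left]
    intro e h1 h2
    obtain ⟨e', -, rfl⟩ := Finset.mem_image.1 h2
    exact (Finset.mem_filter.1 h1).2.1 ⟨e', rfl⟩

/-- The genus can be computed in two stages: the weight formulas of `φ` are summed over a fibre of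
`ψ`. One direction serves compositions, the other one factorizations. -/
theorem IsWeighted.comp_iff [Fintype V] [Fintype E] [Fintype V'] [Fintype E']
    {φ : Specialization G H} {ψ : Specialization H K} {χ : Specialization G K}
    (hv : ∀ v, ψ.vmap (φ.vmap v) = χ.vmap v) (he : ∀ e, φ.emap (ψ.emap e) = χ.emap e)
    {w : V → ℕ} {w' : V' → ℕ} {w'' : V'' → ℕ} (hφ : φ.IsWeighted w w') :
    ψ.IsWeighted w' w'' ↔ χ.IsWeighted w w'' := by
  refine forall_congr' fun k => ?_
  have h1 := Finset.sum_congr (rfl : Finset.univ.filter (fun v => ψ.vmap v = k) = _)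
    fun v (_ : v ∈ Finset.univ.filter fun v => ψ.vmap v = k) => hφ v
  simp only [Finset.sum_add_distrib, Finset.sum_const, smul_eq_mul, mul_one] at h1
  have h2 := card_contractedOver hv he k
  have h4 := sum_fiber φ.vmap ψ.vmap k w
  have h3 := sum_fiber φ.vmap ψ.vmap k (fun _ => 1)
  simp only [← Finset.card_eq_sum_ones] at h3
  simp only [hv] at h3 h4
  rw [h3, h4] at h1
  rw [h2]
  omega

end Specialization

end TropJac

end

/-! ### Numbering, finiteness and contraction of stable graphs. -/

noncomputable section

namespace TropJac

open scoped Classical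

namespace Specialization

open Multigraph

variable {V E V' E' : Type} {G : Multigraph V E} {H : Multigraph V' E'}

theorem vmap_injective (φ : Specialization G H) (h : Function.Surjective φ.emap) :
    Function.Injective φ.vmap := by
  intro v w hvw
  have h1 := (φ.vmap_eq_iff v w).1 hvw
  exact h1.apply_eq (fun v => v) fun e he => (he (h e)).elim

theorem contractedOver_eq_empty [Fintype E] (φ : Specialization G H)
    (h : Function.Surjective φ.emap) (v' : V') : φ.contractedOver v' = ∅ := by
  ext e
  simp [mem_contractedOver, h.range_eq]

theorem filter_vmap_eq [Fintype V] (φ : Specialization G H) (h : Function.Surjective φ.emap)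
    (v : V) : (Finset.univ.filter fun u => φ.vmap u = φ.vmap v) = {v} := by
  ext u
  simp [(φ.vmap_injective h).eq_iff]

theorem isWeighted_iff_of_surjective [Fintype V] [Fintype E] (φ : Specialization G H)
    (h : Function.Surjective φ.emap) (w : V → ℕ) (w' : V' → ℕ) :
    φ.IsWeighted w w' ↔ ∀ v, w' (φ.vmap v) = w v := by
  refine φ.vmap_surjective.forall.trans (forall_congr' fun v => ?_)
  rw [filter_vmap_eq φ h, contractedOver_eq_empty φ h]
  simp

/-- The preimage of a vertex is a connected graph. -/
theorem card_fiber_le [Fintype V] [Fintype E] (φ : Specialization G H) (v' : V') :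
    (Finset.univ.filter fun v => φ.vmap v = v').card ≤ (φ.contractedOver v').card + 1 := by
  let G' : Multigraph {v // φ.vmap v = v'} {e // e ∈ φ.contractedOver v'} :=
    ⟨fun e b => ⟨G.ends e b, by
      obtain ⟨h1, h2⟩ := mem_contractedOver.1 e.2
      rw [φ.vmap_contracted h1 b false, h2]⟩⟩
  have hreach : ∀ v w, G.Reach (Set.range φ.emap)ᶜ v w → ∀ (hv : φ.vmap v = v')
      (hw : φ.vmap w = v'), G'.Reach (Finset.univ : Finset {e // e ∈ φ.contractedOver v'}) ⟨v, hv⟩ ⟨w, hw⟩ := by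
    intro v w h
    induction h with
    | rel v w h =>
      obtain ⟨e, he, rfl, rfl⟩ := h
      intro hv hw
      exact reach_ends_false_true (G := G') (e := ⟨e, mem_contractedOver.2 ⟨he, hv⟩⟩) (by simp)
    | refl v => intro _ _; exact Reach.refl _
    | symm v w _ ih => intro hv hw; exact (ih hw hv).symm
    | trans u v w h _ ih ih' =>
      intro hu hw
      have hv : φ.vmap v = v' := by rw [← hu]; exact ((φ.vmap_eq_iff _ _).2 h).symm
      exact (ih hu hv).trans (ih' hv hw)
  have h := card_le_of_connected (G := G') (F := Finset.univ) fun v w =>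
    hreach v w ((φ.vmap_eq_iff _ _).1 (v.2.trans w.2.symm)) v.2 w.2
  rw [Fintype.card_subtype, Finset.card_univ, Fintype.card_coe] at h
  convert h

/-- The half-edges attached to the fibre either survive, and then correspond to those at `v'`, or
occur in pairs as the halves of an edge contracted to `v'`. -/
theorem sum_val_eq [Fintype E] [Fintype V] [Fintype E'] (φ : Specialization G H) (v' : V') :
    ∑ v with φ.vmap v = v', G.val v = H.val v' + 2 * (φ.contractedOver v').card := by
  have h1 : ∑ v with φ.vmap v = v', G.val v =
      (Finset.univ.filter fun p : E × Bool => φ.vmap (G.ends p.1 p.2) = v').card := by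
    simp only [val, Finset.card_eq_sum_ones]
    exact sum_fiber (fun p : E × Bool => G.ends p.1 p.2) φ.vmap v' (fun _ => 1)
  have h2 : H.val v' = ((Finset.univ.filter fun p : E × Bool =>
      φ.vmap (G.ends p.1 p.2) = v').filter fun p => p.1 ∈ Set.range φ.emap).card := by
    refine Finset.card_bij (fun p _ => (φ.emap p.1, xor p.2 (φ.flip p.1))) ?_ ?_ ?_
    · intro p hp
      simp only [Finset.mem_filter, Finset.mem_univ, true_and, φ.vmap_ends] at hp ⊢
      exact ⟨by simpa using hp, _, rfl⟩
    · rintro ⟨e, b⟩ _ ⟨e', b'⟩ _ h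
      simp only [Prod.mk.injEq] at h
      obtain rfl := φ.emap_injective h.1
      simpa using h.2
    · rintro ⟨e, b⟩ hp
      simp only [Finset.mem_filter, Finset.mem_univ, true_and] at hp
      obtain ⟨h, e', rfl⟩ := hp
      rw [φ.vmap_ends] at h
      exact ⟨(e', xor b (φ.flip e')), by simpa using h, by simp⟩
  have h3 : 2 * (φ.contractedOver v').card = ((Finset.univ.filter fun p : E × Bool =>
      φ.vmap (G.ends p.1 p.2) = v').filter fun p => ¬ p.1 ∈ Set.range φ.emap).card := by
    have : ((Finset.univ.filter fun p : E × Bool =>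
      φ.vmap (G.ends p.1 p.2) = v').filter fun p => ¬ p.1 ∈ Set.range φ.emap) =
        φ.contractedOver v' ×ˢ Finset.univ := by
      ext ⟨e, b⟩
      simp only [Finset.mem_filter, Finset.mem_univ, true_and, Finset.mem_product,
        mem_contractedOver, and_true]
      constructor
      · rintro ⟨h1, h2⟩
        exact ⟨h2, by rw [φ.vmap_contracted h2 false b, h1]⟩
      · rintro ⟨h1, h2⟩
        exact ⟨by rw [φ.vmap_contracted h1 b false, h2], h1⟩
    rw [this, Finset.card_product]
    simp [mul_comm]
  rw [h1, h2, h3, Finset.card_filter_add_card_filter_not]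

theorem val_eq_of_surjective [Fintype E] [Fintype V] [Fintype E'] (φ : Specialization G H)
    (h : Function.Surjective φ.emap) (v : V) : H.val (φ.vmap v) = G.val v := by
  have := φ.sum_val_eq (φ.vmap v)
  rw [filter_vmap_eq φ h, contractedOver_eq_empty φ h] at this
  simpa using this.symm

theorem connected (φ : Specialization G H) (hG : G.Connected) : H.Connected := by
  intro v w
  obtain ⟨v, rfl⟩ := φ.vmap_surjective v
  obtain ⟨w, rfl⟩ := φ.vmap_surjective w
  rw [φ.reach_vmap_iff]
  exact (hG v w).mono fun e _ => by simp

/-- The identification of a graph with its copy on other sets of vertices and edges. -/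
def relabel (G : Multigraph V E) (eV : V ≃ V') (eE : E ≃ E') :
    Specialization G ⟨fun e b => eV (G.ends (eE.symm e) b)⟩ :=
  ofSection eV eE.symm (fun _ => false) eV.symm eE.symm.injective (by simp)
    (fun e he => (he (eE.symm.surjective e)).elim) (by simp) fun v => by
      rw [Equiv.symm_apply_apply]; exact Reach.refl _

/-- The contraction of a set of edges. -/
def contraction (G : Multigraph V E) (Z : Set E) : Specialization G
    (⟨fun e b => Quot.mk _ (G.ends e b)⟩ :
      Multigraph (Quot (G.Reach Z)) {e // e ∉ Z}) where
  vmap := Quot.mk _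
  emap := Subtype.val
  flip _ := false
  vmap_surjective := Quot.mk_surjective
  emap_injective := Subtype.val_injective
  vmap_ends := by simp
  vmap_eq_iff v w := by
    have h : (Set.range (Subtype.val : {e // e ∉ Z} → E))ᶜ = Z := by ext; simp
    rw [h]
    have : Equivalence (G.Reach Z) := ⟨Reach.refl, Reach.symm, Reach.trans⟩
    exact this.quot_mk_eq_iff v w

theorem range_contraction (G : Multigraph V E) (Z : Set E) :
    Set.range (contraction G Z).emap = Zᶜ := by
  ext
  simp [contraction]

end Specialization

namespace StableGraph

open Multigraph TropJac.Specialization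

variable {g : ℕ} {Γ Γ' Γ'' : StableGraph g}

theorem sum_val (Γ : StableGraph g) : ∑ v, Γ.graph.val v = 2 * Γ.m := by
  have h := Finset.card_eq_sum_card_fiberwise (s := (Finset.univ : Finset (Fin Γ.m × Bool)))
    (t := Finset.univ) (f := fun p => Γ.graph.ends p.1 p.2) (fun _ _ => Finset.mem_univ _)
  simp only [Finset.card_univ, Fintype.card_prod, Fintype.card_fin, Fintype.card_bool] at h
  rw [mul_comm, h]
  refine Finset.sum_congr rfl fun v _ => ?_
  exact congrArg Finset.card (Finset.ext fun p => by simp)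

/-- The stability inequalities are summed over all vertices, the leg contributing 1. With the genus
formula this yields n ≤ 2g - 1 and m + Σw ≤ 3g - 2. -/
theorem three_mul_n_le (Γ : StableGraph g) : 3 * Γ.n ≤ 2 * Γ.m + 2 * ∑ v, Γ.weight v + 1 := by
  have h : ∑ v : Fin Γ.n, 3 ≤ ∑ v, (Γ.graph.val v + 2 * Γ.weight v + if v = Γ.leg then 1 else 0) :=
    Finset.sum_le_sum fun v _ => Γ.stable v
  rw [Finset.sum_add_distrib, Finset.sum_add_distrib, Γ.sum_val, ← Finset.mul_sum] at h
  simpa [mul_comm] using h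

theorem n_lt (Γ : StableGraph g) : Γ.n + 1 ≤ 2 * g := by
  have := Γ.three_mul_n_le
  have := Γ.genus_eq
  omega

theorem m_add_weight_le (Γ : StableGraph g) : Γ.m + ∑ v, Γ.weight v + 2 ≤ 3 * g := by
  have := Γ.n_lt
  have := Γ.genus_eq
  omega

theorem sum_weight_le (Γ : StableGraph g) : ∑ v, Γ.weight v ≤ g := by
  have h := card_le_of_connected (G := Γ.graph) (F := Finset.univ) (by
    rw [Finset.coe_univ]; exact Γ.connected)
  have := Γ.genus_eq
  simp only [Fintype.card_fin, Finset.card_univ] at h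
  omega

instance : Finite (StableGraph g) := by
  have hw : ∀ (Γ : StableGraph g) v, Γ.weight v < g + 1 := fun Γ v =>
    Nat.lt_succ_of_le ((Finset.single_le_sum (fun _ _ => Nat.zero_le _)
      (Finset.mem_univ v)).trans Γ.sum_weight_le)
  let f : StableGraph g → Σ n : Fin (2 * g), Σ m : Fin (3 * g),
      (Fin m → Bool → Fin n) × (Fin n → Fin (g + 1)) × Fin n := fun Γ => ⟨⟨Γ.n, Γ.n_lt⟩, ⟨Γ.m, by have := Γ.m_add_weight_le; omega⟩,
    Γ.graph.ends, fun v => ⟨Γ.weight v, hw Γ v⟩, Γ.leg⟩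
  refine Finite.of_injective f ?_
  rintro ⟨n, m, ⟨e⟩, w, l, h1, h2, h3⟩ ⟨n', m', ⟨e'⟩, w', l', h1', h2', h3'⟩ h
  simp only [f, Sigma.mk.injEq, Fin.mk.injEq] at h
  obtain ⟨rfl, h⟩ := h
  simp only [heq_eq_eq, Sigma.mk.injEq, Fin.mk.injEq] at h
  obtain ⟨rfl, h⟩ := h
  simp only [heq_eq_eq, Prod.mk.injEq] at h
  obtain ⟨rfl, h, rfl⟩ := h
  have : w = w' := funext fun v => by simpa using congrFun h v
  subst this
  rfl

theorem Hom.isWeighted (φ : Hom Γ Γ') : φ.toSpecialization.IsWeighted Γ.weight Γ'.weight := by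
  intro v'
  have := φ.map_weight v'
  simp only [contractedOver]
  convert this

/-- A specialization compatible with legs and weights. -/
def Hom.ofIsWeighted (φ : Specialization Γ.graph Γ'.graph) (hleg : φ.vmap Γ.leg = Γ'.leg)
    (hw : φ.IsWeighted Γ.weight Γ'.weight) : Hom Γ Γ' where
  toSpecialization := φ
  map_leg := hleg
  map_weight v' := by
    have := hw v'
    simp only [contractedOver] at this
    convert this

/-- The identity specialization. -/
def Hom.id (Γ : StableGraph g) : Hom Γ Γ :=
  Hom.ofIsWeighted (Specialization.id Γ.graph) rfl
    ((isWeighted_iff_of_surjective _ (fun e => ⟨e, rfl⟩) _ _).2 fun _ => rfl)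

/-- Composition of specializations. -/
def Hom.comp (ψ : Hom Γ' Γ'') (φ : Hom Γ Γ') : Hom Γ Γ'' :=
  Hom.ofIsWeighted (ψ.toSpecialization.comp φ.toSpecialization)
    (by change ψ.vmap (φ.vmap Γ.leg) = _; rw [φ.map_leg, ψ.map_leg])
    ((IsWeighted.comp_iff (fun _ => rfl) (fun _ => rfl) φ.isWeighted).1 ψ.isWeighted)

theorem Hom.exists_factor (φ : Hom Γ Γ') (ψ : Hom Γ Γ'')
    (h : Set.range ψ.emap ⊆ Set.range φ.emap) :
    ∃ χ : Hom Γ' Γ'', (∀ v, χ.vmap (φ.vmap v) = ψ.vmap v) ∧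
      (∀ e, φ.emap (χ.emap e) = ψ.emap e) ∧
      ∀ e, χ.flip e = xor (φ.flip (χ.emap e)) (ψ.flip e) := by
  obtain ⟨χ, h1, h2, h3⟩ := φ.toSpecialization.exists_factor ψ.toSpecialization h
  exact ⟨Hom.ofIsWeighted χ (by rw [← φ.map_leg, h1, ψ.map_leg])
    ((IsWeighted.comp_iff h1 h2 φ.isWeighted).2 ψ.isWeighted), h1, h2, h3⟩

theorem Hom.ext_toSpecialization {φ ψ : Hom Γ Γ'} (h : φ.toSpecialization = ψ.toSpecialization) :
    φ = ψ := by
  cases φ; cases ψ; congr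

end StableGraph

theorem Specialization.finite {V E V' E' : Type} {G : Multigraph V E} {H : Multigraph V' E'}
    [Finite V] [Finite E] [Finite V'] [Finite E'] : Finite (Specialization G H) := by
  refine Finite.of_injective (β := (V → V') × (E' → E) × (E' → Bool))
    (fun φ => (φ.vmap, φ.emap, φ.flip)) ?_
  rintro ⟨⟩ ⟨⟩ h
  simp only [Prod.mk.injEq] at h
  obtain ⟨rfl, rfl, rfl⟩ := h
  rfl

namespace StableGraph

open Multigraph TropJac.Specialization

variable {g : ℕ} {Γ : StableGraph g}

instance (Γ Γ' : StableGraph g) : Finite (Hom Γ Γ') :=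
  have := Specialization.finite (G := Γ.graph) (H := Γ'.graph)
  Finite.of_injective Hom.toSpecialization fun _ _ => Hom.ext_toSpecialization

section OfFintype

variable {V E : Type} [Fintype V] [Fintype E] (G : Multigraph V E) (w : V → ℕ) (l : V)
  (hconn : G.Connected) (hgenus : ∑ v, w v + Fintype.card E + 1 = g + Fintype.card V)
  (hstable : ∀ v, 3 ≤ G.val v + 2 * w v + if v = l then 1 else 0)

/-- A stable graph with arbitrary finite sets of vertices and edges, after numbering. -/
def ofFintype : StableGraph g where
  n := Fintype.card V
  m := Fintype.card E
  graph := ⟨fun e b => Fintype.equivFin V (G.ends ((Fintype.equivFin E).symm e) b)⟩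
  weight v := w ((Fintype.equivFin V).symm v)
  leg := Fintype.equivFin V l
  connected := (relabel G (Fintype.equivFin V) (Fintype.equivFin E)).connected hconn
  genus_eq := by
    rw [← hgenus, Equiv.sum_comp (Fintype.equivFin V).symm w]
  stable v := by
    obtain ⟨v, rfl⟩ := (Fintype.equivFin V).surjective v
    have h := (relabel G (Fintype.equivFin V) (Fintype.equivFin E)).val_eq_of_surjective
      (Fintype.equivFin E).symm.surjective v
    have h' := hstable v
    rw [← h] at h'
    simpa [relabel, ofSection] using h'

/-- The numbering of a stable graph. -/
def toOfFintype : Specialization G (ofFintype (g := g) G w l hconn hgenus hstable).graph :=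
  relabel G (Fintype.equivFin V) (Fintype.equivFin E)

theorem toOfFintype_emap_surjective :
    Function.Surjective (toOfFintype (g := g) G w l hconn hgenus hstable).emap :=
  (Fintype.equivFin E).symm.surjective

theorem toOfFintype_isWeighted : (toOfFintype (g := g) G w l hconn hgenus hstable).IsWeighted w
    (ofFintype (g := g) G w l hconn hgenus hstable).weight := by
  rw [isWeighted_iff_of_surjective _ (toOfFintype_emap_surjective G w l hconn hgenus hstable)]
  intro v
  simp [toOfFintype, relabel, ofSection, ofFintype]

end OfFintype

/-- The contraction of a set of edges of a stable graph. -/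
theorem exists_contraction (Γ : StableGraph g) (Z : Set (Fin Γ.m)) :
    ∃ (Γ' : StableGraph g) (φ : Hom Γ Γ'), Set.range φ.emap = Zᶜ := by
  let φ := contraction Γ.graph Z
  -- The weight is forced by the genus formula. The truncated subtraction is harmless because fibres
  -- are connected, by `card_fiber_le`.
  let w : Quot (Γ.graph.Reach Z) → ℕ := fun v' =>
    (∑ v with φ.vmap v = v', Γ.weight v) + (φ.contractedOver v').card + 1 -
      (Finset.univ.filter fun v => φ.vmap v = v').card
  have hw : φ.IsWeighted Γ.weight w := by
    intro v'
    have := φ.card_fiber_le v'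
    simp only [w]
    omega
  have : Fintype (Quot (Γ.graph.Reach Z)) := Fintype.ofFinite _
  have hgenus : ∑ v, w v + Fintype.card {e // e ∉ Z} + 1 =
      g + Fintype.card (Quot (Γ.graph.Reach Z)) := by
    have h1 := Finset.sum_congr (rfl : (Finset.univ : Finset (Quot (Γ.graph.Reach Z))) = _)
      fun v _ => hw v
    simp only [Finset.sum_add_distrib, Finset.sum_const, smul_eq_mul, mul_one,
      Finset.card_univ] at h1
    have h2 : ∑ v', (Finset.univ.filter fun v => φ.vmap v = v').card = Γ.n := by
      have := Finset.card_eq_sum_card_fiberwise (s := (Finset.univ : Finset (Fin Γ.n)))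
        (f := φ.vmap) (t := Finset.univ) (fun _ _ => Finset.mem_univ _)
      rw [Finset.card_univ, Fintype.card_fin] at this
      exact this.symm
    have h3 : ∑ v', (φ.contractedOver v').card = (Finset.univ.filter fun e => e ∈ Z).card := by
      rw [Finset.card_eq_sum_card_fiberwise (f := fun e => φ.vmap (Γ.graph.ends e false))
        (t := Finset.univ) (fun _ _ => Finset.mem_univ _)]
      refine Finset.sum_congr rfl fun v _ => congrArg Finset.card (Finset.ext fun e => ?_)
      rw [mem_contractedOver, range_contraction]
      simp
    have h4 : ∑ v', ∑ v with φ.vmap v = v', Γ.weight v = ∑ v, Γ.weight v :=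
      Finset.sum_fiberwise _ _ _
    have h5 : Fintype.card {e // e ∉ Z} + (Finset.univ.filter fun e => e ∈ Z).card = Γ.m := by
      rw [Fintype.card_subtype, add_comm, Finset.card_filter_add_card_filter_not]
      simp
    have := Γ.genus_eq
    omega
  have hstable : ∀ v', 3 ≤ (⟨fun e b => Quot.mk _ (Γ.graph.ends e b)⟩ :
      Multigraph (Quot (Γ.graph.Reach Z)) {e // e ∉ Z}).val v' + 2 * w v' +
        if v' = φ.vmap Γ.leg then 1 else 0 := by
    -- For a fibre with k vertices, the sum of the stability inequalities becomes val + 2w + leg ≥ k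
    -- + 2 at `v'`, and k ≥ 1.
    intro v'
    have h1 := φ.sum_val_eq v'
    have h2 := hw v'
    have h3 : ∑ v with φ.vmap v = v', 3 ≤ ∑ v with φ.vmap v = v',
      (Γ.graph.val v + 2 * Γ.weight v + if v = Γ.leg then 1 else 0) :=
      Finset.sum_le_sum fun v _ => Γ.stable v
    rw [Finset.sum_add_distrib, Finset.sum_add_distrib, ← Finset.mul_sum] at h3
    have h4 : (∑ v with φ.vmap v = v', if v = Γ.leg then 1 else 0) =
        if v' = φ.vmap Γ.leg then 1 else 0 := by
      rw [Finset.sum_ite_eq']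
      simp [eq_comm]
    have h5 : 0 < (Finset.univ.filter fun v => φ.vmap v = v').card := by
      obtain ⟨v, rfl⟩ := φ.vmap_surjective v'
      exact Finset.card_pos.2 ⟨v, by simp⟩
    simp only [Finset.sum_const, smul_eq_mul] at h3
    omega
  let ψ := toOfFintype (g := g) _ w (φ.vmap Γ.leg) (φ.connected Γ.connected) hgenus hstable
  refine ⟨_, Hom.ofIsWeighted (ψ.comp φ) rfl ((IsWeighted.comp_iff (fun _ => rfl) (fun _ => rfl)
    hw).1 (toOfFintype_isWeighted _ _ _ _ _ _)), ?_⟩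
  rw [← range_contraction Γ.graph Z]
  change Set.range (φ.emap ∘ ψ.emap) = _
  exact (toOfFintype_emap_surjective _ _ _ _ _ _).range_comp φ.emap

end StableGraph

end TropJac

end

/-! ### Push-forward of divisors and specializations of subdivisions. -/

noncomputable section

namespace TropJac

open scoped Classical

open Multigraph

theorem pushforward_comp {A V V' V'' : Type} [AddCommMonoid A] [Fintype V] [Fintype V']
    (f : V → V') (f' : V' → V'') (D : V → A) :
    pushforward f' (pushforward f D) = pushforward (f' ∘ f) D := by
  funext c
  exact Specialization.sum_fiber f f' c D

theorem sum_preimage {A V V' : Type} [AddCommMonoid A] [Fintype V] (f : V → V') (D : V → A)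
    (W : Finset V') :
    ∑ v with f v ∈ W, D v = ∑ v' ∈ W, pushforward f D v' := by
  simp only [pushforward, Finset.sum_filter]
  rw [Finset.sum_comm]
  refine Finset.sum_congr rfl fun v _ => ?_
  rw [Finset.sum_ite_eq]

theorem sum_pushforward {A V V' : Type} [AddCommMonoid A] [Fintype V] [Fintype V'] (f : V → V')
    (D : V → A) : ∑ v', pushforward f D v' = ∑ v, D v := by
  rw [← sum_preimage]
  simp

theorem pushforward_cast {V V' : Type} [Fintype V] (f : V → V') (D : V → ℤ) (v' : V') :
    ((pushforward f D v' : ℤ) : ℝ) = pushforward f (fun v => (D v : ℝ)) v' := by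
  simp [pushforward]

theorem pushforward_eq_of_fiber {A V V' : Type} [AddCommMonoid A] [Fintype V] {f : V → V'}
    (D : V → A) {v' : V'} {v : V} (h : ∀ u, f u = v' ↔ u = v) : pushforward f D v' = D v := by
  have : (Finset.univ.filter fun u => f u = v') = {v} := by
    ext u
    simp [h]
  rw [pushforward, this, Finset.sum_singleton]

namespace Specialization

variable {V E V' E' V'' E'' : Type} {G : Multigraph V E} {H : Multigraph V' E'}

theorem delta_preimage [Fintype V] [Fintype E] [Fintype E'] (φ : Specialization G H)
    (W : Finset V') : G.delta (Finset.univ.filter fun v => φ.vmap v ∈ W) = H.delta W := by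
  rw [delta, delta, ← Finset.card_image_of_injective _ φ.emap_injective]
  congr 1
  ext e
  simp only [Finset.mem_filter, Finset.mem_univ, true_and, Finset.mem_image]
  have key : ∀ e', ¬ (φ.vmap (G.ends (φ.emap e') false) ∈ W ↔
      φ.vmap (G.ends (φ.emap e') true) ∈ W) ↔
      ¬ (H.ends e' false ∈ W ↔ H.ends e' true ∈ W) := by
    intro e'
    rw [φ.vmap_ends, φ.vmap_ends]
    cases φ.flip e'
    · rfl
    · exact not_congr iff_comm
  constructor
  · intro h
    by_cases he : e ∈ Set.range φ.emap
    · obtain ⟨e', rfl⟩ := he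
      exact ⟨e', (key e').1 h, rfl⟩
    · rw [φ.vmap_contracted he false true] at h
      exact (h Iff.rfl).elim
  · rintro ⟨e', h, rfl⟩
    exact (key e').2 h

theorem beta_preimage [Fintype V] [Fintype E] [Fintype E'] (φ : Specialization G H)
    (μ : V → ℝ) (D : V → ℤ) (W : Finset V') :
    beta G μ D (Finset.univ.filter fun v => φ.vmap v ∈ W) =
      beta H (pushforward φ.vmap μ) (pushforward φ.vmap D) W := by
  rw [beta, beta, φ.delta_preimage, sum_preimage, sum_preimage]
  simp only [pushforward_cast]

/-- By `beta_preimage` the inequality for a set of vertices of `H` is the inequality for its full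
preimage in `G`, which is again proper. -/
theorem isQuasistable_pushforward [Fintype V] [Fintype E] [Fintype V'] [Fintype E']
    (φ : Specialization G H) {v₀ : V} {μ : V → ℝ} {d : ℤ} {D : V → ℤ}
    (h : IsQuasistable G v₀ μ d D) :
    IsQuasistable H (φ.vmap v₀) (pushforward φ.vmap μ) d (pushforward φ.vmap D) := by
  refine ⟨by rw [sum_pushforward, h.1], fun W hW => ?_⟩
  have hW' : (Finset.univ.filter fun v => φ.vmap v ∈ W) ≠ Finset.univ := by
    intro h'
    refine hW (Finset.eq_univ_of_forall fun v' => ?_)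
    obtain ⟨v, rfl⟩ := φ.vmap_surjective v'
    have := Finset.mem_univ v
    rw [← h'] at this
    exact (Finset.mem_filter.1 this).2
  have := h.2 _ hW'
  rw [φ.beta_preimage] at this
  exact ⟨this.1, fun hv => this.2 (by simpa using hv)⟩

section Subdiv

variable (ι : Specialization G H) {S : Finset E} {S' : Finset E'}
  (hS : ∀ e', e' ∈ S' ↔ ι.emap e' ∈ S)

/-- The map on vertices of the subdivisions induced by a specialization. -/
def subdivVmap : SubVertex V S → SubVertex V' S'
  | .inl v => .inl (ι.vmap v)
  | .inr e => if h : ∃ e', ι.emap e' = e then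
      .inr ⟨h.choose, (hS _).2 (h.choose_spec.symm ▸ e.2)⟩ else .inl (ι.vmap (G.ends e false))

theorem subdivVmap_inr_emap (e' : E') (h : ι.emap e' ∈ S) :
    ι.subdivVmap hS (.inr ⟨ι.emap e', h⟩) = .inr ⟨e', (hS e').2 h⟩ := by
  have hex : ∃ e'', ι.emap e'' = ι.emap e' := ⟨e', rfl⟩
  rw [subdivVmap, dif_pos hex]
  exact congrArg Sum.inr (Subtype.ext (ι.emap_injective hex.choose_spec))

theorem subdivVmap_inr_of_notMem (e : {e // e ∈ S}) (h : (e : E) ∉ Set.range ι.emap) (b : Bool) :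
    ι.subdivVmap hS (.inr e) = .inl (ι.vmap (G.ends e b)) := by
  have h' : ¬ ∃ e', ι.emap e' = e := h
  rw [subdivVmap, dif_neg h', ι.vmap_contracted h false b]

/-- Since an exceptional vertex has a single preimage, which is exceptional, the push-forward of a
pseudo-divisor again has value -1 there. -/
theorem subdivVmap_eq_inr_iff (x : SubVertex V S) (e' : {e // e ∈ S'}) :
    ι.subdivVmap hS x = .inr e' ↔ x = .inr ⟨ι.emap e', (hS e').1 e'.2⟩ := by
  constructor
  · intro h
    rcases x with v | ⟨e, he⟩
    · simp [subdivVmap] at h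
    · by_cases hr : e ∈ Set.range ι.emap
      · obtain ⟨e'', rfl⟩ := hr
        rw [subdivVmap_inr_emap] at h
        obtain rfl := Sum.inr_injective h
        rfl
      · rw [subdivVmap_inr_of_notMem _ _ _ hr false] at h
        simp at h
  · rintro rfl
    exact ι.subdivVmap_inr_emap hS e' _

/-- The map on edges of the subdivisions induced by a specialization. -/
def subdivEmap : SubEdge S' → SubEdge S
  | .inl e => .inl ⟨ι.emap e, fun h => e.2 ((hS _).2 h)⟩
  | .inr (e, k) => .inr (⟨ι.emap e, (hS _).1 e.2⟩, xor k (ι.flip e))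

theorem overEdge_subdivEmap (f : SubEdge S') :
    overEdge S (ι.subdivEmap hS f) = ι.emap (overEdge S' f) := by
  rcases f with f | ⟨f, k⟩ <;> rfl

theorem mem_range_subdivEmap_iff (f : SubEdge S) :
    f ∈ Set.range (ι.subdivEmap hS) ↔ overEdge S f ∈ Set.range ι.emap := by
  constructor
  · rintro ⟨f, rfl⟩
    exact ⟨_, (ι.overEdge_subdivEmap hS f).symm⟩
  · rcases f with ⟨f, hf⟩ | ⟨⟨f, hf⟩, k⟩
    · rintro ⟨e', rfl : ι.emap e' = f⟩
      exact ⟨.inl ⟨e', fun h => hf ((hS _).1 h)⟩, rfl⟩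
    · rintro ⟨e', rfl : ι.emap e' = f⟩
      exact ⟨.inr (⟨e', (hS _).2 hf⟩, xor k (ι.flip e')), by simp [subdivEmap]⟩

theorem reach_subdiv_inl {C : Set E} {v w : V} (h : G.Reach C v w) :
    (G.subdiv S).Reach {f | overEdge S f ∈ C} (.inl v) (.inl w) := by
  refine Reach.map (G := G) (S := C) Sum.inl (fun e he => ?_) h
  by_cases heS : e ∈ S
  · have h1 := reach_ends (G := G.subdiv S) (S := {f | overEdge S f ∈ C})
      (e := .inr (⟨e, heS⟩, false)) he false true
    have h2 := reach_ends (G := G.subdiv S) (S := {f | overEdge S f ∈ C})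
      (e := .inr (⟨e, heS⟩, true)) he false true
    exact h1.trans h2
  · exact reach_ends (G := G.subdiv S) (S := {f | overEdge S f ∈ C})
      (e := .inl ⟨e, heS⟩) he false true

/-- The specialization of subdivisions induced by a specialization. -/
def subdiv : Specialization (G.subdiv S) (H.subdiv S') :=
  ofSection (ι.subdivVmap hS) (ι.subdivEmap hS) (fun f => ι.flip (overEdge S' f))
    (Sum.elim (fun v => .inl (Function.surjInv ι.vmap_surjective v))
      fun e => .inr ⟨ι.emap e, (hS e).1 e.2⟩)
    (by
      rintro (⟨e, he⟩ | ⟨⟨e, he⟩, k⟩) (⟨e', he'⟩ | ⟨⟨e', he'⟩, k'⟩) h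
      · simp only [subdivEmap, Sum.inl.injEq, Subtype.mk.injEq] at h
        obtain rfl := ι.emap_injective h
        rfl
      · simp [subdivEmap] at h
      · simp [subdivEmap] at h
      · simp only [subdivEmap, Sum.inr.injEq, Prod.mk.injEq, Subtype.mk.injEq] at h
        obtain rfl := ι.emap_injective h.1
        simpa using h.2)
    (by
      rintro (⟨e, he⟩ | ⟨⟨e, he⟩, k⟩) b
      · exact congrArg Sum.inl (ι.vmap_ends e b)
      · simp only [subdivEmap, Multigraph.subdiv, overEdge]
        have hb : (b = xor k (ι.flip e)) ↔ (xor b (ι.flip e) = k) := by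
          cases b <;> cases k <;> cases ι.flip e <;> simp
        by_cases h : b = xor k (ι.flip e)
        · rw [if_pos h, if_pos (hb.1 h), subdivVmap, ι.vmap_ends]
          simp
        · rw [if_neg h, if_neg (mt hb.2 h), subdivVmap_inr_emap])
    (by
      intro f hf
      rw [mem_range_subdivEmap_iff] at hf
      rcases f with f | ⟨f, k⟩
      · exact congrArg Sum.inl (ι.vmap_contracted hf _ _)
      · cases k
        · exact (ι.subdivVmap_inr_of_notMem hS f hf false).symm
        · exact (ι.subdivVmap_inr_of_notMem hS f hf true))
    (by
      rintro (v | e)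
      · simp [subdivVmap, Function.surjInv_eq]
      · exact ι.subdivVmap_inr_emap hS e _)
    (by
      have hC : (Set.range (ι.subdivEmap hS))ᶜ = {f | overEdge S f ∈ (Set.range ι.emap)ᶜ} := by
        ext f
        exact not_congr (ι.mem_range_subdivEmap_iff hS f)
      have hinl : ∀ v, (G.subdiv S).Reach {f | overEdge S f ∈ (Set.range ι.emap)ᶜ} (.inl v)
          (.inl (Function.surjInv ι.vmap_surjective (ι.vmap v))) := fun v =>
        reach_subdiv_inl ((ι.vmap_eq_iff _ _).1 (Function.surjInv_eq ι.vmap_surjective _).symm)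
      rw [hC]
      rintro (v | ⟨e, he⟩)
      · exact hinl v
      · by_cases hr : e ∈ Set.range ι.emap
        · obtain ⟨e, rfl⟩ := hr
          rw [subdivVmap_inr_emap]
          exact Reach.refl _
        · rw [ι.subdivVmap_inr_of_notMem hS ⟨e, he⟩ hr false]
          exact (reach_ends (G := G.subdiv S) (e := .inr (⟨e, he⟩, false)) (S := {f | overEdge S f ∈ (Set.range ι.emap)ᶜ}) hr true false).trans
            (hinl _))

end Subdiv

section Collapse

variable {S S₀ : Finset E} (hS : S₀ ⊆ S) (h : E → Bool)

/-- The map on vertices that moves the exceptional vertex on `e ∉ S₀` to the end `!h e`. -/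
def collapseVmap (G : Multigraph V E) (S S₀ : Finset E) (h : E → Bool) :
    SubVertex V S → SubVertex V S₀
  | .inl v => .inl v
  | .inr e => if he : (e : E) ∈ S₀ then .inr ⟨e, he⟩ else .inl (G.ends e (!h e))

/-- The edges of a subdivision that remain after moving exceptional vertices to ends. -/
def collapseEmap : SubEdge S₀ → SubEdge S
  | .inl e => if he : (e : E) ∈ S then .inr (⟨e, he⟩, h e) else .inl ⟨e, he⟩
  | .inr (e, k) => .inr (⟨e, hS e.2⟩, k)

theorem overEdge_collapseEmap (f : SubEdge S₀) :
    overEdge S (collapseEmap hS h f) = overEdge S₀ f := by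
  rcases f with f | ⟨f, k⟩
  · simp only [collapseEmap]
    split_ifs <;> rfl
  · rfl

theorem collapseVmap_eq_inr_iff (x : SubVertex V S) (e : {e // e ∈ S₀}) :
    collapseVmap G S S₀ h x = .inr e ↔ x = .inr ⟨e, hS e.2⟩ := by
  rcases x with v | ⟨e', he'⟩
  · simp [collapseVmap]
  · simp only [collapseVmap]
    split_ifs with h'
    · simp [Subtype.ext_iff]
    · simp only [Sum.inr.injEq, Subtype.mk.injEq, false_iff]
      rintro rfl
      exact h' e.2

/-- A collapse contracts one edge for each `e` in `S` outside `S₀`, namely the half at the end `!h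
e` to which the exceptional vertex moves; all other edges survive. -/
theorem mem_range_collapseEmap_iff (f : SubEdge S) :
    f ∈ Set.range (collapseEmap hS h) ↔
      ∀ e k, f = .inr (e, k) → (e : E) ∉ S₀ → k = h e := by
  constructor
  · rintro ⟨f, rfl⟩ e k hf he
    rcases f with f | ⟨f, k'⟩
    · simp only [collapseEmap] at hf
      split_ifs at hf with h'
      simp only [Sum.inr.injEq, Prod.mk.injEq] at hf
      rw [← hf.1, ← hf.2]
    · simp only [collapseEmap, Sum.inr.injEq, Prod.mk.injEq] at hf
      exact (he (hf.1 ▸ f.2)).elim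
  · intro hf
    rcases f with ⟨f, hfS⟩ | ⟨⟨f, hfS⟩, k⟩
    · exact ⟨.inl ⟨f, fun h => hfS (hS h)⟩, by simp [collapseEmap, hfS]⟩
    · by_cases hf0 : f ∈ S₀
      · exact ⟨.inr (⟨f, hf0⟩, k), rfl⟩
      · exact ⟨.inl ⟨f, hf0⟩, by simp [collapseEmap, hfS, hf ⟨f, hfS⟩ k rfl hf0]⟩

/-- The specialization of subdivisions that moves the exceptional vertices on the edges `e ∉ S₀` to
the end `!h e`. -/
def collapse (G : Multigraph V E) : Specialization (G.subdiv S) (G.subdiv S₀) :=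
  ofSection (collapseVmap G S S₀ h) (collapseEmap hS h) (fun _ => false)
    (Sum.elim .inl fun e => .inr ⟨e, hS e.2⟩)
    (by
      rintro (⟨e, he⟩ | ⟨⟨e, he⟩, k⟩) (⟨e', he'⟩ | ⟨⟨e', he'⟩, k'⟩) hee
      · have := congrArg (overEdge S) hee
        rw [overEdge_collapseEmap, overEdge_collapseEmap] at this
        simpa [overEdge] using this
      · have := congrArg (overEdge S) hee
        rw [overEdge_collapseEmap, overEdge_collapseEmap] at this
        exact (he ((show e = e' from this) ▸ he')).elim
      · have := congrArg (overEdge S) hee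
        rw [overEdge_collapseEmap, overEdge_collapseEmap] at this
        exact (he' ((show e = e' from this) ▸ he)).elim
      · simpa [collapseEmap] using hee)
    (by
      rintro (⟨e, he⟩ | ⟨⟨e, he⟩, k⟩) b
      · simp only [collapseEmap, Bool.xor_false]
        split_ifs with heS
        · simp only [Multigraph.subdiv]
          split_ifs with hb
          · rw [collapseVmap, hb]
          · have : b = !h e := by revert hb; cases b <;> cases h e <;> simp
            rw [collapseVmap, dif_neg he, ← this]
        · rfl
      · simp only [collapseEmap, Bool.xor_false, Multigraph.subdiv]
        split_ifs with hb
        · rfl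
        · rw [collapseVmap, dif_pos he])
    (by
      rintro f hf
      rw [mem_range_collapseEmap_iff] at hf
      push Not at hf
      obtain ⟨⟨e, he⟩, k, rfl, he0, hk⟩ := hf
      have : k = !h e := by revert hk; cases k <;> cases h e <;> simp
      subst this
      have he0' : e ∉ S₀ := he0
      cases hh : h e <;> simp [Multigraph.subdiv, collapseVmap, he0', hh])
    (by
      rintro (v | e)
      · rfl
      · simp [collapseVmap])
    (by
      rintro (v | ⟨e, he⟩)
      · exact Reach.refl _
      · simp only [collapseVmap]
        split_ifs with he0
        · exact Reach.refl _
        · have hC : (.inr (⟨e, he⟩, !h e) : SubEdge S) ∈ (Set.range (collapseEmap hS h))ᶜ := by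
            rw [Set.mem_compl_iff, mem_range_collapseEmap_iff]
            intro h'
            simpa using h' _ _ rfl he0
          have := reach_ends (G := G.subdiv S) hC (h e) (!h e)
          simpa [Multigraph.subdiv] using this)

end Collapse

end Specialization

end TropJac

end

/-! ### Push-forward, factorization and finiteness of pseudo-divisors. -/

noncomputable section

namespace TropJac

open scoped Classical

open Multigraph

/-- The edges whose images are in a given set. -/
def Specialization.pullback {V E V' E' : Type} [Fintype E'] {G : Multigraph V E}
    {H : Multigraph V' E'} (ι : Specialization G H) (S : Finset E) : Finset E' :=
  Finset.univ.filter fun e' => ι.emap e' ∈ S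

theorem Specialization.mem_pullback {V E V' E' : Type} [Fintype E'] {G : Multigraph V E}
    {H : Multigraph V' E'} (ι : Specialization G H) (S : Finset E) (e' : E') :
    e' ∈ ι.pullback S ↔ ι.emap e' ∈ S := by
  simp [Specialization.pullback]

namespace QD

variable {V E V' E' V'' E'' : Type} [Fintype V] [Fintype E] [DecidableEq E] [Fintype V']
  [Fintype E'] [DecidableEq E'] [Fintype V''] [Fintype E''] [DecidableEq E'']
  {G : Multigraph V E} {H : Multigraph V' E'} {K : Multigraph V'' E''} {v₀ : V} {v₀' : V'}
  {v₀'' : V''} {μ : V → ℝ} {μ' : V' → ℝ} {μ'' : V'' → ℝ} {d : ℤ}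

theorem ext' {P Q : QD G v₀ μ d} (hS : P.S = Q.S) (hD : ∀ v, P.D (.inl v) = Q.D (.inl v)) :
    P = Q := by
  obtain ⟨S, D, h, h'⟩ := P
  obtain ⟨S', D', k, k'⟩ := Q
  obtain rfl : S = S' := hS
  have : D = D' := by
    funext x
    rcases x with v | e
    · exact hD v
    · rw [h, k]
  subst this
  rfl

omit [Fintype E] [DecidableEq E] [Fintype V'] [Fintype E'] [DecidableEq E'] in
theorem pushforward_sumElim {f : V → V'} {S : Finset E} {S' : Finset E'}
    {F : SubVertex V S → SubVertex V' S'} (hF : ∀ v, F (.inl v) = .inl (f v)) :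
    pushforward F (Sum.elim μ fun _ => 0) = Sum.elim (pushforward f μ) fun _ => 0 := by
  funext x
  rw [pushforward, Finset.sum_filter, Fintype.sum_sum_type]
  rcases x with v | e'
  · simp [hF, pushforward, Finset.sum_filter]
  · simp [hF]

omit [Fintype E] [DecidableEq E] [Fintype V'] [Fintype E'] [DecidableEq E'] in
theorem pushforward_subdiv_inl (ι : Specialization G H) {S : Finset E} {S' : Finset E'}
    (hS : ∀ e', e' ∈ S' ↔ ι.emap e' ∈ S) (hrange : ∀ e ∈ S, e ∈ Set.range ι.emap)
    (D : SubVertex V S → ℤ) (v' : V') :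
    pushforward (ι.subdivVmap hS) D (.inl v') = pushforward ι.vmap (fun v => D (.inl v)) v' := by
  rw [pushforward, Finset.sum_filter, Fintype.sum_sum_type, Finset.sum_eq_zero (s := Finset.univ
    (α := {e // e ∈ S})), add_zero, pushforward, Finset.sum_filter]
  · refine Finset.sum_congr rfl fun v _ => ?_
    simp [Specialization.subdivVmap]
  · rintro ⟨e, he⟩ _
    obtain ⟨e, rfl⟩ := hrange e he
    rw [ι.subdivVmap_inr_emap]
    simp

/-- The push-forward of a pseudo-divisor along a specialization of subdivisions under which each
exceptional vertex has a single preimage, which is exceptional. -/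
def pushAlong (P : QD G v₀ μ d) (ι : Specialization G H) (hv : ι.vmap v₀ = v₀')
    (hμ : μ' = pushforward ι.vmap μ) {S' : Finset E'}
    (τ : Specialization (G.subdiv P.S) (H.subdiv S')) (hτ : ∀ v, τ.vmap (.inl v) = .inl (ι.vmap v))
    (hexc : ∀ e', ∃ e, ∀ x, τ.vmap x = .inr e' ↔ x = .inr e) : QD H v₀' μ' d where
  S := S'
  D := pushforward τ.vmap P.D
  exceptional e' := by
    obtain ⟨e, he⟩ := hexc e'
    rw [pushforward_eq_of_fiber P.D he, P.exceptional]
  quasistable := by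
    have h := τ.isQuasistable_pushforward P.quasistable
    have hμ' := pushforward_sumElim (μ := μ) hτ
    rw [← hμ] at hμ'
    rwa [hμ', hτ, hv] at h

/-- The push-forward of a pseudo-divisor along a specialization. -/
def push (P : QD G v₀ μ d) (ι : Specialization G H) (hv : ι.vmap v₀ = v₀')
    (hμ : μ' = pushforward ι.vmap μ) : QD H v₀' μ' d :=
  P.pushAlong ι hv hμ (ι.subdiv (ι.mem_pullback P.S))
    (fun _ => rfl) fun e' => ⟨_, fun x => ι.subdivVmap_eq_inr_iff (ι.mem_pullback P.S) x e'⟩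

/-- The specialization of a pseudo-divisor to its push-forward. -/
def toPush (P : QD G v₀ μ d) (ι : Specialization G H) (hv : ι.vmap v₀ = v₀')
    (hμ : μ' = pushforward ι.vmap μ) : HomOver ι P (P.push ι hv hμ) where
  toSpecialization := ι.subdiv (ι.mem_pullback P.S)
  subset e' he' := (ι.mem_pullback P.S e').1 he'
  vmap_inl _ := rfl
  overEdge_emap f' := ι.overEdge_subdivEmap (ι.mem_pullback P.S) f'
  flip_eq _ := rfl
  map_divisor := rfl

theorem range_toPush (P : QD G v₀ μ d) (ι : Specialization G H) (hv : ι.vmap v₀ = v₀')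
    (hμ : μ' = pushforward ι.vmap μ) (f : SubEdge P.S) :
    f ∈ Set.range (P.toPush ι hv hμ).emap ↔ overEdge P.S f ∈ Set.range ι.emap :=
  ι.mem_range_subdivEmap_iff (ι.mem_pullback P.S) f

/-- The pseudo-divisor obtained by moving the exceptional vertices on `e ∉ S₀` to the end
`!h e`. -/
def collapse (P : QD G v₀ μ d) (S₀ : Finset E) (hS : S₀ ⊆ P.S) (h : E → Bool) : QD G v₀ μ d :=
  P.pushAlong (Specialization.id G) rfl
    (funext fun _ => (pushforward_eq_of_fiber μ (fun _ => Iff.rfl)).symm)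
    (Specialization.collapse hS h G) (fun _ => rfl)
    fun e => ⟨_, fun x => Specialization.collapseVmap_eq_inr_iff hS h x e⟩

/-- The specialization of a pseudo-divisor to its collapse. -/
def toCollapse (P : QD G v₀ μ d) (S₀ : Finset E) (hS : S₀ ⊆ P.S) (h : E → Bool) :
    HomOver (Specialization.id G) P (P.collapse S₀ hS h) where
  toSpecialization := Specialization.collapse hS h G
  subset _ he' := hS he'
  vmap_inl _ := rfl
  overEdge_emap f' := Specialization.overEdge_collapseEmap hS h f'
  flip_eq _ := rfl
  map_divisor := rfl

/-- Composition of specializations of pseudo-divisors. -/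
def HomOver.comp {ι : Specialization G H} {κ : Specialization H K} {P : QD G v₀ μ d}
    {Q : QD H v₀' μ' d} {R : QD K v₀'' μ'' d} (σ : HomOver κ Q R) (τ : HomOver ι P Q) :
    HomOver (κ.comp ι) P R where
  toSpecialization := σ.toSpecialization.comp τ.toSpecialization
  subset e' he' := τ.subset _ (σ.subset _ he')
  vmap_inl v := by
    change σ.vmap (τ.vmap _) = _
    rw [τ.vmap_inl, σ.vmap_inl]
    rfl
  overEdge_emap f' := by
    change overEdge _ (τ.emap (σ.emap f')) = _
    rw [τ.overEdge_emap, σ.overEdge_emap]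
    rfl
  flip_eq f' := by
    change xor (τ.flip (σ.emap f')) (σ.flip f') = _
    rw [τ.flip_eq, σ.flip_eq, σ.overEdge_emap]
    rfl
  map_divisor := by
    rw [σ.map_divisor, τ.map_divisor, pushforward_comp]
    rfl

/-- Factorization of specializations of pseudo-divisors. -/
theorem HomOver.exists_factor {φ : Specialization G H} {ψ : Specialization G K}
    {χ : Specialization H K} (hv : ∀ v, χ.vmap (φ.vmap v) = ψ.vmap v)
    (he : ∀ e, φ.emap (χ.emap e) = ψ.emap e)
    (hf : ∀ e, χ.flip e = xor (φ.flip (χ.emap e)) (ψ.flip e)) {P : QD G v₀ μ d}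
    {Q : QD H v₀' μ' d} {R : QD K v₀'' μ'' d} (σ : HomOver φ P Q) (τ : HomOver ψ P R)
    (h : Set.range τ.emap ⊆ Set.range σ.emap) :
    ∃ ρ : HomOver χ Q R, ∀ e, σ.emap (ρ.emap e) = τ.emap e := by
  obtain ⟨ρ, h1, h2, h3⟩ := σ.toSpecialization.exists_factor τ.toSpecialization h
  have hover : ∀ f, overEdge Q.S (ρ.emap f) = χ.emap (overEdge R.S f) := by
    intro f
    apply φ.emap_injective
    rw [← σ.overEdge_emap, h2, he, τ.overEdge_emap]
  refine ⟨{ toSpecialization := ρ, subset := ?_, vmap_inl := ?_, overEdge_emap := hover,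
            flip_eq := ?_, map_divisor := ?_ }, h2⟩
  · intro e' he'
    -- If the edge under `e'` were not subdivided in `Q`, both halves of `e'` would have to come
    -- from this single edge, against injectivity.
    by_contra hcon
    have key : ∀ k, ρ.emap (.inr (⟨e', he'⟩, k)) = .inl ⟨_, hcon⟩ := by
      intro k
      have := hover (.inr (⟨e', he'⟩, k))
      rcases hρ : ρ.emap (.inr (⟨e', he'⟩, k)) with f | ⟨f, k⟩
      · rw [hρ] at this
        exact congrArg Sum.inl (Subtype.ext this)
      · rw [hρ] at this
        exact (hcon ((show (f : E') = χ.emap e' from this) ▸ f.2)).elim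
    have := ρ.emap_injective ((key false).trans (key true).symm)
    simp at this
  · intro v
    obtain ⟨v, rfl⟩ := φ.vmap_surjective v
    rw [← σ.vmap_inl, h1, τ.vmap_inl, hv]
  · intro f
    rw [h3, σ.flip_eq, τ.flip_eq, hover, hf]
  · have : τ.vmap = ρ.vmap ∘ σ.vmap := funext fun v => (h1 v).symm
    rw [τ.map_divisor, σ.map_divisor, pushforward_comp, this]

theorem HomOver.ext_toSpecialization {ι : Specialization G H} {P : QD G v₀ μ d}
    {Q : QD H v₀' μ' d} {σ τ : HomOver ι P Q} (h : σ.toSpecialization = τ.toSpecialization) :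
    σ = τ := by
  cases σ; cases τ; congr

instance (ι : Specialization G H) (P : QD G v₀ μ d) (Q : QD H v₀' μ' d) :
    Finite (HomOver ι P Q) :=
  have := Specialization.finite (G := G.subdiv P.S) (H := H.subdiv Q.S)
  Finite.of_injective HomOver.toSpecialization fun _ _ => HomOver.ext_toSpecialization

-- The inequality for a one-element set bounds the divisor from below at each vertex, and the fixed
-- degree then bounds it from above.
omit [DecidableEq E] in
theorem finite_quasistable (G : Multigraph V E) (v₀ : V) (μ : V → ℝ) (d : ℤ) :
    {D : V → ℤ | IsQuasistable G v₀ μ d D}.Finite := by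
  -- The minimum with `d` covers the graph with one vertex, where {v} is not a proper subset and the
  -- degree determines the value.
  let lo : V → ℤ := fun v => min d (⌊μ v - (G.delta {v} : ℝ) / 2⌋)
  have hlo : ∀ D, IsQuasistable G v₀ μ d D → ∀ v, lo v ≤ D v := by
    intro D hD v
    by_cases hv : ({v} : Finset V) = Finset.univ
    · have h := hD.1
      rw [← hv, Finset.sum_singleton] at h
      exact (min_le_left _ _).trans h.ge
    · have h := (hD.2 {v} hv).1
      simp only [beta, Finset.sum_singleton] at h
      refine (min_le_right _ _).trans ?_
      have h2 := Int.floor_le (μ v - (G.delta {v} : ℝ) / 2)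
      have : ((⌊μ v - (G.delta {v} : ℝ) / 2⌋ : ℤ) : ℝ) ≤ D v := by linarith
      exact_mod_cast this
  refine (Set.finite_Icc lo fun v => d - ∑ u, lo u + lo v).subset fun D hD => ⟨hlo D hD, fun v => ?_⟩
  have h1 := hD.1
  have h2 : ∑ u ∈ Finset.univ.erase v, lo u ≤ ∑ u ∈ Finset.univ.erase v, D u :=
    Finset.sum_le_sum fun u _ => hlo D hD u
  have h3 := Finset.add_sum_erase Finset.univ lo (Finset.mem_univ v)
  have h4 := Finset.add_sum_erase Finset.univ D (Finset.mem_univ v)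
  show D v ≤ d - ∑ u, lo u + lo v
  linarith

instance (G : Multigraph V E) (v₀ : V) (μ : V → ℝ) (d : ℤ) : Finite (QD G v₀ μ d) := by
  have : ∀ S : Finset E, Finite {D : SubVertex V S → ℤ //
      IsQuasistable (G.subdiv S) (.inl v₀) (Sum.elim μ fun _ => 0) d D} := fun S =>
    (finite_quasistable _ _ _ _).to_subtype
  refine Finite.of_injective (β := Σ S : Finset E, {D : SubVertex V S → ℤ //
      IsQuasistable (G.subdiv S) (.inl v₀) (Sum.elim μ fun _ => 0) d D})
    (fun P => ⟨P.S, P.D, P.quasistable⟩) ?_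
  rintro ⟨S, D, h, h'⟩ ⟨S', D', k, k'⟩ hPQ
  simp only [Sigma.mk.injEq] at hPQ
  obtain ⟨rfl, hPQ⟩ := hPQ
  simp only [heq_eq_eq, Subtype.mk.injEq] at hPQ
  subst hPQ
  rfl

end QD

/-! ### The diagrams of the moduli space and of the Jacobian -/

section Diagrams

variable {g : ℕ} {d : ℤ} {μ : UniversalPolarization g d}

instance : Finite (QDObj μ) :=
  Finite.of_injective (β := Σ Γ : StableGraph g, QD Γ.graph Γ.leg (μ.μ Γ) d)
    (fun a => ⟨a.Γ, a.P⟩) (by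
      rintro ⟨Γ, P⟩ ⟨Γ', P'⟩ h
      simp only [Sigma.mk.injEq] at h
      obtain ⟨rfl, h⟩ := h
      rw [eq_of_heq h])

instance (a a' : QDObj μ) : Finite (QDObj.Hom a a') :=
  Finite.of_injective (β := Σ ι : StableGraph.Hom a.Γ a'.Γ, QD.HomOver ι.toSpecialization a.P a'.P)
    (fun φ => ⟨φ.ι, φ.τ⟩) (by
      rintro ⟨ι, τ⟩ ⟨ι', τ'⟩ h
      simp only [Sigma.mk.injEq] at h
      obtain ⟨rfl, h⟩ := h
      rw [eq_of_heq h])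

theorem isGeneralizedConeComplex_moduliDiagram (g : ℕ) :
    (moduliDiagram g).IsGeneralizedConeComplex :=
  ⟨inferInstanceAs (Finite (StableGraph g)),
    fun (Γ Γ' : StableGraph g) => inferInstanceAs (Finite (StableGraph.Hom Γ' Γ)),
    fun Γ => orthant_isRationalCone (Fin (StableGraph.m Γ)),
    fun _ _ f => isFaceMorphism_extendByZero (StableGraph.Hom.toSpecialization f).emap_injective⟩

theorem isGeneralizedConeComplex_jacobianDiagram (μ : UniversalPolarization g d) :
    (jacobianDiagram μ).IsGeneralizedConeComplex :=
  ⟨inferInstanceAs (Finite (QDObj μ)),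
    fun (a a' : QDObj μ) => inferInstanceAs (Finite (QDObj.Hom a' a)),
    fun a => orthant_isRationalCone (QDObj.Edge a),
    fun _ _ f => isFaceMorphism_extendByZero
      (QD.HomOver.toSpecialization (QDObj.Hom.τ f)).emap_injective⟩

/-- Composition of specializations. -/
def QDObj.Hom.comp {a b c : QDObj μ} (ψ : Hom b c) (φ : Hom a b) : Hom a c where
  ι := ψ.ι.comp φ.ι
  τ := ψ.τ.comp φ.τ

theorem QDObj.Hom.exists_factor {a b c : QDObj μ} (φ : Hom a b) (ψ : Hom a c)
    (h : Set.range ψ.τ.emap ⊆ Set.range φ.τ.emap) :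
    ∃ χ : Hom b c, (∀ e, φ.ι.emap (χ.ι.emap e) = ψ.ι.emap e) ∧
      ∀ e, φ.τ.emap (χ.τ.emap e) = ψ.τ.emap e := by
  have hover : Function.Surjective (overEdge c.P.S) := by
    intro e
    by_cases he : e ∈ c.P.S
    · exact ⟨.inr (⟨e, he⟩, false), rfl⟩
    · exact ⟨.inl ⟨e, he⟩, rfl⟩
  have hι : Set.range ψ.ι.emap ⊆ Set.range φ.ι.emap := by
    rintro _ ⟨e, rfl⟩
    obtain ⟨f, rfl⟩ := hover e
    obtain ⟨f', hf'⟩ := h ⟨f, rfl⟩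
    exact ⟨overEdge b.P.S f', by rw [← φ.τ.overEdge_emap, hf', ψ.τ.overEdge_emap]⟩
  obtain ⟨χ, h1, h2, h3⟩ := φ.ι.exists_factor ψ.ι hι
  obtain ⟨ρ, hρ⟩ := QD.HomOver.exists_factor h1 h2 h3 φ.τ ψ.τ h
  exact ⟨⟨χ, ρ⟩, h2, hρ⟩

/-- All coordinates are positive. -/
def IsPositive {ι : Type} (x : orthant ι) : Prop := ∀ i, 0 < x.1 i

theorem range_eq_support {ι κ : Type} {i : ι → κ} (hi : Function.Injective i) {x : orthant ι}
    (hx : IsPositive x) (k : κ) : k ∈ Set.range i ↔ (extendByZero i x).1 k ≠ 0 := by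
  constructor
  · rintro ⟨a, rfl⟩
    rw [extendByZero_apply hi]
    exact (hx a).ne'
  · intro h
    by_contra hk
    exact h (extendByZero_apply_of_notMem x hk)

theorem exists_restrict {ι κ : Type} {i : ι → κ} (hi : Function.Injective i) (y : orthant κ)
    (h : ∀ k, k ∈ Set.range i ↔ y.1 k ≠ 0) :
    ∃ x : orthant ι, IsPositive x ∧ extendByZero i x = y := by
  refine ⟨⟨fun a => y.1 (i a), fun a => y.2 _⟩, fun a => ?_, ?_⟩
  · exact (y.2 (i a)).lt_of_ne' ((h _).1 ⟨a, rfl⟩)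
  · rw [extendByZero_eq_iff hi]
    refine ⟨fun _ => rfl, fun k hk => ?_⟩
    by_contra h'
    exact hk ((h k).2 h')

theorem extendByZero_factor {ι κ ρ : Type} {i : ι → κ} {j : ρ → κ} {l : ρ → ι}
    (hi : Function.Injective i) (hl : ∀ a, i (l a) = j a) {x : orthant ι} {y : orthant ρ}
    (h : extendByZero i x = extendByZero j y) (hj : Function.Injective j) (hy : IsPositive y) :
    extendByZero l y = x := by
  have hlinj : Function.Injective l := fun a b hab => hj (by rw [← hl, ← hl, hab])
  rw [extendByZero_eq_iff hlinj]
  refine ⟨fun a => ?_, fun a ha => ?_⟩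
  · rw [← extendByZero_apply hi, h, hl, extendByZero_apply hj]
  · by_contra hne
    have h1 : i a ∈ Set.range j := by
      rw [range_eq_support hj hy, ← h, extendByZero_apply hi]
      exact hne
    obtain ⟨b, hb⟩ := h1
    exact ha ⟨b, hi (by rw [hl, hb])⟩

/-- The normal form of a length vector is reached by contracting the edges of length zero. Its
support determines which edges are contracted, and factorization gives uniqueness. -/
theorem spanProperty_moduliDiagram (g : ℕ) : (moduliDiagram g).SpanProperty := by
  refine ConeDiagram.spanProperty_of_normalForm _ (fun c (x : orthant (Fin (StableGraph.m c))) =>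
    IsPositive x) ?_ ?_ ?_
  · intro Γ x
    obtain ⟨Γ', φ, hφ⟩ := StableGraph.exists_contraction Γ {e | x.1 e = 0}
    obtain ⟨z, hz, h⟩ := exists_restrict φ.emap_injective x (by rw [hφ]; simp)
    exact ⟨Γ', φ, z, hz, h⟩
  · intro _ _ _ f g
    exact ⟨StableGraph.Hom.comp f g, fun x =>
      (extendByZero_comp (StableGraph.Hom.toSpecialization f).emap_injective
        (StableGraph.Hom.toSpecialization g).emap_injective x).symm⟩
  · intro c c' i f f' z z' hz hz' h
    let φ : StableGraph.Hom i c := f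
    let φ' : StableGraph.Hom i c' := f'
    have h' : extendByZero φ.emap z = extendByZero φ'.emap z' := h
    obtain ⟨χ, -, h2, -⟩ := φ'.exists_factor φ (fun e he => by
      rw [range_eq_support φ'.emap_injective hz', ← h']
      rwa [range_eq_support φ.emap_injective hz] at he)
    exact ⟨χ, extendByZero_factor φ'.emap_injective h2 h'.symm φ.emap_injective hz⟩

/-- The normal form is reached in two stages: the edges of Γ of total length zero are contracted,
then the exceptional vertices at distance zero from an end are moved to that end. Uniqueness is
again the factorization property. -/
theorem spanProperty_jacobianDiagram (μ : UniversalPolarization g d) :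
    (jacobianDiagram μ).SpanProperty := by
  refine ConeDiagram.spanProperty_of_normalForm _ (fun c (x : orthant (QDObj.Edge c)) =>
    IsPositive x) ?_ ?_ ?_
  · intro a x
    let P : QD a.Γ.graph a.Γ.leg (μ.μ a.Γ) d := QDObj.P a
    let x : orthant (SubEdge P.S) := x
    obtain ⟨Γ', φ, hφ⟩ := StableGraph.exists_contraction (QDObj.Γ a)
      {e | ∀ f, overEdge P.S f = e → x.1 f = 0}
    let Q := P.push φ.toSpecialization φ.map_leg (μ.map_eq φ)
    let τ := P.toPush φ.toSpecialization φ.map_leg (μ.map_eq φ)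
    -- The surviving half is the one with index `true` unless its length is zero. As the edge has
    -- positive total length, the surviving half always has positive length. The set `S₀` consists
    -- of the edges with both halves of positive length.
    let h : Fin Γ'.m → Bool := fun e => if ∃ he : e ∈ Q.S, x.1 (τ.emap (.inr (⟨e, he⟩, true))) ≠ 0
      then true else false
    let S₀ := Q.S.filter fun e => ∀ he : e ∈ Q.S, ∀ k, x.1 (τ.emap (.inr (⟨e, he⟩, k))) ≠ 0
    have hS₀ : S₀ ⊆ Q.S := Finset.filter_subset _ _
    let ρ := Q.toCollapse S₀ hS₀ h
    let ψ : QDObj.Hom a ⟨Γ', Q.collapse S₀ hS₀ h⟩ :=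
      QDObj.Hom.comp (b := ⟨Γ', Q⟩) ⟨StableGraph.Hom.id Γ', ρ⟩ ⟨φ, τ⟩
    have hrange : ∀ f, f ∈ Set.range ψ.τ.emap ↔ x.1 f ≠ 0 := by
      intro f
      have hover : overEdge P.S f ∈ Set.range φ.emap ↔
          ∃ f', overEdge P.S f' = overEdge P.S f ∧ x.1 f' ≠ 0 := by
        rw [hφ]
        simp only [Set.mem_compl_iff, Set.mem_ofPred_eq, not_forall]
        exact exists_congr fun _ => by rw [exists_prop]
      constructor
      · rintro ⟨f, rfl⟩
        change x.1 (τ.emap (ρ.emap f)) ≠ 0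
        have hρ := (Specialization.mem_range_collapseEmap_iff hS₀ h (ρ.emap f)).1 ⟨f, rfl⟩
        have hτ := (P.range_toPush φ.toSpecialization φ.map_leg (μ.map_eq φ)
          (τ.emap (ρ.emap f))).1 ⟨_, rfl⟩
        rw [hφ] at hτ
        simp only [Set.mem_compl_iff, Set.mem_ofPred_eq, not_forall] at hτ
        obtain ⟨f', hf', hne⟩ := hτ
        obtain ⟨f'', rfl⟩ := (P.range_toPush φ.toSpecialization φ.map_leg (μ.map_eq φ) f').2 (by
          rw [hf', τ.overEdge_emap]; exact ⟨_, rfl⟩)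
        have hf'' := hf'
        rw [τ.overEdge_emap, (P.toPush φ.toSpecialization _ _).overEdge_emap] at hf''
        replace hf'' := φ.emap_injective hf''
        generalize ρ.emap f = y at *
        rcases y with y | ⟨y, k⟩
        · rcases f'' with f'' | ⟨f'', k'⟩
          · rwa [show (.inl y : SubEdge Q.S) = .inl f'' from
              congrArg Sum.inl (Subtype.ext hf''.symm)]
          · exact (y.2 ((show (f'' : Fin Γ'.m) = y from hf'') ▸ f''.2)).elim
        · by_cases hy : (y : Fin Γ'.m) ∈ S₀
          · exact (Finset.mem_filter.1 hy).2 y.2 k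
          · obtain rfl := hρ y k rfl hy
            by_cases hex : ∃ he : (y : Fin Γ'.m) ∈ Q.S, x.1 (τ.emap (.inr (⟨y, he⟩, true))) ≠ 0
            · have : h y = true := if_pos hex
              rw [this]
              exact hex.2
            · have : h y = false := if_neg hex
              rw [this]
              rcases f'' with f'' | ⟨f'', k'⟩
              · exact (f''.2 ((show (f'' : Fin Γ'.m) = y from hf'') ▸ y.2)).elim
              · obtain rfl : f'' = y := Subtype.ext hf''
                cases k'
                · exact hne
                · exact (hex ⟨f''.2, hne⟩).elim
      · intro hne
        obtain ⟨f, rfl⟩ := (P.range_toPush φ.toSpecialization φ.map_leg (μ.map_eq φ) f).2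
          (hover.2 ⟨f, rfl, hne⟩)
        have hρ : f ∈ Set.range ρ.emap := by
          refine (Specialization.mem_range_collapseEmap_iff hS₀ h f).2 ?_
          rintro y k rfl hy
          by_contra hk
          refine hy (Finset.mem_filter.2 ⟨y.2, fun he k' => ?_⟩)
          by_cases hex : ∃ he : (y : Fin Γ'.m) ∈ Q.S, x.1 (τ.emap (.inr (⟨y, he⟩, true))) ≠ 0
          · have hy : h y = true := if_pos hex
            rw [hy] at hk
            cases k'
            · cases k
              · exact hne
              · exact (hk rfl).elim
            · exact hex.2
          · have hy : h y = false := if_neg hex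
            rw [hy] at hk
            cases k
            · exact (hk rfl).elim
            · exact (hex ⟨y.2, hne⟩).elim
        obtain ⟨f', rfl⟩ := hρ
        exact ⟨f', rfl⟩
    obtain ⟨z, hz, h⟩ := exists_restrict ψ.τ.emap_injective x hrange
    exact ⟨_, ψ, z, hz, h⟩
  · intro _ _ _ f g
    exact ⟨QDObj.Hom.comp f g, fun x =>
      (extendByZero_comp (QDObj.Hom.τ f).emap_injective (QDObj.Hom.τ g).emap_injective x).symm⟩
  · intro c c' i f f' z z' hz hz' h
    let φ : QDObj.Hom i c := f
    let φ' : QDObj.Hom i c' := f'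
    have h' : extendByZero φ.τ.emap z = extendByZero φ'.τ.emap z' := h
    obtain ⟨χ, -, h2⟩ := φ'.exists_factor φ (fun e he => by
      rw [range_eq_support φ'.τ.emap_injective hz', ← h']
      rwa [range_eq_support φ.τ.emap_injective hz] at he)
    exact ⟨χ, extendByZero_factor φ'.τ.emap_injective h2 h'.symm φ.τ.emap_injective hz⟩

theorem continuous_totalLength {E : Type} [Fintype E] [DecidableEq E] (S : Finset E) :
    Continuous (totalLength S) := by
  refine continuous_induced_rng.2 (continuous_pi fun e => ?_)
  exact continuous_finsetSum _ fun f _ => (continuous_apply f).comp continuous_subtype_val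

theorem isMorphism_forget (μ : UniversalPolarization g d) :
    ConeDiagram.IsMorphism (jacobianDiagram μ) (moduliDiagram g) (forget μ) := by
  refine ⟨continuous_quot_lift _ ?_, fun a => ⟨QDObj.Γ a,
    totalLength (E := Fin _) (QDObj.P a).S, ⟨Matrix.of fun e f =>
      if overEdge (QDObj.P a).S f = e then 1 else 0, fun x => ?_⟩, fun x => rfl⟩⟩
  · exact continuous_sigma fun a =>
      (ConeDiagram.continuous_incl (D := moduliDiagram g) (QDObj.Γ a)).comp
        (continuous_totalLength (E := Fin _) (QDObj.P a).S)
  · funext e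
    simp only [totalLength, Matrix.mulVec, dotProduct, Finset.sum_filter, Matrix.map_apply,
      Matrix.of_apply]
    refine Finset.sum_congr rfl fun f _ => ?_
    split_ifs <;> simp

end Diagrams

end TropJac

end

/-! ### Quasistability in terms of the graph without exceptional vertices. -/

noncomputable section

namespace TropJac

open scoped Classical

open Multigraph

namespace Multigraph

variable {V E : Type}

/-- The number of edges of `F` joining a vertex in `W` to one outside `W`. -/
def cutCount (G : Multigraph V E) (F : Finset E) (W : Finset V) : ℕ :=
  (F.filter (G.Crosses W)).card

/-- The function `W ↦ c(W) + |F(W, Wᶜ)| / 2`. -/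
def edgeBeta (G : Multigraph V E) (F : Finset E) (c : V → ℝ) (W : Finset V) : ℝ :=
  ∑ v ∈ W, c v + (G.cutCount F W : ℝ) / 2

/-- Quasistability of a real function on the vertices with respect to a set of edges. -/
def EdgeStable [Fintype V] (G : Multigraph V E) (F : Finset E) (v₀ : V) (c : V → ℝ) : Prop :=
  ∀ W, W ≠ Finset.univ → 0 ≤ G.edgeBeta F c W ∧ (v₀ ∈ W → 0 < G.edgeBeta F c W)

/-- The function on vertices associated with a divisor on the `S`-subdivision. -/
def chip (G : Multigraph V E) (S : Finset E) (μ : V → ℝ) (D : V → ℤ) (v : V) : ℝ :=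
  D v - μ v - (∑ p : {e // e ∈ S} × Bool, if G.ends p.1 p.2 = v then 1 else 0) / 2

variable {G : Multigraph V E}

theorem cutCount_eq_sum (F : Finset E) (W : Finset V) :
    (G.cutCount F W : ℝ) = ∑ e ∈ F, if G.Crosses W e then 1 else 0 := by
  simp [cutCount]

theorem crosses_compl [Fintype V] {W : Finset V} {e : E} : G.Crosses Wᶜ e ↔ G.Crosses W e := by
  simp only [Crosses, Finset.mem_compl]
  tauto

theorem edgeBeta_add_compl [Fintype V] (F : Finset E) (c : V → ℝ) (W : Finset V) :
    G.edgeBeta F c W + G.edgeBeta F c Wᶜ = ∑ v, c v + G.cutCount F W := by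
  have h : G.cutCount F Wᶜ = G.cutCount F W := by simp only [cutCount, crosses_compl]
  rw [edgeBeta, edgeBeta, h, ← Finset.sum_add_sum_compl W c]
  ring

theorem edgeBeta_univ [Fintype V] (F : Finset E) (c : V → ℝ) :
    G.edgeBeta F c Finset.univ = ∑ v, c v := by
  simp [edgeBeta, cutCount, Crosses]

theorem edgeBeta_add (F : Finset E) (c c' : V → ℝ) (W : Finset V) :
    G.edgeBeta F (fun v => c v + c' v) W = G.edgeBeta F c W + ∑ v ∈ W, c' v := by
  rw [edgeBeta, edgeBeta, Finset.sum_add_distrib]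
  ring

/-- The cut count is submodular, and each edge joining A \ B to B \ A is counted twice on the right
and not at all on the left; after halving it contributes 1 to the defect. -/
theorem edgeBeta_submodular {F F₀ : Finset E} (hF : F₀ ⊆ F) (c : V → ℝ) {A B : Finset V}
    (h : ∀ e ∈ F₀, ∃ b, (G.ends e b ∈ A ∧ G.ends e b ∉ B) ∧ G.ends e (!b) ∉ A ∧
      G.ends e (!b) ∈ B) :
    G.edgeBeta F c (A ∩ B) + G.edgeBeta F c (A ∪ B) + F₀.card ≤
      G.edgeBeta F c A + G.edgeBeta F c B := by
  have h1 := Finset.sum_union_inter (s₁ := A) (s₂ := B) (f := c)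
  have h2 : (G.cutCount F (A ∩ B) : ℝ) + G.cutCount F (A ∪ B) + 2 * F₀.card ≤
      G.cutCount F A + G.cutCount F B := by
    have h3 : (F₀.card : ℝ) = ∑ e ∈ F, if e ∈ F₀ then 1 else 0 := by
      rw [Finset.sum_ite_mem, Finset.inter_eq_right.2 hF]
      simp
    simp only [cutCount_eq_sum, h3, Finset.mul_sum, ← Finset.sum_add_distrib]
    refine Finset.sum_le_sum fun e _ => ?_
    have he : e ∈ F₀ → ∃ b, (G.ends e b ∈ A ∧ G.ends e b ∉ B) ∧ G.ends e (!b) ∉ A ∧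
      G.ends e (!b) ∈ B := h e
    simp only [Crosses, Finset.mem_inter, Finset.mem_union]
    by_cases h0 : e ∈ F₀
    · obtain ⟨b, ⟨h1, h2⟩, h3, h4⟩ := he h0
      cases b <;> simp only [Bool.not_true, Bool.not_false] at h1 h2 h3 h4 <;>
        simp [h0, h1, h2, h3, h4] <;> norm_num
    · by_cases h1 : G.ends e false ∈ A <;> by_cases h2 : G.ends e true ∈ A <;>
        by_cases h3 : G.ends e false ∈ B <;> by_cases h4 : G.ends e true ∈ B <;>
          simp [h0, h1, h2, h3, h4]
  simp only [edgeBeta]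
  linarith

/-- If `F` contains an edge that is not a bridge, then some edge can be removed from `F`. -/
theorem exists_removable [Fintype V] {F : Finset E} {c : V → ℝ} (hc : ∀ W, 0 ≤ G.edgeBeta F c W)
    {e : E} (he : e ∈ F) (hbridge : ∀ W, G.Crosses W e → ∃ e' ∈ F, e' ≠ e ∧ G.Crosses W e') :
    ∃ f ∈ F, ∃ b, ∀ W, G.ends f b ∈ W → G.ends f (!b) ∉ W → 1 ≤ G.edgeBeta F c W := by
  by_contra! hcon
  obtain ⟨W₀, hu₀, hv₀, -⟩ := hcon e he false
  simp only [Bool.not_false] at hv₀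
  -- Among the sets separating the ends of `e` in the given direction, `W` has the least value,
  -- which is below 1. As `e` is not a bridge, a second edge `e'` crosses `W`.
  obtain ⟨W, hW, hmin⟩ := Finset.exists_min_image
    (Finset.univ.filter fun W => G.ends e false ∈ W ∧ G.ends e true ∉ W) (G.edgeBeta F c)
    ⟨W₀, by simp [hu₀, hv₀]⟩
  simp only [Finset.mem_filter, Finset.mem_univ, true_and] at hW hmin
  obtain ⟨hu, hv⟩ := hW
  have hW1 : G.edgeBeta F c W < 1 := by
    obtain ⟨W₁, h1, h2, h3⟩ := hcon e he false
    exact (hmin W₁ ⟨h1, h2⟩).trans_lt h3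
  obtain ⟨e', he', hne, hcross⟩ := hbridge W (by simp [Crosses, hu, hv])
  obtain ⟨b, hb, hb'⟩ : ∃ b, G.ends e' b ∈ W ∧ G.ends e' (!b) ∉ W := by
    by_cases h : G.ends e' false ∈ W
    · exact ⟨false, h, fun h' => hcross (iff_of_true h h')⟩
    · exact ⟨true, by_contra fun h' => hcross (iff_of_false h h'), h⟩
  -- The failing set `W'` for `e'` is taken in the opposite direction, so that `e'` joins W \ W' to
  -- W' \ W and submodularity gains 1.
  obtain ⟨W', h1, h2, h3⟩ := hcon e' he' (!b)
  rw [Bool.not_not] at h2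
  have key : ∀ F₀ ⊆ F, (∀ f ∈ F₀, ∃ b, (G.ends f b ∈ W ∧ G.ends f b ∉ W') ∧
      G.ends f (!b) ∉ W ∧ G.ends f (!b) ∈ W') →
      G.edgeBeta F c (W ∩ W') + G.edgeBeta F c (W ∪ W') + F₀.card ≤
        G.edgeBeta F c W + G.edgeBeta F c W' := fun F₀ hF₀ h =>
    edgeBeta_submodular hF₀ c h
  have key1 := key {e'} (by simpa using he') fun f hf => by
    rw [Finset.mem_singleton.1 hf]
    exact ⟨b, ⟨hb, h2⟩, hb', h1⟩
  rw [Finset.card_singleton, Nat.cast_one] at key1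
  -- If the intersection or the union competes with `W`, minimality forces the value of `W'` to be
  -- at least 1. In the remaining case `e` joins the two differences as well, and the gain of 2
  -- contradicts that both values are below 1.
  by_cases hu' : G.ends e false ∈ W'
  · have h4 := hmin (W ∩ W') ⟨Finset.mem_inter.2 ⟨hu, hu'⟩, fun h => hv (Finset.mem_inter.1 h).1⟩
    have h5 := hc (W ∪ W')
    linarith
  · by_cases hv' : G.ends e true ∈ W'
    · have key2 := key {e, e'} (by
        intro f hf
        rcases Finset.mem_insert.1 hf with rfl | hf
        · exact he
        · exact (Finset.mem_singleton.1 hf) ▸ he') (by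
        intro f hf
        rcases Finset.mem_insert.1 hf with rfl | hf
        · exact ⟨false, ⟨hu, hu'⟩, hv, hv'⟩
        · rw [Finset.mem_singleton.1 hf]
          exact ⟨b, ⟨hb, h2⟩, hb', h1⟩)
      rw [Finset.card_pair hne.symm] at key2
      have h4 := hc (W ∩ W')
      have h5 := hc (W ∪ W')
      push_cast at key2
      linarith
    · have h4 := hmin (W ∪ W') ⟨Finset.mem_union_left _ hu, fun h => by
        rcases Finset.mem_union.1 h with h | h
        exacts [hv h, hv' h]⟩
      have h5 := hc (W ∩ W')
      linarith

theorem sum_indicator_sub (u v : V) (t : ℤ) (W : Finset V) :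
    ∑ w ∈ W, (((if w = u then t else 0) - (if w = v then t else 0) : ℤ) : ℝ) =
      (if u ∈ W then (t : ℝ) else 0) - (if v ∈ W then (t : ℝ) else 0) := by
  push_cast
  rw [Finset.sum_sub_distrib, Finset.sum_ite_eq', Finset.sum_ite_eq']

/-- Chips can be distributed on the ends of an edge. -/
theorem exists_distribution [Fintype V] {F : Finset E} {c : V → ℝ} {e : E} (he : e ∈ F)
    (hc : ∀ W, (G.ends e false ∈ W ↔ G.ends e true ∈ W) → 0 ≤ G.edgeBeta F c W) :
    ∃ t : ℤ, ∀ W, 0 ≤ G.edgeBeta F (fun w => c w +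
      (((if w = G.ends e false then t else 0) - (if w = G.ends e true then t else 0) : ℤ) : ℝ)) W := by
  simp only [edgeBeta_add, sum_indicator_sub]
  by_cases huv : G.ends e false = G.ends e true
  · exact ⟨0, fun W => by simpa using hc W (by rw [huv])⟩
  obtain ⟨A, hA, hAmin⟩ := Finset.exists_min_image
    (Finset.univ.filter fun W => G.ends e false ∈ W ∧ G.ends e true ∉ W) (G.edgeBeta F c)
    ⟨{G.ends e false}, by simpa using Ne.symm huv⟩
  obtain ⟨B, hB, hBmin⟩ := Finset.exists_min_image
    (Finset.univ.filter fun W => G.ends e true ∈ W ∧ G.ends e false ∉ W) (G.edgeBeta F c)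
    ⟨{G.ends e true}, by simpa using huv⟩
  simp only [Finset.mem_filter, Finset.mem_univ, true_and] at hA hB hAmin hBmin
  have h := edgeBeta_submodular (G := G) (F₀ := {e}) (by simpa using he) c (A := A) (B := B)
    (by simpa using Or.inl ⟨⟨hA.1, hB.2⟩, hA.2, hB.1⟩)
  have h1 := hc (A ∩ B) (by simp [hA, hB])
  have h2 := hc (A ∪ B) (by simp [hA, hB])
  rw [Finset.card_singleton, Nat.cast_one] at h
  -- Moving t chips from the second end to the first adds t to the sets like `A` and subtracts t
  -- from those like `B`, so -β(A) ≤ t ≤ β(B) is needed. This interval has length at least 1 by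
  -- submodularity and contains the integral part of β(B).
  refine ⟨⌊G.edgeBeta F c B⌋, fun W => ?_⟩
  have h3 := Int.floor_le (G.edgeBeta F c B)
  have h4 := Int.lt_floor_add_one (G.edgeBeta F c B)
  by_cases hu : G.ends e false ∈ W <;> by_cases hv : G.ends e true ∈ W
  · simpa [hu, hv] using hc W (by simp [hu, hv])
  · have := hAmin W ⟨hu, hv⟩
    simp only [hu, hv, if_true, if_false]
    linarith
  · have := hBmin W ⟨hv, hu⟩
    simp only [hu, hv, if_true, if_false]
    linarith
  · simpa [hu, hv] using hc W (by simp [hu, hv])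

/-- The numbers y + k/2 form a discrete set; δ is the smaller of the distances from 0 to the largest
negative and to the smallest positive one. -/
theorem exists_gap (y : ℝ) : ∃ δ > 0, ∀ k : ℤ, (y + k / 2 < 0 → y + k / 2 ≤ -δ) ∧
    (0 < y + k / 2 → δ ≤ y + k / 2) := by
  refine ⟨min (-(y + ((⌈-2 * y⌉ - 1 : ℤ) : ℝ) / 2)) (y + ((⌊-2 * y⌋ + 1 : ℤ) : ℝ) / 2),
    lt_min ?_ ?_, fun k => ⟨fun h => ?_, fun h => ?_⟩⟩
  · have := Int.ceil_lt_add_one (-2 * y)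
    push_cast
    linarith
  · have := Int.lt_floor_add_one (-2 * y)
    push_cast
    linarith
  · have h1 : k < ⌈-2 * y⌉ := Int.lt_ceil.2 (by linarith)
    have h2 : (k : ℝ) ≤ ((⌈-2 * y⌉ - 1 : ℤ) : ℝ) := by exact_mod_cast Int.le_sub_one_of_lt h1
    have := min_le_left (-(y + ((⌈-2 * y⌉ - 1 : ℤ) : ℝ) / 2)) (y + ((⌊-2 * y⌋ + 1 : ℤ) : ℝ) / 2)
    linarith
  · have h1 : ⌊-2 * y⌋ < k := Int.floor_lt.2 (by linarith)
    have h2 : ((⌊-2 * y⌋ + 1 : ℤ) : ℝ) ≤ k := by exact_mod_cast h1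
    have := min_le_right (-(y + ((⌈-2 * y⌉ - 1 : ℤ) : ℝ) / 2)) (y + ((⌊-2 * y⌋ + 1 : ℤ) : ℝ) / 2)
    linarith

/-- A small perturbation that turns quasistability into weak inequalities. -/
theorem exists_perturbation [Fintype V] (v₀ : V) (x : V → ℝ) : ∃ η : V → ℝ, ∑ v, η v = 0 ∧
    ∀ W, W ≠ Finset.univ → ∀ k : ℤ, (0 ≤ ∑ v ∈ W, x v + k / 2 ∧
      (v₀ ∈ W → 0 < ∑ v ∈ W, x v + k / 2)) ↔ 0 ≤ ∑ v ∈ W, x v + ∑ v ∈ W, η v + k / 2 := by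
  choose δ hδ hgap using fun W : Finset V => exists_gap (∑ v ∈ W, x v)
  obtain ⟨W₀, -, hW₀⟩ := Finset.exists_min_image Finset.univ δ ⟨∅, Finset.mem_univ _⟩
  let N : ℝ := Fintype.card V
  have hN : 0 ≤ N := Nat.cast_nonneg _
  -- The perturbation puts ε on every vertex and removes εN at `v₀`. On proper subsets its sum is
  -- nonnegative if `v₀` is absent, negative if `v₀` is present, and smaller in size than every gap,
  -- so only the value 0 is treated differently in the two cases.
  let ε : ℝ := δ W₀ / (N + 1)
  have hε : 0 < ε := div_pos (hδ _) (by linarith)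
  have hεN : ε * N < δ W₀ := by
    have : ε * (N + 1) = δ W₀ := div_mul_cancel₀ _ (by linarith)
    linarith
  have hsum : ∀ W : Finset V, ∑ v ∈ W, (ε * (1 - if v = v₀ then N else 0)) =
      ε * (W.card - if v₀ ∈ W then N else 0) := by
    intro W
    rw [← Finset.mul_sum, Finset.sum_sub_distrib, Finset.sum_ite_eq']
    simp
  refine ⟨fun v => ε * (1 - if v = v₀ then N else 0), ?_, fun W hW k => ?_⟩
  · rw [hsum]
    simp [N]
  · rw [hsum]
    have hcard : (W.card : ℝ) + 1 ≤ N := by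
      have : W.card < Fintype.card V := Finset.card_lt_univ_of_notMem
        (x := (not_forall.1 fun h => hW (Finset.eq_univ_of_forall h)).choose)
        (not_forall.1 fun h => hW (Finset.eq_univ_of_forall h)).choose_spec
      have h := (Nat.cast_le (α := ℝ)).2 (Nat.succ_le_of_lt this)
      push_cast at h
      exact h
    have hcard0 : (0 : ℝ) ≤ W.card := Nat.cast_nonneg _
    have hδW := hW₀ W (Finset.mem_univ _)
    obtain ⟨hg1, hg2⟩ := hgap W k
    by_cases hv : v₀ ∈ W
    · simp only [hv, if_true, true_imp_iff]
      have h1 : ε * (W.card - N) < 0 := mul_neg_of_pos_of_neg hε (by linarith)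
      have h2 : -(ε * N) ≤ ε * (W.card - N) := by nlinarith
      constructor
      · rintro ⟨-, h⟩
        have := hg2 h
        linarith
      · intro h
        constructor <;> linarith
    · simp only [hv, if_false, false_imp_iff, and_true, sub_zero]
      have h1 : 0 ≤ ε * W.card := mul_nonneg hε.le hcard0
      have h2 : ε * W.card ≤ ε * N := mul_le_mul_of_nonneg_left (by linarith) hε.le
      constructor
      · intro h
        linarith
      · intro h
        by_contra! hneg
        have := hg1 hneg
        linarith

theorem sum_chip (S : Finset E) (μ : V → ℝ) (D : V → ℤ) (W : Finset V) :
    ∑ v ∈ W, G.chip S μ D v = ∑ v ∈ W, (D v : ℝ) - ∑ v ∈ W, μ v -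
      (∑ p : {e // e ∈ S} × Bool, if G.ends p.1 p.2 ∈ W then 1 else 0) / 2 := by
  simp only [chip, Finset.sum_sub_distrib, ← Finset.sum_div]
  rw [Finset.sum_comm]
  simp only [Finset.sum_ite_eq]

/-- All values differ from -μ(W) by half-integers, whatever the divisor and the edge sets are;
therefore one perturbation serves all pseudo-divisors at once. -/
theorem exists_edgeBeta_chip_eq (F S : Finset E) (μ : V → ℝ) (D : V → ℤ) (W : Finset V) :
    ∃ k : ℤ, G.edgeBeta F (G.chip S μ D) W = ∑ v ∈ W, -μ v + k / 2 := by
  refine ⟨2 * ∑ v ∈ W, D v - (∑ p : {e // e ∈ S} × Bool, if G.ends p.1 p.2 ∈ W then 1 else 0) +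
    G.cutCount F W, ?_⟩
  rw [edgeBeta, sum_chip, Finset.sum_neg_distrib]
  push_cast
  ring

theorem sum_chip_univ [Fintype V] (S : Finset E) (μ : V → ℝ) (D : V → ℤ) :
    ∑ v, G.chip S μ D v = ∑ v, (D v : ℝ) - ∑ v, μ v - S.card := by
  rw [sum_chip]
  simp

/-- Perturbed quasistability. -/
theorem exists_perturbation_chip [Fintype V] (G : Multigraph V E) (v₀ : V) (μ : V → ℝ) :
    ∃ η : V → ℝ, ∑ v, η v = 0 ∧ ∀ W, W ≠ Finset.univ → ∀ (F S : Finset E) (D : V → ℤ) (j : ℤ),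
      (0 ≤ G.edgeBeta F (G.chip S μ D) W - j ∧ (v₀ ∈ W → 0 < G.edgeBeta F (G.chip S μ D) W - j)) ↔
        (j : ℝ) ≤ G.edgeBeta F (fun v => G.chip S μ D v + η v) W := by
  obtain ⟨η, h1, h2⟩ := exists_perturbation v₀ fun v => -μ v
  refine ⟨η, h1, fun W hW F S D j => ?_⟩
  obtain ⟨k, hk⟩ := exists_edgeBeta_chip_eq (G := G) F S μ D W
  have := h2 W hW (k - 2 * j)
  rw [edgeBeta_add, hk]
  push_cast at this
  have e1 : ∑ v ∈ W, -μ v + (k - 2 * j : ℝ) / 2 = ∑ v ∈ W, -μ v + k / 2 - j := by ring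
  have e2 : ∑ v ∈ W, -μ v + ∑ v ∈ W, η v + (k - 2 * j : ℝ) / 2 =
    ∑ v ∈ W, -μ v + k / 2 + ∑ v ∈ W, η v - j := by ring
  rw [e1, e2] at this
  rw [this, sub_nonneg]

section Subdiv

variable [Fintype V] [Fintype E] [DecidableEq E]

/-- An exceptional vertex inside `W` contributes nothing once the half-edges of `S` are charged to
their ends by `chip`; outside `W` it adds the number of its ends in `W₀`. For a given trace `W₀` the
value is least when all exceptional vertices are included. -/
theorem beta_subdiv (S : Finset E) (μ : V → ℝ) (D : SubVertex V S → ℤ) (hD : ∀ e, D (.inr e) = -1)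
    (W : Finset (SubVertex V S)) (W₀ : Finset V) (hW : ∀ v, v ∈ W₀ ↔ .inl v ∈ W) :
    beta (G.subdiv S) (Sum.elim μ fun _ => 0) D W =
      G.edgeBeta Sᶜ (G.chip S μ fun v => D (.inl v)) W₀ +
        ∑ e : {e // e ∈ S}, if .inr e ∈ W then 0 else
          ∑ b : Bool, if G.ends e b ∈ W₀ then (1 : ℝ) else 0 := by
  have h1 : ∀ f : SubVertex V S → ℝ, ∑ x ∈ W, f x = ∑ v ∈ W₀, f (.inl v) +
      ∑ e : {e // e ∈ S}, if .inr e ∈ W then f (.inr e) else 0 := by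
    intro f
    have : ∑ x ∈ W, f x = ∑ x, if x ∈ W then f x else 0 := by simp
    rw [this, Fintype.sum_sum_type]
    simp only [← hW]
    simp
  have h2 : ((G.subdiv S).delta W : ℝ) = G.cutCount Sᶜ W₀ +
      ∑ e : {e // e ∈ S}, ∑ b : Bool, if (G.ends e b ∈ W₀ ↔ .inr e ∈ W) then 0 else 1 := by
    simp only [delta, Finset.card_filter]
    push_cast
    rw [Fintype.sum_sum_type, Fintype.sum_prod_type, cutCount_eq_sum,
      Finset.sum_subtype Sᶜ (p := fun e => e ∉ S) (by simp)]
    congr 1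
    · refine Finset.sum_congr rfl fun e _ => ?_
      exact if_congr (by simp [Multigraph.subdiv, Crosses, hW]) rfl rfl
    · refine Finset.sum_congr rfl fun e _ => Finset.sum_congr rfl fun b _ => ?_
      cases b
      · simp [Multigraph.subdiv, hW]
      · simp [Multigraph.subdiv, hW, iff_comm]
  have h3 : (∑ e : {e // e ∈ S}, if .inr e ∈ W then (-1 : ℝ) else 0) +
      (∑ e : {e // e ∈ S}, ∑ b : Bool, if (G.ends e b ∈ W₀ ↔ .inr e ∈ W) then 0 else 1) / 2 +
      (∑ e : {e // e ∈ S}, ∑ b : Bool, if G.ends e b ∈ W₀ then 1 else 0) / 2 =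
      ∑ e : {e // e ∈ S}, if .inr e ∈ W then 0 else
          ∑ b : Bool, if G.ends e b ∈ W₀ then (1 : ℝ) else 0 := by
    rw [Finset.sum_div, Finset.sum_div, ← Finset.sum_add_distrib, ← Finset.sum_add_distrib]
    refine Finset.sum_congr rfl fun e _ => ?_
    simp only [Fintype.sum_bool]
    by_cases h1 : G.ends e false ∈ W₀ <;> by_cases h2 : G.ends e true ∈ W₀ <;>
      by_cases h3 : (.inr e : SubVertex V S) ∈ W <;> simp [h1, h2, h3] <;> norm_num
  rw [beta, edgeBeta, sum_chip, h1, h1, h2, Fintype.sum_prod_type, ← h3]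
  simp only [hD, Sum.elim_inl, Sum.elim_inr, Int.cast_neg, Int.cast_one, ite_self,
    Finset.sum_const_zero]
  ring

/-- By `beta_subdiv` it suffices to test the sets that contain all exceptional vertices, and these
correspond to sets of vertices of `G`. -/
theorem isQuasistable_subdiv_iff {S : Finset E} {v₀ : V} {μ : V → ℝ} {d : ℤ} (hμ : ∑ v, μ v = d)
    {D : SubVertex V S → ℤ} (hD : ∀ e, D (.inr e) = -1) :
    IsQuasistable (G.subdiv S) (.inl v₀) (Sum.elim μ fun _ => 0) d D ↔
      ∑ v, D (.inl v) = d + S.card ∧ G.EdgeStable Sᶜ v₀ (G.chip S μ fun v => D (.inl v)) := by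
  have hsum : ∑ x, D x = ∑ v, D (.inl v) - S.card := by
    rw [Fintype.sum_sum_type]
    simp [hD, sub_eq_add_neg]
  constructor
  · rintro ⟨h1, h2⟩
    refine ⟨by rw [← h1, hsum]; ring, fun W hW => ?_⟩
    let W' : Finset (SubVertex V S) := Finset.univ.filter fun x => ∀ v, x = .inl v → v ∈ W
    have hW'1 : ∀ v, v ∈ W ↔ .inl v ∈ W' := by simp [W']
    have hW'2 : ∀ e, .inr e ∈ W' := by simp [W']
    have h3 := h2 W' fun h => hW (Finset.eq_univ_of_forall fun v => by
      rw [hW'1, h]; exact Finset.mem_univ _)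
    rw [beta_subdiv S μ D hD W' W hW'1, ← hW'1] at h3
    simpa [hW'2] using h3
  · rintro ⟨h1, h2⟩
    refine ⟨by rw [hsum, h1]; ring, fun W hW => ?_⟩
    let W₀ : Finset V := Finset.univ.filter fun v => .inl v ∈ W
    have hW₀ : ∀ v, v ∈ W₀ ↔ .inl v ∈ W := by simp [W₀]
    rw [beta_subdiv S μ D hD W W₀ hW₀, ← hW₀]
    have hnn : ∀ e : {e // e ∈ S}, (0 : ℝ) ≤ if .inr e ∈ W then 0 else
        ∑ b : Bool, if G.ends e b ∈ W₀ then (1 : ℝ) else 0 := by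
      intro e
      split_ifs
      · exact le_rfl
      · exact Finset.sum_nonneg fun b _ => by split_ifs <;> norm_num
    have hextra := Finset.sum_nonneg fun e (_ : e ∈ Finset.univ) => hnn e
    -- A proper subset containing all vertices of `G` misses some exceptional vertex. The function
    -- `chip` has sum zero, and each missing vertex adds 2, so strict inequality holds.
    by_cases huniv : W₀ = Finset.univ
    · have hchip : ∑ v, G.chip S μ (fun v => D (.inl v)) v = 0 := by
        rw [sum_chip_univ, hμ]
        have : ((∑ v, D (.inl v) : ℤ) : ℝ) = ((d + S.card : ℤ) : ℝ) := by rw [h1]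
        push_cast at this
        linarith
      have hpos : (0 : ℝ) < ∑ e : {e // e ∈ S}, if .inr e ∈ W then 0 else
          ∑ b : Bool, if G.ends e b ∈ W₀ then (1 : ℝ) else 0 := by
        obtain ⟨x, hx⟩ : ∃ x, x ∉ W := by
          by_contra! h
          exact hW (Finset.eq_univ_of_forall h)
        rcases x with v | e
        · have := Finset.mem_univ v
          rw [← huniv, hW₀] at this
          exact (hx this).elim
        · refine Finset.sum_pos' (fun e _ => hnn e) ⟨e, Finset.mem_univ _, ?_⟩
          rw [if_neg hx, huniv]
          simp
      rw [huniv, edgeBeta_univ, hchip, zero_add]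
      rw [huniv] at hpos
      exact ⟨hpos.le, fun _ => hpos⟩
    · have := h2 W₀ huniv
      exact ⟨by linarith, fun h => by linarith [this.2 h]⟩

end Subdiv

end Multigraph

/-! ### Uniqueness, enlargement and lifting of pseudo-divisors. -/

namespace QD

variable {V E V' E' : Type} [Fintype V] [Fintype E] [DecidableEq E] [Fintype V']
  [Fintype E'] [DecidableEq E'] {G : Multigraph V E} {H : Multigraph V' E'} {v₀ : V} {v₀' : V'}
  {μ : V → ℝ} {μ' : V' → ℝ} {d : ℤ}

/-- The function on vertices associated with a pseudo-divisor. -/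
def chip (P : QD G v₀ μ d) : V → ℝ := G.chip P.S μ fun v => P.D (.inl v)

theorem edgeStable (hμ : ∑ v, μ v = d) (P : QD G v₀ μ d) : G.EdgeStable P.Sᶜ v₀ P.chip :=
  ((isQuasistable_subdiv_iff hμ P.exceptional).1 P.quasistable).2

theorem sum_inl (hμ : ∑ v, μ v = d) (P : QD G v₀ μ d) :
    ∑ v, P.D (.inl v) = d + P.S.card :=
  ((isQuasistable_subdiv_iff hμ P.exceptional).1 P.quasistable).1

theorem sum_chip (hμ : ∑ v, μ v = d) (P : QD G v₀ μ d) : ∑ v, P.chip v = 0 := by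
  have h := congrArg (Int.cast (R := ℝ)) (P.sum_inl hμ)
  push_cast at h
  rw [chip, sum_chip_univ, hμ, h]
  ring

/-- A pseudo-divisor given by its values on the vertices of the graph. -/
def ofEdgeStable (hμ : ∑ v, μ v = d) (S : Finset E) (D : V → ℤ) (hD : ∑ v, D v = d + S.card)
    (h : G.EdgeStable Sᶜ v₀ (G.chip S μ D)) : QD G v₀ μ d where
  S := S
  D := Sum.elim D fun _ => -1
  exceptional _ := rfl
  quasistable := (isQuasistable_subdiv_iff hμ (fun _ => rfl)).2 ⟨hD, h⟩

/-- The complement of the support of a pseudo-divisor is connected. -/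
theorem connected_compl (hμ : ∑ v, μ v = d) (P : QD G v₀ μ d) (v w : V) :
    G.Reach ((P.Sᶜ : Finset E) : Set E) v w := by
  suffices h : ∀ v, G.Reach ((P.Sᶜ : Finset E) : Set E) v₀ v from (h v).symm.trans (h w)
  by_contra! hcon
  obtain ⟨u, hu⟩ := hcon
  -- For the component `W` of `v₀` no edge crosses, so the values of `W` and of its complement add
  -- up to 0, although the first is positive and the second nonnegative.
  let W : Finset V := Finset.univ.filter fun v => G.Reach ((P.Sᶜ : Finset E) : Set E) v₀ v
  have hv₀ : v₀ ∈ W := by simpa [W] using Reach.refl v₀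
  have h1 := (P.edgeStable hμ W fun h => hu (by
    have := Finset.mem_univ u
    rw [← h] at this
    exact (Finset.mem_filter.1 this).2)).2 hv₀
  have h2 := (P.edgeStable hμ Wᶜ fun h => by
    have := Finset.mem_univ v₀
    rw [← h] at this
    exact Finset.mem_compl.1 this hv₀).1
  have h3 := edgeBeta_add_compl (G := G) P.Sᶜ P.chip W
  have h4 : G.cutCount P.Sᶜ W = 0 := by
    rw [cutCount, Finset.card_eq_zero, Finset.filter_eq_empty_iff]
    intro e he hcross
    refine hcross ?_
    simp only [W, Finset.mem_filter, Finset.mem_univ, true_and]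
    exact ⟨fun h => h.trans (reach_ends (by exact_mod_cast he) _ _),
      fun h => h.trans (reach_ends (by exact_mod_cast he) _ _)⟩
  rw [P.sum_chip hμ, h4] at h3
  simp only [Nat.cast_zero, add_zero] at h3
  linarith

/-- A pseudo-divisor whose complement is a tree is determined by its support. -/
theorem eq_of_tree (hμ : ∑ v, μ v = d) {P Q : QD G v₀ μ d} (hS : P.S = Q.S)
    (hcard : Fintype.card V = P.Sᶜ.card + 1) : P = Q := by
  refine ext' hS fun v => ?_
  have hzero : (fun v => ((P.D (.inl v) - Q.D (.inl v) : ℤ) : ℝ)) = 0 := by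
    refine eq_zero_of_cut_sums (P.connected_compl hμ) _ ?_ ?_
    · rw [← Int.cast_sum, Finset.sum_sub_distrib, P.sum_inl hμ, Q.sum_inl hμ, hS]
      simp
    · intro e he
      obtain ⟨W, hW1, hW2⟩ : ∃ W, (G.Crosses W e ∧ ∀ e' ∈ P.Sᶜ, e' ≠ e → ¬ G.Crosses W e') ∧
          v₀ ∈ W := by
        obtain ⟨W, hW⟩ := exists_cut_of_tree (P.connected_compl hμ) hcard he
        by_cases h : v₀ ∈ W
        · exact ⟨W, hW, h⟩
        · exact ⟨Wᶜ, by simpa only [crosses_compl] using hW, by simpa using h⟩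
      refine ⟨W, hW1.1, hW1.2, ?_⟩
      have hne1 : W ≠ Finset.univ := by
        rintro rfl
        simp [Crosses] at hW1
      have hne2 : Wᶜ ≠ Finset.univ := by
        intro h
        have := crosses_compl.2 hW1.1
        rw [h] at this
        simp [Crosses] at this
      have hcut : G.cutCount P.Sᶜ W = 1 := by
        rw [cutCount, Finset.card_eq_one]
        refine ⟨e, Finset.ext fun e' => ?_⟩
        simp only [Finset.mem_filter, Finset.mem_singleton]
        constructor
        · rintro ⟨h1, h2⟩
          by_contra hne
          exact hW1.2 e' h1 hne h2
        · rintro rfl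
          exact ⟨he, hW1.1⟩
      -- Exactly one edge crosses `W`, so the values of `W` and its complement add up to 1. As `v₀`
      -- lies in `W`, the value of `W` is in (0, 1] for both divisors, and their integral difference
      -- on `W` must vanish.
      have hP1 := (P.edgeStable hμ W hne1).2 hW2
      have hP2 := (P.edgeStable hμ Wᶜ hne2).1
      have hP3 := edgeBeta_add_compl (G := G) P.Sᶜ P.chip W
      have hQ1 := (Q.edgeStable hμ W hne1).2 hW2
      have hQ2 := (Q.edgeStable hμ Wᶜ hne2).1
      have hQ3 := edgeBeta_add_compl (G := G) Q.Sᶜ Q.chip W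
      rw [← hS] at hQ1 hQ2 hQ3
      rw [P.sum_chip hμ, hcut] at hP3
      rw [Q.sum_chip hμ, hcut] at hQ3
      have hdiff : G.edgeBeta P.Sᶜ P.chip W - G.edgeBeta P.Sᶜ Q.chip W =
          ((∑ v ∈ W, (P.D (.inl v) - Q.D (.inl v)) : ℤ) : ℝ) := by
        simp only [edgeBeta, chip, Multigraph.sum_chip, ← hS]
        push_cast
        rw [Finset.sum_sub_distrib]
        ring
      have h1 : ((∑ v ∈ W, (P.D (.inl v) - Q.D (.inl v)) : ℤ) : ℝ) < 1 := by
        rw [← hdiff]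
        push_cast at hP3
        linarith
      have h2 : -1 < ((∑ v ∈ W, (P.D (.inl v) - Q.D (.inl v)) : ℤ) : ℝ) := by
        rw [← hdiff]
        push_cast at hQ3
        linarith
      have h3 : ∑ v ∈ W, (P.D (.inl v) - Q.D (.inl v)) = 0 := by
        have h1' : ∑ v ∈ W, (P.D (.inl v) - Q.D (.inl v)) < 1 := by exact_mod_cast h1
        have h2' : -1 < ∑ v ∈ W, (P.D (.inl v) - Q.D (.inl v)) := by exact_mod_cast h2
        omega
      rw [← Int.cast_sum, h3, Int.cast_zero]
  have := congrFun hzero v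
  simp only [Pi.zero_apply] at this
  exact sub_eq_zero.1 (by exact_mod_cast this)

/-- A pseudo-divisor whose complement contains a cycle is a specialization of one with a larger
support. -/
theorem exists_larger (hμ : ∑ v, μ v = d) (P : QD G v₀ μ d) (hcard : Fintype.card V ≤ P.Sᶜ.card) :
    ∃ Q : QD G v₀ μ d, Q.S.card = P.S.card + 1 ∧
      Nonempty (HomOver (Specialization.id G) Q P) := by
  have : Nonempty V := ⟨v₀⟩
  obtain ⟨e, he, hbridge⟩ := exists_not_bridge (G := G) hcard
  obtain ⟨η, hη, hpert⟩ := exists_perturbation_chip G v₀ μ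
  -- After the perturbation all inequalities are weak and hold for the full vertex set too, as
  -- `exists_removable` requires.
  have hnn : ∀ W, 0 ≤ G.edgeBeta P.Sᶜ (fun v => P.chip v + η v) W := by
    intro W
    by_cases hW : W = Finset.univ
    · rw [hW, edgeBeta_univ, Finset.sum_add_distrib, P.sum_chip hμ, hη, add_zero]
    · have := (hpert W hW P.Sᶜ P.S (fun v => P.D (.inl v)) 0).1 (by
        simpa [QD.chip] using P.edgeStable hμ W hW)
      simpa [QD.chip] using this
  obtain ⟨f, hf, b, hfb⟩ := exists_removable hnn he hbridge
  rw [Finset.mem_compl] at hf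
  -- The new exceptional vertex on `f` has value -1, compensated by a chip at the end `!b`, so
  -- moving it to that end recovers `P`. Only the sets containing the end `b` and not the end `!b`
  -- lose 1, which `hfb` allows.
  let D : V → ℤ := fun v => P.D (.inl v) + if v = G.ends f (!b) then 1 else 0
  have hbeta : ∀ W, G.edgeBeta (insert f P.S)ᶜ (G.chip (insert f P.S) μ D) W =
      G.edgeBeta P.Sᶜ P.chip W -
        if G.ends f b ∈ W ∧ G.ends f (!b) ∉ W then 1 else 0 := by
    intro W
    have h1 : (G.cutCount P.Sᶜ W : ℝ) = (if G.Crosses W f then 1 else 0) +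
        G.cutCount (insert f P.S)ᶜ W := by
      have : P.Sᶜ = insert f (insert f P.S)ᶜ := by
        ext e
        by_cases h : e = f <;> simp [h, hf]
      rw [cutCount_eq_sum, cutCount_eq_sum, this, Finset.sum_insert (by simp)]
    have h2 : ∀ (S : Finset E), (∑ p : {e // e ∈ S} × Bool,
        if G.ends p.1 p.2 ∈ W then (1 : ℝ) else 0) =
        ∑ e ∈ S, ∑ b, if G.ends e b ∈ W then (1 : ℝ) else 0 := by
      intro S
      rw [Fintype.sum_prod_type]
      exact (Finset.sum_subtype S (p := (· ∈ S)) (fun _ => Iff.rfl) fun e =>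
        ∑ b, if G.ends e b ∈ W then (1 : ℝ) else 0).symm
    have h3 : ∑ v ∈ W, ((D v : ℤ) : ℝ) = ∑ v ∈ W, (P.D (.inl v) : ℝ) +
        if G.ends f (!b) ∈ W then 1 else 0 := by
      simp only [D]
      push_cast
      rw [Finset.sum_add_distrib, Finset.sum_ite_eq']
    rw [edgeBeta, edgeBeta, chip, Multigraph.sum_chip, Multigraph.sum_chip, h1, h2, h2,
      Finset.sum_insert hf, h3]
    simp only [Fintype.sum_bool, Crosses]
    cases b <;> by_cases h4 : G.ends f false ∈ W <;> by_cases h5 : G.ends f true ∈ W <;>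
      simp [h4, h5] <;> ring
  have hD : ∑ v, D v = d + (insert f P.S).card := by
    simp only [D]
    rw [Finset.sum_add_distrib, P.sum_inl hμ, Finset.card_insert_of_notMem hf]
    simp [add_assoc]
  have hst : G.EdgeStable (insert f P.S)ᶜ v₀ (G.chip (insert f P.S) μ D) := by
    intro W hW
    rw [hbeta]
    split_ifs with h
    · have := (hpert W hW P.Sᶜ P.S (fun v => P.D (.inl v)) 1).2 (by
        simpa [QD.chip] using hfb W h.1 h.2)
      simpa [QD.chip] using this
    · simpa using P.edgeStable hμ W hW
  let Q := ofEdgeStable hμ (insert f P.S) D hD hst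
  refine ⟨Q, Finset.card_insert_of_notMem hf, ?_⟩
  have hQP : Q.collapse P.S (Finset.subset_insert _ _) (fun _ => b) = P := by
    refine ext' rfl fun v => ?_
    change pushforward (Specialization.collapseVmap G (insert f P.S) P.S fun _ => b)
      (Sum.elim D fun _ => -1) (.inl v) = P.D (.inl v)
    rw [pushforward, Finset.sum_filter, Fintype.sum_sum_type]
    simp only [Specialization.collapseVmap, Sum.inl.injEq, Sum.elim_inl, Sum.elim_inr]
    rw [Finset.sum_ite_eq', if_pos (Finset.mem_univ _),
      Finset.sum_eq_single ⟨f, Finset.mem_insert_self _ _⟩]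
    · simp only [dif_neg hf, Sum.inl.injEq, D]
      by_cases h : G.ends f (!b) = v
      · simp [h]
      · simp [h, Ne.symm h]
    · intro e _ hne
      have : (e : E) ∈ P.S := (Finset.mem_insert.1 e.2).resolve_left fun h => hne (Subtype.ext h)
      simp [this]
    · simp
  have hom := Q.toCollapse P.S (Finset.subset_insert _ _) (fun _ => b)
  rw [hQP] at hom
  exact ⟨hom⟩

/-- Pseudo-divisors lift along the contraction of a single edge. -/
theorem exists_lift (hμ : ∑ v, μ v = d) (ι : Specialization G H) {e : E}
    (he : Set.range ι.emap = {e}ᶜ) (hv : ι.vmap v₀ = v₀') (hμ' : μ' = pushforward ι.vmap μ)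
    (Q : QD H v₀' μ' d) :
    ∃ P : QD G v₀ μ d, P.S = Q.S.image ι.emap ∧ P.push ι hv hμ' = Q := by
  obtain ⟨η, hη, hpert⟩ := exists_perturbation_chip G v₀ μ
  let s : V' → V := Function.surjInv ι.vmap_surjective
  have hs : ∀ v', ι.vmap (s v') = v' := Function.surjInv_eq ι.vmap_surjective
  let S := Q.S.image ι.emap
  have hS : ∀ e', e' ∈ Q.S ↔ ι.emap e' ∈ S := fun e' => by simp [S, ι.emap_injective.eq_iff]
  have hrange : ∀ e ∈ S, e ∈ Set.range ι.emap := fun e he => by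
    obtain ⟨e', -, rfl⟩ := Finset.mem_image.1 he
    exact ⟨e', rfl⟩
  have heS : e ∉ S := fun h => by
    have := hrange e h
    rw [he] at this
    exact this rfl
  -- All chips of a vertex of `H` are first placed on one vertex of its fibre. The divisor `D t`
  -- then moves `t` chips along the contracted edge `e`, which does not change the push-forward.
  let D₀ : V → ℤ := fun w => if w = s (ι.vmap w) then Q.D (.inl (ι.vmap w)) else 0
  let D : ℤ → V → ℤ := fun t w => D₀ w +
    ((if w = G.ends e false then t else 0) - (if w = G.ends e true then t else 0))
  have huv : ι.vmap (G.ends e false) = ι.vmap (G.ends e true) :=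
    ι.vmap_contracted (by rw [he]; simp) _ _
  have hpush : ∀ t v', pushforward ι.vmap (D t) v' = Q.D (.inl v') := by
    intro t v'
    simp only [pushforward, D, Finset.sum_add_distrib, Finset.sum_sub_distrib,
      Finset.sum_ite_eq', Finset.mem_filter, Finset.mem_univ, true_and, huv, sub_self, add_zero]
    rw [Finset.sum_eq_single (s v')]
    · simp [D₀, hs]
    · intro w hw hne
      rw [Finset.mem_filter] at hw
      simp only [D₀, hw.2]
      exact if_neg hne
    · simp [hs]
  have hpush' : ∀ t, pushforward (ι.subdiv hS).vmap (Sum.elim (D t) fun _ => -1) = Q.D := by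
    intro t
    funext x
    rcases x with v' | e'
    · exact (pushforward_subdiv_inl ι hS hrange _ v').trans (hpush t v')
    · refine (pushforward_eq_of_fiber _ fun x => ι.subdivVmap_eq_inr_iff hS x e').trans ?_
      rw [Q.exceptional]
      rfl
  have hμQ : ∑ v', μ' v' = d := by rw [hμ', sum_pushforward, hμ]
  -- The only contracted edge is `e`, so the sets that do not separate its ends are full preimages.
  -- Their inequalities are those of `Q`, independently of `t`.
  have hsatur : ∀ W : Finset V, (G.ends e false ∈ W ↔ G.ends e true ∈ W) → ∀ w,
      ι.vmap w ∈ W.image ι.vmap ↔ w ∈ W := by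
    intro W hW w
    refine ⟨fun h => ?_, Finset.mem_image_of_mem _⟩
    obtain ⟨w', hw', h⟩ := Finset.mem_image.1 h
    have h1 := (ι.vmap_eq_iff _ _).1 h
    rw [he, compl_compl] at h1
    have h2 := h1.apply_eq (fun v => v ∈ W) (by rintro f rfl; exact propext hW)
    exact h2 ▸ hw'
  have hbeta : ∀ W : Finset V, (G.ends e false ∈ W ↔ G.ends e true ∈ W) → ∀ t,
      G.edgeBeta Sᶜ (G.chip S μ (D t)) W = H.edgeBeta Q.Sᶜ Q.chip (W.image ι.vmap) := by
    intro W hW t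
    let W' : Finset (SubVertex V' Q.S) :=
      Finset.univ.filter fun x => ∀ v, x = .inl v → v ∈ W.image ι.vmap
    have hW'1 : ∀ v, v ∈ W.image ι.vmap ↔ .inl v ∈ W' := fun v => by simp [W']
    have hW'2 : ∀ e, .inr e ∈ W' := by simp [W']
    have h1 := beta_subdiv (G := H) Q.S μ' Q.D Q.exceptional W' (W.image ι.vmap) hW'1
    have h2 := beta_subdiv (G := G) S μ (Sum.elim (D t) fun _ => -1) (fun _ => rfl)
      (Finset.univ.filter fun x => (ι.subdiv hS).vmap x ∈ W') W (fun w => by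
        rw [Finset.mem_filter, ← hsatur W hW, hW'1]
        simp [Specialization.subdiv, Specialization.ofSection, Specialization.subdivVmap])
    have h3 : ∀ e : {e // e ∈ S}, .inr e ∈
        Finset.univ.filter fun x => (ι.subdiv hS).vmap x ∈ W' := by
      rintro ⟨e, he⟩
      obtain ⟨e', rfl⟩ := hrange e he
      rw [Finset.mem_filter]
      refine ⟨Finset.mem_univ _, ?_⟩
      have : (ι.subdiv hS).vmap (.inr ⟨ι.emap e', he⟩) = .inr ⟨e', (hS e').2 he⟩ :=
        ι.subdivVmap_inr_emap hS e' he
      rw [this]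
      exact hW'2 _
    simp only [hW'2, if_true, Finset.sum_const_zero, add_zero] at h1
    simp only [h3, if_true, Finset.sum_const_zero, add_zero] at h2
    have h4 := (ι.subdiv hS).beta_preimage (Sum.elim μ fun _ => 0) (Sum.elim (D t) fun _ => -1) W'
    rw [hpush', pushforward_sumElim (f := ι.vmap) (fun _ => rfl), ← hμ'] at h4
    refine h2.symm.trans (Eq.trans ?_ h1)
    convert h4
  have hsumD : ∀ t, ∑ v, D t v = d + S.card := by
    intro t
    rw [← sum_pushforward ι.vmap (D t), Finset.sum_congr rfl fun v _ => hpush t v, Q.sum_inl hμQ,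
      Finset.card_image_of_injective _ ι.emap_injective]
  have hnn : ∀ W : Finset V, (G.ends e false ∈ W ↔ G.ends e true ∈ W) →
      0 ≤ G.edgeBeta Sᶜ (fun w => G.chip S μ (D 0) w + η w) W := by
    intro W hW
    by_cases huniv : W = Finset.univ
    · have := congrArg (Int.cast (R := ℝ)) (hsumD 0)
      push_cast at this
      rw [huniv, edgeBeta_univ, Finset.sum_add_distrib, hη, sum_chip_univ, hμ, this]
      linarith
    · have h1 := (hpert W huniv Sᶜ S (D 0) 0).1
      rw [hbeta W hW] at h1
      have h2 := Q.edgeStable hμQ (W.image ι.vmap) fun h => huniv (Finset.eq_univ_of_forall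
        fun w => (hsatur W hW w).1 (by rw [h]; exact Finset.mem_univ _))
      have hvW : v₀' ∈ W.image ι.vmap ↔ v₀ ∈ W := by rw [← hsatur W hW v₀, hv]
      rw [hvW] at h2
      simpa using h1 (by simpa using h2)
  -- The sets separating the ends of `e` are handled by the choice of `t`.
  obtain ⟨t, ht⟩ := exists_distribution (by simpa using heS) hnn
  have hchip : (fun w => (G.chip S μ (D 0) w + η w) + (((if w = G.ends e false then t else 0) -
      (if w = G.ends e true then t else 0) : ℤ) : ℝ)) = fun w => G.chip S μ (D t) w + η w := by
    funext w
    simp only [Multigraph.chip, D]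
    push_cast
    simp only [ite_self]
    ring
  rw [hchip] at ht
  have hst : G.EdgeStable Sᶜ v₀ (G.chip S μ (D t)) := by
    intro W hW
    have := (hpert W hW Sᶜ S (D t) 0).2 (by simpa using ht W)
    simpa using this
  have hQS : (ofEdgeStable hμ S (D t) (hsumD t) hst).push ι hv hμ' = Q := by
    refine ext' ?_ fun v' => ?_
    · ext e'
      rw [hS]
      exact ι.mem_pullback S e'
    · exact (pushforward_subdiv_inl ι (ι.mem_pullback S) hrange _ v').trans (hpush t v')
  exact ⟨_, rfl, hQS⟩

end QD

end TropJac

end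

noncomputable section

namespace TropJac

open scoped Classical

open Multigraph

/-! ### Maximal cones of the Jacobian -/

theorem Specialization.connected_of {V E V' E' : Type} {G : Multigraph V E} {H : Multigraph V' E'}
    (φ : Specialization G H) (hH : H.Connected) : G.Connected := fun v w =>
  Reach.mono (Set.subset_univ _) ((φ.reach_vmap_iff Set.univ v w).1 (hH _ _))

namespace StableGraph

variable {g : ℕ} {Γ : StableGraph g}

/-- Expansions are most easily built on sets like `Option (Fin n)`; renumbering turns them into
stable graphs, and the contraction to Γ factors through the numbering. -/
theorem exists_numbering {V E : Type} [Fintype V] [Fintype E] (G : Multigraph V E) (w : V → ℕ)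
    (l : V) (hgenus : ∑ v, w v + Fintype.card E + 1 = g + Fintype.card V)
    (hstable : ∀ v, 3 ≤ G.val v + 2 * w v + if v = l then 1 else 0)
    (ψ : Specialization G Γ.graph) (hleg : ψ.vmap l = Γ.leg) (hw : ψ.IsWeighted w Γ.weight) {e : E}
    (he : Set.range ψ.emap = {e}ᶜ) :
    ∃ (Γ' : StableGraph g) (φ : Hom Γ' Γ) (f : Fin Γ'.m), Set.range φ.emap = {f}ᶜ := by
  let τ := toOfFintype (g := g) G w l (ψ.connected_of Γ.connected) hgenus hstable
  have hτ : Function.Surjective τ.emap := toOfFintype_emap_surjective _ _ _ _ _ _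
  obtain ⟨χ, h1, h2, -⟩ := τ.exists_factor ψ (by rw [hτ.range_eq]; exact Set.subset_univ _)
  obtain ⟨f, hf⟩ := hτ e
  refine ⟨_, Hom.ofIsWeighted χ ((h1 l).trans hleg) ((Specialization.IsWeighted.comp_iff h1 h2
    (toOfFintype_isWeighted _ _ _ _ _ _)).2 hw), f, ?_⟩
  ext f'
  have h3 : τ.emap f' ∈ Set.range ψ.emap ↔ f' ∈ Set.range χ.emap := by
    constructor
    · rintro ⟨e', he'⟩
      exact ⟨e', τ.emap_injective (by rw [h2, he'])⟩
    · rintro ⟨e', rfl⟩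
      exact ⟨e', (h2 e').symm⟩
  change f' ∈ Set.range χ.emap ↔ _
  rw [← h3, he, Set.mem_compl_singleton_iff, Set.mem_compl_singleton_iff, ← hf,
    τ.emap_injective.ne_iff]

/-- A vertex of positive weight can be replaced by one with a loop. -/
theorem exists_loop_expansion (Γ : StableGraph g) {v : Fin Γ.n} (hv : Γ.weight v ≠ 0) :
    ∃ (Γ' : StableGraph g) (φ : Hom Γ' Γ) (f : Fin Γ'.m), Set.range φ.emap = {f}ᶜ := by
  -- The edge `none` is the new loop at `v`; it replaces one unit of weight.
  let G : Multigraph (Fin Γ.n) (Option (Fin Γ.m)) :=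
    ⟨fun e b => e.elim v fun e => Γ.graph.ends e b⟩
  let w : Fin Γ.n → ℕ := fun u => Γ.weight u - if u = v then 1 else 0
  have hw : ∀ u, w u + (if u = v then 1 else 0) = Γ.weight u := by
    intro u
    simp only [w]
    split_ifs with h
    · subst h; omega
    · rfl
  let ψ : Specialization G Γ.graph := Specialization.ofSection (fun u => u) some (fun _ => false)
    (fun u => u) (Option.some_injective _) (by simp [G]) (by
      rintro (_ | e) he
      · rfl
      · exact (he ⟨e, rfl⟩).elim) (fun _ => rfl) (fun _ => Reach.refl _)
  have hfib : ∀ u (_ : DecidablePred fun u' => ψ.vmap u' = u),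
      (Finset.univ.filter fun u' => ψ.vmap u' = u) = {u} := fun u _ => by
    ext u'
    rw [Finset.mem_filter, Finset.mem_singleton]
    exact ⟨fun h => h.2, fun h => ⟨Finset.mem_univ _, h⟩⟩
  have hcontr : ∀ u, (ψ.contractedOver u).card = if u = v then 1 else 0 := by
    intro u
    have : ψ.contractedOver u = if u = v then {none} else ∅ := by
      ext e
      rw [Specialization.mem_contractedOver]
      rcases e with _ | e
      · simp only [ψ, Specialization.ofSection, G]
        by_cases h : v = u
        · simp [h]
        · simp [h, Ne.symm h]
      · simp only [ψ, Specialization.ofSection, G]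
        split_ifs <;> simp
    rw [this]
    split_ifs <;> simp
  have hval : ∀ u, G.val u = Γ.graph.val u + 2 * if u = v then 1 else 0 := by
    intro u
    have := ψ.sum_val_eq u
    rwa [hfib, hcontr, Finset.sum_singleton] at this
  refine exists_numbering G w Γ.leg ?_ ?_ ψ rfl ?_ (e := none) ?_
  · have := Γ.genus_eq
    have h2 := Finset.sum_congr (rfl : (Finset.univ : Finset (Fin Γ.n)) = _) fun u _ => hw u
    rw [Finset.sum_add_distrib, Finset.sum_ite_eq', if_pos (Finset.mem_univ _)] at h2
    simp only [Fintype.card_option, Fintype.card_fin]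
    change _ = ∑ u, Γ.weight u at h2
    omega
  · intro u
    have h1 := Γ.stable u
    have h2 := hw u
    rw [hval]
    split_ifs at h1 h2 ⊢ <;> omega
  · intro u
    rw [hfib, hcontr, Finset.sum_singleton, Finset.card_singleton]
    have := hw u
    omega
  · ext e
    rcases e with _ | e <;> simp [ψ, Specialization.ofSection]

/-- A vertex of high valence can be replaced by two vertices joined by an edge. -/
theorem exists_split_expansion (Γ : StableGraph g) {v : Fin Γ.n} (hval : 2 ≤ Γ.graph.val v)
    (hv : 4 ≤ Γ.graph.val v + 2 * Γ.weight v + if v = Γ.leg then 1 else 0) :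
    ∃ (Γ' : StableGraph g) (φ : Hom Γ' Γ) (f : Fin Γ'.m), Set.range φ.emap = {f}ᶜ := by
  -- Two half-edges `M` at `v` move to a new vertex `none` of weight 0, joined to `v` by the new
  -- edge `none`. The new vertex has valence 3, and `v` loses two half-edges and gains one, which
  -- the bound 4 permits.
  obtain ⟨M, hM, hMcard⟩ := Finset.exists_subset_card_eq hval
  replace hM : ∀ p ∈ M, Γ.graph.ends p.1 p.2 = v := fun p hp => by simpa using hM hp
  let G : Multigraph (Option (Fin Γ.n)) (Option (Fin Γ.m)) :=
    ⟨fun e b => e.elim (if b then none else some v)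
      fun e => if (e, b) ∈ M then none else some (Γ.graph.ends e b)⟩
  let w : Option (Fin Γ.n) → ℕ := fun u => u.elim 0 Γ.weight
  let ψ : Specialization G Γ.graph := Specialization.ofSection (fun u => u.elim v fun u => u) some
    (fun _ => false) some (Option.some_injective _) (by
      intro e b
      simp only [G, Option.elim_some, Bool.xor_false]
      split_ifs with h
      · exact (hM _ h).symm
      · rfl) (by
      rintro (_ | e) he
      · rfl
      · exact (he ⟨e, rfl⟩).elim) (fun _ => rfl) (by
      rintro (_ | u)
      · exact reach_ends (G := G) (e := none) (by simp) true false
      · exact Reach.refl _)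
  have hψsome : ∀ u, ψ.vmap (some u) = u := fun u => rfl
  have hψnone : ψ.vmap none = v := rfl
  have hfib : ∀ (f : Option (Fin Γ.n) → ℕ) (u : Fin Γ.n)
      (_ : DecidablePred fun u' => ψ.vmap u' = u), ∑ u' with ψ.vmap u' = u, f u' =
      f (some u) + if u = v then f none else 0 := by
    intro f u _
    rw [Finset.sum_filter, Fintype.sum_option, add_comm]
    simp [hψsome, hψnone, eq_comm]
  have hcontr : ∀ u, (ψ.contractedOver u).card = if u = v then 1 else 0 := by
    intro u
    have : ψ.contractedOver u = if u = v then {none} else ∅ := by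
      ext e
      rw [Specialization.mem_contractedOver]
      rcases e with _ | e
      · simp only [ψ, Specialization.ofSection, G]
        by_cases h : v = u
        · simp [h]
        · simp [h, Ne.symm h]
      · simp only [ψ, Specialization.ofSection, G]
        split_ifs <;> simp
    rw [this]
    split_ifs <;> simp
  have hnone : G.val none = 3 := by
    have : ∀ _ : DecidablePred fun p : Option (Fin Γ.m) × Bool => G.ends p.1 p.2 = none,
        (Finset.univ.filter fun p : Option (Fin Γ.m) × Bool => G.ends p.1 p.2 = none) =
        insert (none, true) (M.image fun p => (some p.1, p.2)) := by
      intro _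
      ext ⟨e, b⟩
      rcases e with _ | e
      · cases b <;> simp [G]
      · simp [G]
    rw [val, this, Finset.card_insert_of_notMem (by simp), Finset.card_image_of_injective, hMcard]
    rintro ⟨e, b⟩ ⟨e', b'⟩ h
    simpa using h
  have hvals : ∀ u, G.val (some u) + (if u = v then 3 else 0) =
      Γ.graph.val u + 2 * if u = v then 1 else 0 := by
    intro u
    have := ψ.sum_val_eq u
    rwa [hfib, hcontr, hnone] at this
  refine exists_numbering G w (some Γ.leg) ?_ ?_ ψ rfl ?_ (e := none) ?_
  · have := Γ.genus_eq
    rw [Fintype.sum_option]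
    simp only [Fintype.card_option, Fintype.card_fin, w, Option.elim_none, Option.elim_some]
    omega
  · rintro (_ | u)
    · rw [hnone]
      omega
    · have h1 := Γ.stable u
      have h2 := hvals u
      simp only [w, Option.elim_some, Option.some.injEq]
      by_cases hu : u = v
      · subst hu
        simp only [if_true] at h2
        split_ifs at h1 hv ⊢ <;> omega
      · simp only [hu, if_false] at h2
        split_ifs at h1 ⊢ <;> omega
  · intro u
    rw [Finset.card_eq_sum_ones, hfib, hfib, hcontr]
    simp only [w, Option.elim_none, Option.elim_some]
    split_ifs <;> omega
  · ext e
    rcases e with _ | e <;> simp [ψ, Specialization.ofSection]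

end StableGraph

section Maximal

variable {g : ℕ} {d : ℤ} {μ : UniversalPolarization g d}

theorem card_edge (a : QDObj μ) : Fintype.card a.Edge = a.Γ.m + a.P.S.card := by
  have h1 : Fintype.card {e // e ∉ a.P.S} + a.P.S.card = a.Γ.m := by
    have := Fintype.card_subtype_compl (fun e => e ∈ a.P.S)
    rw [Fintype.card_coe, Fintype.card_fin] at this
    have h2 := Finset.card_le_univ a.P.S
    rw [Fintype.card_fin] at h2
    have h3 : Fintype.card {e // e ∉ a.P.S} = Fintype.card {e // ¬ e ∈ a.P.S} := rfl
    omega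
  rw [Fintype.card_sum, Fintype.card_prod, Fintype.card_coe, Fintype.card_bool]
  omega

theorem card_compl_add_card (a : QDObj μ) : a.P.Sᶜ.card + a.P.S.card = a.Γ.m := by
  have := Finset.card_compl_add_card a.P.S
  rwa [Fintype.card_fin] at this

theorem n_le_card_compl (a : QDObj μ) : a.Γ.n ≤ a.P.Sᶜ.card + 1 := by
  have := card_le_of_connected (a.P.connected_compl (μ.degree_eq a.Γ))
  rwa [Fintype.card_fin] at this

/-- Connectedness of the complement of S gives |S| ≤ m - n + 1 = g - Σw, and stability gives m ≤ 3g
- 2 - Σw. -/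
theorem card_edge_le (a : QDObj μ) : Fintype.card a.Edge + 2 ≤ 4 * g := by
  rw [card_edge]
  have := n_le_card_compl a
  have := card_compl_add_card a
  have := a.Γ.genus_eq
  have := a.Γ.m_add_weight_le
  omega

theorem coneDim_jacobianDiagram (a : QDObj μ) :
    coneDim ((jacobianDiagram μ).cone a) = Fintype.card a.Edge :=
  coneDim_orthant a.Edge

theorem isMaximal_iff (a : QDObj μ) : (jacobianDiagram μ).IsMaximal a ↔
    ∀ (b : QDObj μ) (f : QDObj.Hom b a), Function.Surjective f.τ.emap :=
  forall_congr' fun _ => forall_congr' fun f => extendByZero_surjective_iff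
    (QDObj.Hom.τ f).emap_injective

theorem card_le_of_isMaximal {a b : QDObj μ} (ha : (jacobianDiagram μ).IsMaximal a)
    (f : QDObj.Hom b a) : Fintype.card b.Edge ≤ Fintype.card a.Edge :=
  Fintype.card_le_of_surjective _ ((isMaximal_iff a).1 ha b f)

/-- No cone has larger dimension, so every arrow starting here is a bijection on coordinates. -/
theorem isMaximal_of_card {a : QDObj μ} (h : Fintype.card a.Edge + 2 = 4 * g) :
    (jacobianDiagram μ).IsMaximal a := by
  rw [isMaximal_iff]
  intro b f
  have h1 := card_edge_le b
  have h2 : Fintype.card a.Edge ≤ Fintype.card b.Edge :=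
    Fintype.card_le_of_injective _ f.τ.emap_injective
  exact ((Fintype.bijective_iff_injective_and_card _).2
    ⟨f.τ.emap_injective, (by omega : Fintype.card a.Edge = Fintype.card b.Edge)⟩).2

/-- Pseudo-divisors lift along the contraction of a single edge. -/
theorem QDObj.exists_lift {Γ : StableGraph g} (a : QDObj μ) (φ : StableGraph.Hom Γ a.Γ)
    {f : Fin Γ.m} (hf : Set.range φ.emap = {f}ᶜ) :
    ∃ P : QD Γ.graph Γ.leg (μ.μ Γ) d, P.S = a.P.S.image φ.emap ∧
      Nonempty (QD.HomOver φ.toSpecialization P a.P) := by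
  obtain ⟨P, hP, h⟩ := QD.exists_lift (μ.degree_eq Γ) φ.toSpecialization hf φ.map_leg
    (μ.map_eq φ) a.P
  have τ := P.toPush φ.toSpecialization φ.map_leg (μ.map_eq φ)
  rw [h] at τ
  exact ⟨P, hP, ⟨τ⟩⟩

theorem m_eq_of_range {Γ Γ' : StableGraph g} (φ : StableGraph.Hom Γ Γ') {f : Fin Γ.m}
    (hf : Set.range φ.emap = {f}ᶜ) : Γ.m = Γ'.m + 1 := by
  have h1 : (Finset.univ.image φ.emap).card = Γ'.m := by
    rw [Finset.card_image_of_injective _ φ.emap_injective]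
    simp
  have h2 : Finset.univ.image φ.emap = {f}ᶜ := by
    apply Finset.coe_injective
    simpa using hf
  rw [h2, Finset.card_compl] at h1
  have := f.2
  simp at h1
  omega

theorem not_isMaximal_of_expansion (a : QDObj μ)
    (h : ∃ (Γ : StableGraph g) (φ : StableGraph.Hom Γ a.Γ) (f : Fin Γ.m),
      Set.range φ.emap = {f}ᶜ) : ¬ (jacobianDiagram μ).IsMaximal a := by
  obtain ⟨Γ, φ, f, hf⟩ := h
  obtain ⟨P, hP, ⟨τ⟩⟩ := a.exists_lift φ hf
  intro ha
  have h1 := card_le_of_isMaximal (b := ⟨Γ, P⟩) ha ⟨φ, τ⟩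
  rw [card_edge, card_edge] at h1
  simp only [hP, Finset.card_image_of_injective _ φ.emap_injective, m_eq_of_range φ hf] at h1
  omega

/-- The structure of the maximal cones. -/
theorem isMaximal_structure {a : QDObj μ} (ha : (jacobianDiagram μ).IsMaximal a) :
    (∀ v, a.Γ.weight v = 0) ∧ a.Γ.n + 1 = 2 * g ∧ a.Γ.m + 2 = 3 * g ∧ a.P.S.card = g ∧
      ∀ v, a.Γ.graph.val v + (if v = a.Γ.leg then 1 else 0) = 3 := by
  -- Each failure of the asserted structure yields a cone of larger dimension: by adding a loop, by
  -- splitting a vertex, or by adding an edge to S.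
  have hw : ∀ v, a.Γ.weight v = 0 := fun v => by
    by_contra h
    exact not_isMaximal_of_expansion a (a.Γ.exists_loop_expansion h) ha
  have hval : ∀ v, a.Γ.graph.val v + (if v = a.Γ.leg then 1 else 0) = 3 := by
    intro v
    have h := a.Γ.stable v
    rw [hw v] at h
    by_contra hne
    refine not_isMaximal_of_expansion a (a.Γ.exists_split_expansion (v := v) ?_ ?_) ha
    · split_ifs at h hne <;> omega
    · rw [hw v]
      split_ifs at h hne ⊢ <;> omega
  have hcard : a.Γ.n = a.P.Sᶜ.card + 1 := by
    refine le_antisymm (n_le_card_compl a) ?_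
    by_contra! hlt
    obtain ⟨Q, hQ, ⟨τ⟩⟩ := a.P.exists_larger (μ.degree_eq a.Γ) (by
      rw [Fintype.card_fin]
      omega)
    have h1 := card_le_of_isMaximal (b := ⟨a.Γ, Q⟩) ha ⟨StableGraph.Hom.id a.Γ, τ⟩
    rw [card_edge, card_edge] at h1
    simp only at h1
    omega
  -- Trivalence gives 2m + 1 = 3n, which with m + 1 = g + n determines n and m; |S| follows because
  -- the complement is a spanning tree.
  have h1 := Finset.sum_congr (rfl : (Finset.univ : Finset (Fin a.Γ.n)) = _) fun v _ => hval v
  rw [Finset.sum_add_distrib, a.Γ.sum_val, Finset.sum_ite_eq', if_pos (Finset.mem_univ _)] at h1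
  simp only [Finset.sum_const, Finset.card_univ, Fintype.card_fin, smul_eq_mul] at h1
  have h2 := a.Γ.genus_eq
  simp only [hw, Finset.sum_const_zero] at h2
  have := card_compl_add_card a
  exact ⟨hw, by omega, by omega, by omega, hval⟩

theorem card_edge_of_isMaximal {a : QDObj μ} (ha : (jacobianDiagram μ).IsMaximal a) :
    Fintype.card a.Edge + 2 = 4 * g := by
  obtain ⟨-, -, h1, h2, -⟩ := isMaximal_structure ha
  rw [card_edge]
  omega

theorem hasPureDimension_jacobianDiagram (μ : UniversalPolarization g d) :
    (jacobianDiagram μ).HasPureDimension (4 * (g : ℤ) - 2) := by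
  intro (a : QDObj μ) ha
  rw [coneDim_jacobianDiagram a]
  have := card_edge_of_isMaximal ha
  omega

end Maximal

end TropJac

end

noncomputable section

namespace TropJac

open scoped Classical

open Multigraph

/-! ### Trivalent trees with labelled leaves -/

/-- The flags of a trivalent tree with `k + 1` vertices: half-edges and leaves. -/
abbrev Flag (k : ℕ) : Type := (Fin k × Bool) ⊕ Fin (k + 3)

namespace Flag

variable {k : ℕ}

/-- The edges of the tree given by the vertices at which the flags are attached. -/
def tree (φ : Flag k → Fin (k + 1)) : Multigraph (Fin (k + 1)) (Fin k) :=
  ⟨fun t b => φ (.inl (t, b))⟩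

/-- The positions of the flags in the standard caterpillar tree. -/
def caterpillar (k : ℕ) : Flag k → ℕ
  | .inl (t, b) => t + b.toNat
  -- By truncation, leaves 0 and 1 are attached to vertex 0. Leaf j + 1 is at vertex j for j ≤ k,
  -- and the last leaf k + 2 is also at vertex k.
  | .inr l => min (l - 1) k

theorem caterpillar_le (f : Flag k) : caterpillar k f ≤ k := by
  rcases f with ⟨t, b⟩ | l
  · cases b <;> simp [caterpillar]
  · exact min_le_right _ _

/-- `v` is joined to `c` by a walk of length `n`. -/
def Near (φ : Flag k → Fin (k + 1)) (c : Fin (k + 1)) : ℕ → Fin (k + 1) → Prop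
  | 0, v => v = c
  | n + 1, v => ∃ t b, φ (.inl (t, b)) = v ∧ Near φ c n (φ (.inl (t, !b)))

theorem exists_near {φ : Flag k → Fin (k + 1)} (h : (tree φ).Connected) (c v : Fin (k + 1)) :
    ∃ n, Near φ c n v := by
  have key : ∀ v w, (tree φ).Reach Set.univ v w → ((∃ n, Near φ c n v) ↔ ∃ n, Near φ c n w) := by
    intro v w h
    induction h with
    | rel x y h =>
      obtain ⟨t, -, rfl, rfl⟩ := h
      exact ⟨fun ⟨n, hn⟩ => ⟨n + 1, t, true, rfl, hn⟩, fun ⟨n, hn⟩ => ⟨n + 1, t, false, rfl, hn⟩⟩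
    | refl x => rfl
    | symm x y _ ih => exact ih.symm
    | trans x y z _ _ ih₁ ih₂ => exact ih₁.trans ih₂
  exact (key v c (h v c)).2 ⟨0, rfl⟩

/-- Walks of length less than `K` from `c` never meet `z`, so they survive when flags are reattached
only at `z`. -/
theorem Near.congr {φ φ' : Flag k → Fin (k + 1)} {c z : Fin (k + 1)} {K : ℕ}
    (hφ : ∀ f, φ (.inl f) ≠ z → φ' (.inl f) = φ (.inl f)) (hz : ∀ n < K, ¬ Near φ c n z) :
    ∀ n < K, ∀ v, Near φ c n v → Near φ' c n v := by
  intro n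
  induction n with
  | zero => exact fun _ _ h => h
  | succ n ih =>
    rintro hn v ⟨t, b, rfl, h⟩
    have h1 : φ (.inl (t, b)) ≠ z := fun h1 => hz (n + 1) hn ⟨t, b, h1, h⟩
    have h2 : φ (.inl (t, !b)) ≠ z := fun h2 => hz n (by omega) (h2 ▸ h)
    exact ⟨t, b, hφ _ h1, by rw [hφ _ h2]; exact ih (by omega) _ h⟩

/-- The flags at the vertices before `j` are those of the standard caterpillar. -/
def Agrees (j : ℕ) (φ : Flag k → Fin (k + 1)) : Prop :=
  ∀ f, ∀ i < j, (φ f : ℕ) = i ↔ caterpillar k f = i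

theorem Agrees.lt_iff {j : ℕ} {φ : Flag k → Fin (k + 1)} (h : Agrees j φ) (f : Flag k) :
    (φ f : ℕ) < j ↔ caterpillar k f < j :=
  ⟨fun h1 => by rwa [(h f _ h1).1 rfl], fun h1 => by rwa [(h f _ h1).2 rfl]⟩

/-- A family of attachments of flags which is closed under changes of the labels of vertices and
edges and under the exchange of a leaf with another flag along an edge. -/
structure Closed (R : (Flag k → Fin (k + 1)) → Prop) : Prop where
  card_eq : ∀ {φ}, R φ → ∀ v, (Finset.univ.filter fun f => φ f = v).card = 3
  connected : ∀ {φ}, R φ → (tree φ).Connected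
  vertices : ∀ {φ}, R φ → ∀ σ : Equiv.Perm (Fin (k + 1)), R fun f => σ (φ f)
  edges : ∀ {φ}, R φ → ∀ (τ : Equiv.Perm (Fin k)) (ε : Fin k → Bool),
    R (Sum.elim (fun p => φ (.inl (τ p.1, xor p.2 (ε p.1)))) fun l => φ (.inr l))
  exchange : ∀ {φ}, R φ → ∀ t b l q, φ (.inl (t, b)) = φ (.inr l) → φ (.inl (t, !b)) = φ q →
    φ q ≠ φ (.inr l) → q ≠ .inl (t, !b) → R fun f => φ (Equiv.swap (.inr l) q f)

namespace Closed

variable {R : (Flag k → Fin (k + 1)) → Prop} (hR : Closed R)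

include hR

theorem exists_third {φ : Flag k → Fin (k + 1)} (h : R φ) (v : Fin (k + 1)) (a b : Flag k) :
    ∃ r, φ r = v ∧ r ≠ a ∧ r ≠ b := by
  have h1 : ({a, b} : Finset (Flag k)).card < (Finset.univ.filter fun f => φ f = v).card := by
    rw [hR.card_eq h]
    exact lt_of_le_of_lt Finset.card_le_two (by omega)
  obtain ⟨r, hr, hr'⟩ := Finset.exists_mem_notMem_of_card_lt_card h1
  simp only [Finset.mem_insert, Finset.mem_singleton, not_or] at hr'
  exact ⟨r, (Finset.mem_filter.1 hr).2, hr'⟩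

/-- Induction on the distance from the leaf to vertex `j`. The leaf is exchanged with a flag at the
next vertex of a shortest walk, which brings it one step closer; the flag is chosen so that neither
the rest of the walk nor `x` is moved. -/
theorem exists_leaf_at {j : Fin (k + 1)} {x : Flag k} {l : Fin (k + 3)} (hx : x ≠ .inr l)
    (hl : (j : ℕ) ≤ caterpillar k (.inr l)) (hx' : ∀ t : Fin k, (t : ℕ) + 1 = j → x = .inl (t, true))
    (n : ℕ) : ∀ φ, R φ → Agrees j φ → φ x = j → Near φ j n (φ (.inr l)) →
      ∃ φ', R φ' ∧ Agrees j φ' ∧ φ' x = j ∧ φ' (.inr l) = j := by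
  induction n using Nat.strong_induction_on with
  | _ n ih =>
    intro φ hφ hA hφx hn
    by_cases hmin : ∃ m < n, Near φ j m (φ (.inr l))
    · obtain ⟨m, hm, h⟩ := hmin
      exact ih m hm φ hφ hA hφx h
    push Not at hmin
    rcases n with _ | n
    · exact ⟨φ, hφ, hA, hφx, hn⟩
    obtain ⟨t, b, hy, hz⟩ := hn
    set z := φ (.inl (t, !b)) with hzdef
    have hzmin : ∀ m < n, ¬ Near φ j m z := fun m hm h => hmin (m + 1) (by omega) ⟨t, b, hy, h⟩
    have hyz : z ≠ φ (.inr l) := fun h => hmin n (by omega) (h ▸ hz)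
    have hyj : φ (.inr l) ≠ j := hmin 0 (by omega)
    have hylt : ¬ (φ (.inr l) : ℕ) < j := by
      rw [hA.lt_iff]
      omega
    -- The vertices before `j` can be entered only through the edge with number j - 1, whose other
    -- half is `x`, attached to `j`. A walk leaving the vertex of the leaf that way would start at
    -- `j` itself.
    have hzlt : ¬ (z : ℕ) < j := by
      intro h
      rw [hzdef, hA.lt_iff] at h
      rw [← hy, hA.lt_iff] at hylt
      cases b
      · simp [caterpillar] at h hylt
        omega
      · simp [caterpillar] at h hylt
        exact hyj (by rw [← hy, ← hx' t (by omega), hφx])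
    -- Of the three flags at `z`, one leads back to the leaf and one is needed: `x` if `z` is
    -- already `j`, the next half-edge of the walk otherwise. The third one is `r`.
    have hr : ∃ r, φ r = z ∧ r ≠ .inl (t, !b) ∧ r ≠ x ∧
        Near (fun f => φ (Equiv.swap (.inr l) r f)) j n z := by
      rcases n with _ | n
      · obtain ⟨r, h1, h2, h3⟩ := hR.exists_third hφ z (.inl (t, !b)) x
        exact ⟨r, h1, h2, h3, hz⟩
      · obtain ⟨t', b', h4, h5⟩ := hz
        obtain ⟨r, h1, h2, h3⟩ := hR.exists_third hφ z (.inl (t, !b)) (.inl (t', b'))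
        have h6 : ∀ f, φ (.inl f) ≠ z →
            φ (Equiv.swap (.inr l) r (.inl f)) = φ (.inl f) := by
          intro f hf
          rw [Equiv.swap_apply_of_ne_of_ne (by simp) (fun h => hf (by rw [h, h1]))]
        refine ⟨r, h1, h2, ?_, t', b', ?_, ?_⟩
        · rintro rfl
          exact hzmin 0 (by omega) (h1.symm.trans hφx)
        · simp only
          rw [Equiv.swap_apply_of_ne_of_ne (by simp) h3.symm, h4]
        · simp only
          rw [h6 _ (fun h => hzmin n (by omega) (h ▸ h5))]
          exact Near.congr h6 hzmin n (by omega) _ h5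
    obtain ⟨r, hrz, hr1, hr2, hr3⟩ := hr
    have hrl : r ≠ .inr l := fun h => hyz (by rw [← h, hrz])
    refine ih n (by omega) _ (hR.exchange hφ t b l r hy hrz.symm (by rwa [hrz]) hr1) ?_ ?_ ?_
    · intro f i hi
      beta_reduce
      by_cases h1 : f = .inr l
      · subst h1
        rw [Equiv.swap_apply_left, hrz]
        exact iff_of_false (by omega) (by omega)
      by_cases h2 : f = r
      · subst h2
        rw [Equiv.swap_apply_right]
        have := hA.lt_iff f
        rw [hrz] at this
        exact iff_of_false (by omega) (by omega)
      rw [Equiv.swap_apply_of_ne_of_ne h1 h2]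
      exact hA f i hi
    · rw [Equiv.swap_apply_of_ne_of_ne hx hr2.symm, hφx]
    · rw [Equiv.swap_apply_left, hrz]
      exact hr3

/-- The caterpillar has three flags at vertex j < k: an incoming flag `x` (leaf 0 if j = 0,
otherwise the second half of edge j - 1), leaf j + 1, and the first half of edge j. The vertex of
`x` is named j, the leaf is brought there by exchanges, and the edge containing the third flag is
renumbered. -/
theorem exists_agrees_succ {φ : Flag k → Fin (k + 1)} (hφ : R φ) {j : ℕ} (hj : j < k)
    (hA : Agrees j φ) : ∃ φ', R φ' ∧ Agrees (j + 1) φ' := by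
  obtain ⟨x, hxl, hx', hcx, hxj⟩ : ∃ x : Flag k, x ≠ .inr ⟨j + 1, by omega⟩ ∧
      (∀ t : Fin k, (t : ℕ) + 1 = j → x = .inl (t, true)) ∧ caterpillar k x = j ∧
      (∀ t b, x = .inl (t, b) → (t : ℕ) + 1 = j ∧ b = true) := by
    rcases j with _ | j
    · exact ⟨.inr 0, by simp, by simp, by simp [caterpillar], by simp⟩
    · refine ⟨.inl (⟨j, by omega⟩, true), by simp, fun t ht => ?_, by simp [caterpillar], ?_⟩
      · rw [show t = ⟨j, by omega⟩ from Fin.ext (by simpa using ht)]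
      · intro t b h
        simp only [Sum.inl.injEq, Prod.mk.injEq] at h
        rw [← h.1, ← h.2]
        simp
  have hjk : j < k + 1 := by omega
  -- the vertex of `x` gets the label `j`
  obtain ⟨φ, hφ, hA, hφx⟩ : ∃ φ', R φ' ∧ Agrees j φ' ∧ φ' x = ⟨j, hjk⟩ := by
    refine ⟨_, hR.vertices hφ (Equiv.swap (φ x) ⟨j, hjk⟩), ?_, Equiv.swap_apply_left _ _⟩
    have h0 : ¬ (φ x : ℕ) < j := by
      rw [hA.lt_iff]
      omega
    intro f i hi
    beta_reduce
    rw [← hA f i hi]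
    by_cases h1 : φ f = φ x
    · rw [h1, Equiv.swap_apply_left]
      exact iff_of_false (by simp; omega) (by omega)
    by_cases h2 : φ f = ⟨j, hjk⟩
    · rw [h2, Equiv.swap_apply_right]
      exact iff_of_false (by omega) (by simp; omega)
    rw [Equiv.swap_apply_of_ne_of_ne h1 h2]
  obtain ⟨n, hn⟩ := exists_near (hR.connected hφ) ⟨j, hjk⟩ (φ (.inr ⟨j + 1, by omega⟩))
  have hl : caterpillar k (.inr ⟨j + 1, by omega⟩) = j := by
    simp [caterpillar]
    omega
  obtain ⟨φ, hφ, hA, hφx, hφl⟩ := hR.exists_leaf_at (j := ⟨j, hjk⟩) hxl hl.ge hx' n φ hφ hA hφx hn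
  simp only at hA
  obtain ⟨r, hr, hr1, hr2⟩ := hR.exists_third hφ ⟨j, hjk⟩ x (.inr ⟨j + 1, by omega⟩)
  have hfib : ∀ {ψ} (_ : R ψ) {r : Flag k}, ψ x = ⟨j, hjk⟩ → ψ (.inr ⟨j + 1, by omega⟩) = ⟨j, hjk⟩ →
      ψ r = ⟨j, hjk⟩ → r ≠ x → r ≠ .inr ⟨j + 1, by omega⟩ →
      ∀ f, ψ f = ⟨j, hjk⟩ ↔ f = x ∨ f = .inr ⟨j + 1, by omega⟩ ∨ f = r := by
    intro ψ hψ r h1 h2 h3 h4 h5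
    have h6 : ({x, .inr ⟨j + 1, by omega⟩, r} : Finset (Flag k)) =
        Finset.univ.filter fun f => ψ f = ⟨j, hjk⟩ := by
      apply Finset.eq_of_subset_of_card_le
      · intro f hf
        simp only [Finset.mem_insert, Finset.mem_singleton] at hf
        rcases hf with rfl | rfl | rfl <;> simp [h1, h2, h3]
      · rw [hR.card_eq hψ, Finset.card_insert_of_notMem (by simp [hxl, h4.symm]),
          Finset.card_pair h5.symm]
    intro f
    have := Finset.ext_iff.1 h6 f
    simpa using this.symm
  -- the third flag at `j` is part of an edge
  obtain ⟨s, b, rfl⟩ : ∃ s b, r = .inl (s, b) := by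
    rcases r with ⟨s, b⟩ | l
    · exact ⟨s, b, rfl⟩
    -- If the third flag were a leaf, no edge would lead from the vertices up to `j` to the later
    -- ones, contradicting connectedness as j < k.
    exfalso
    have h1 : ∀ t b, (φ (.inl (t, b)) : ℕ) ≤ j → (φ (.inl (t, !b)) : ℕ) ≤ j := by
      intro t b h
      by_contra hlt
      rcases h.lt_or_eq with h | h
      · have h2 := (hA.lt_iff _).1 h
        have h3 := mt (hA.lt_iff _).2 (by omega : ¬ (φ (.inl (t, !b)) : ℕ) < j)
        cases b
        · simp [caterpillar] at h2 h3
          have := hx' t (by omega)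
          apply hlt
          simp only [Bool.not_false]
          rw [← this, hφx]
        · simp [caterpillar] at h2 h3
          omega
      · rcases (hfib hφ hφx hφl hr hr1 hr2 _).1 (Fin.ext h) with h | h | h
        · obtain ⟨h2, rfl⟩ := hxj t b h.symm
          have := (hA.lt_iff (.inl (t, false))).2 (by simp [caterpillar]; omega)
          simp only [Bool.not_true] at hlt
          omega
        · simp at h
        · simp at h
    have h2 := (hR.connected hφ ⟨j, hjk⟩ (Fin.last k)).apply_eq
      (fun v : Fin (k + 1) => (v : ℕ) ≤ j) (by
      intro t _
      exact propext ⟨h1 t false, fun h => by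
        have := h1 t true h
        rwa [Bool.not_true] at this⟩)
    simp at h2
    omega
  -- An edge with number below `j` has its halves at vertices before `j`, apart from the second half
  -- of edge j - 1, which is `x`.
  have hs : j ≤ s := by
    by_contra! hs
    have h1 := hA (.inl (s, b)) j
    have h2 := mt (hA.lt_iff (.inl (s, b))).2 (by rw [hr]; simp)
    cases b
    · simp [caterpillar] at h2
      omega
    · simp [caterpillar] at h2
      exact hr1 (hx' s (by omega)).symm
  -- Edge `s` is renumbered `j` and reversed if necessary, so that its half at vertex `j` becomes
  -- the first one. Since s ≥ j, the edges before `j` keep their numbers.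
  let ψ : Flag k → Fin (k + 1) := Sum.elim (fun p => φ (.inl (Equiv.swap s ⟨j, hj⟩ p.1,
    xor p.2 (if p.1 = ⟨j, hj⟩ then b else false)))) fun l => φ (.inr l)
  have hψ : R ψ := hR.edges hφ (Equiv.swap s ⟨j, hj⟩) fun t => if t = ⟨j, hj⟩ then b else false
  have hψt : ∀ (t : Fin k) c, (t : ℕ) < j → ψ (.inl (t, c)) = φ (.inl (t, c)) := by
    intro t c ht
    have h1 : t ≠ s := by rintro rfl; omega
    have h2 : t ≠ ⟨j, hj⟩ := by rintro rfl; simp at ht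
    simp [ψ, Equiv.swap_apply_of_ne_of_ne h1 h2, h2]
  have hψs : ψ (.inl (⟨j, hj⟩, false)) = ⟨j, hjk⟩ := by simp [ψ, hr]
  have hψx : ψ x = ⟨j, hjk⟩ := by
    rcases x with ⟨t, c⟩ | l
    · rw [hψt t c (by have := (hxj t c rfl).1; omega), hφx]
    · exact hφx
  refine ⟨ψ, hψ, fun f i hi => ?_⟩
  rcases (Nat.lt_succ_iff.1 hi).lt_or_eq with hi | rfl
  · rcases f with ⟨t, c⟩ | l
    · by_cases ht : (t : ℕ) < j
      · rw [hψt t c ht]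
        exact hA _ i hi
      · refine iff_of_false ?_ ?_
        · have h1 : j ≤ (Equiv.swap s ⟨j, hj⟩ t : Fin k) := by
            rw [Equiv.swap_apply_def]
            split_ifs
            · simp
            · exact hs
            · omega
          have h2 := mt (hA.lt_iff (.inl (Equiv.swap s ⟨j, hj⟩ t,
            xor c (if t = ⟨j, hj⟩ then b else false)))).1 (by simp [caterpillar]; omega)
          change ¬ (φ (.inl (Equiv.swap s ⟨j, hj⟩ t,
            xor c (if t = ⟨j, hj⟩ then b else false))) : ℕ) = i
          omega
        · simp only [caterpillar]
          omega
    · exact hA _ i hi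
  · have := hfib hψ hψx hφl hψs (by
      intro h
      have := hxj _ _ h.symm
      simp at this) (by simp) f
    rw [Fin.ext_iff] at this
    rw [this]
    constructor
    · rintro (rfl | rfl | rfl)
      · exact hcx
      · exact hl
      · simp [caterpillar]
    · intro h
      rcases f with ⟨t, c⟩ | l
      · cases c
        · right; right
          simp [caterpillar] at h
          simp [Fin.ext_iff, h]
        · left
          simp [caterpillar] at h
          exact (hx' t h).symm
      · simp only [caterpillar] at h
        by_cases h0 : (l : ℕ) = i + 1
        · right; left
          simp [Fin.ext_iff, h0]
        · left
          have h1 : i = 0 := by omega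
          have h2 : (l : ℕ) = 0 := by omega
          subst h1
          by_contra hne
          have h3 := (hfib hψ (r := .inl (⟨0, hj⟩, false)) hψx hφl hψs (by
            intro h
            have := hxj _ _ h.symm
            simp at this) (by simp) x).1 hψx
          rcases x with ⟨t, c⟩ | l'
          · have := hxj t c rfl
            omega
          · simp only [caterpillar] at hcx
            simp [Fin.ext_iff] at hxl hne
            omega

/-- The standard caterpillar tree belongs to every nonempty closed family. -/
theorem caterpillar_mem {φ : Flag k → Fin (k + 1)} (hφ : R φ) :
    R fun f => ⟨caterpillar k f, Nat.lt_succ_of_le (caterpillar_le f)⟩ := by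
  have h : ∀ j ≤ k, ∃ φ', R φ' ∧ Agrees j φ' := by
    intro j
    induction j with
    | zero => exact fun _ => ⟨φ, hφ, fun _ i hi => absurd hi (by omega)⟩
    | succ j ih =>
      intro hj
      obtain ⟨φ', h1, h2⟩ := ih (by omega)
      exact hR.exists_agrees_succ h1 (by omega) h2
  obtain ⟨φ', h1, h2⟩ := h k le_rfl
  convert h1 using 1
  funext f
  apply Fin.ext
  -- Agreement at the vertices before `k` suffices: all remaining flags are at the last vertex.
  have h3 := caterpillar_le f
  have h4 := (φ' f).2
  rcases h3.lt_or_eq with h | h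
  · exact ((h2 f _ h).2 rfl).symm
  · have := h2.lt_iff f
    simp only
    omega

end Closed

end Flag

end TropJac

end

noncomputable section

namespace TropJac

open scoped Classical

open Multigraph

variable {g : ℕ} {d : ℤ} {μ : UniversalPolarization g d}

/-! ### Connectedness in codimension one -/

namespace StableGraph

/-- The vertices at which the half-edges and the leg are attached. -/
def root (Γ : StableGraph g) : Option (Fin Γ.m × Bool) → Fin Γ.n
  | none => Γ.leg
  | some p => Γ.graph.ends p.1 p.2

theorem card_root {n m : ℕ} (G : Multigraph (Fin n) (Fin m)) (r : Option (Fin m × Bool) → Fin n)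
    (hr : ∀ p, r (some p) = G.ends p.1 p.2) (v : Fin n) :
    G.val v + (if v = r none then 1 else 0) = Nat.card {f // r f = v} := by
  rw [Nat.card_eq_fintype_card, Fintype.card_subtype, val, Finset.card_filter, Finset.card_filter,
    Fintype.sum_option, add_comm]
  simp only [hr, eq_comm]

/-- Exchange of two flags at the ends of an edge. -/
theorem exists_exchange (Γ : StableGraph g)
    (hΓ : ∀ v, Nat.card {f // Γ.root f = v} = 3) (e₀ : Fin Γ.m) (b : Bool)
    {p q : Option (Fin Γ.m × Bool)} (hp : Γ.root p = Γ.graph.ends e₀ b)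
    (hq : Γ.root q = Γ.graph.ends e₀ !b) (hpe : ∀ c, p ≠ some (e₀, c)) (hqe : ∀ c, q ≠ some (e₀, c)) :
    ∃ (H : Multigraph (Fin Γ.n) (Fin Γ.m)) (l : Fin Γ.n) (h₁ : H.Connected)
      (h₂ : ∑ v, Γ.weight v + Γ.m + 1 = g + Γ.n)
      (h₃ : ∀ v, 3 ≤ H.val v + 2 * Γ.weight v + if v = l then 1 else 0) (Γ₁ : StableGraph g)
      (ι : Hom Γ Γ₁) (ι' : Hom ⟨Γ.n, Γ.m, H, Γ.weight, l, h₁, h₂, h₃⟩ Γ₁),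
      (∀ f, root ⟨Γ.n, Γ.m, H, Γ.weight, l, h₁, h₂, h₃⟩ f = Γ.root (Equiv.swap p q f)) ∧
      Set.range ι.emap = {e₀}ᶜ ∧ ι'.emap = ι.emap := by
  obtain ⟨Γ₁, ι, hι⟩ := Γ.exists_contraction {e₀}
  -- The flags `p` and `q` sit at the two ends of `e₀`, which become one vertex of `Γ₁`, and `e₀`
  -- itself is not moved. So contracting `e₀` after the exchange gives `Γ₁` again.
  let H : Multigraph (Fin Γ.n) (Fin Γ.m) := ⟨fun e c => Γ.root (Equiv.swap p q (some (e, c)))⟩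
  have hv : ∀ f, ι.vmap (Γ.root (Equiv.swap p q f)) = ι.vmap (Γ.root f) := by
    intro f
    have h : ι.vmap (Γ.root q) = ι.vmap (Γ.root p) := by
      rw [hp, hq]
      exact ι.vmap_contracted (by rw [hι]; simp) _ _
    by_cases h1 : f = p
    · rw [h1, Equiv.swap_apply_left, h]
    by_cases h2 : f = q
    · rw [h2, Equiv.swap_apply_right, h]
    rw [Equiv.swap_apply_of_ne_of_ne h1 h2]
  have he₀ : ∀ c, H.ends e₀ c = Γ.graph.ends e₀ c := fun c => by
    change Γ.root _ = Γ.root (some (e₀, c))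
    rw [Equiv.swap_apply_of_ne_of_ne (hpe c).symm (hqe c).symm]
  let κ : Specialization H Γ₁.graph :=
    { vmap := ι.vmap
      emap := ι.emap
      flip := ι.flip
      vmap_surjective := ι.vmap_surjective
      emap_injective := ι.emap_injective
      vmap_ends := fun e' c => (hv _).trans (ι.vmap_ends e' c)
      vmap_eq_iff := fun v w => by
        rw [ι.vmap_eq_iff, hι, compl_compl]
        constructor <;> intro h <;> refine Reach.map (fun x => x) ?_ h <;> rintro e rfl
        · rw [← he₀, ← he₀]
          exact reach_ends (Set.mem_singleton e) _ _
        · rw [he₀, he₀]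
          exact reach_ends (Set.mem_singleton e) _ _ }
  have hval : ∀ v, H.val v + (if v = Γ.root (Equiv.swap p q none) then 1 else 0) = 3 := by
    intro v
    rw [card_root H (fun f => Γ.root (Equiv.swap p q f)) (fun _ => rfl), ← hΓ v]
    exact Nat.card_congr ((Equiv.swap p q).subtypeEquiv fun f => Iff.rfl)
  have hκ : κ.IsWeighted Γ.weight Γ₁.weight := by
    intro v'
    have h1 := ι.isWeighted v'
    have h2 : κ.contractedOver v' = ι.contractedOver v' := by
      ext e
      rw [Specialization.mem_contractedOver, Specialization.mem_contractedOver]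
      exact and_congr Iff.rfl (iff_of_eq (congrArg (· = v') (hv (some (e, false)))))
    rw [h2]
    exact h1
  refine ⟨H, Γ.root (Equiv.swap p q none), κ.connected_of Γ₁.connected, Γ.genus_eq,
    fun v => ?_, Γ₁, ι, Hom.ofIsWeighted κ ((hv none).trans ι.map_leg) hκ, ?_, hι, rfl⟩
  · have := hval v
    omega
  · rintro (_ | f) <;> rfl

end StableGraph

/-- Renumbering of half-edges. -/
def flagEquiv {I J : Type} (eE : I ≃ J) (ε : I → Bool) : Option (I × Bool) ≃ Option (J × Bool) :=
  Equiv.optionCongr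
    { toFun := fun x => (eE x.1, xor x.2 (ε x.1))
      invFun := fun y => (eE.symm y.1, xor y.2 (ε (eE.symm y.1)))
      left_inv := fun x => by simp
      right_inv := fun y => by simp }

theorem flagEquiv_some {I J : Type} (eE : I ≃ J) (ε : I → Bool) (i : I) (b : Bool) :
    flagEquiv eE ε (some (i, b)) = some (eE i, xor b (ε i)) := rfl

namespace QDObj

theorem card_root_of_isMaximal {a : QDObj μ} (ha : (jacobianDiagram μ).IsMaximal a) (v : Fin a.Γ.n) :
    Nat.card {f // a.Γ.root f = v} = 3 := by
  rw [← StableGraph.card_root a.Γ.graph a.Γ.root (fun _ => rfl) v, ← (isMaximal_structure ha).2.2.2.2 v]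
  congr

/-- Contracting `e₀`, which is not in S, gives a common face `t` of codimension one. The
pushed-forward pseudo-divisor lifts to the exchanged graph with the same support, and a cone of full
dimension is maximal. -/
theorem exists_exchange {a : QDObj μ} (ha : (jacobianDiagram μ).IsMaximal a) {e₀ : Fin a.Γ.m}
    (he₀ : e₀ ∉ a.P.S) (b : Bool) {p q : Option (Fin a.Γ.m × Bool)}
    (hp : a.Γ.root p = a.Γ.graph.ends e₀ b) (hq : a.Γ.root q = a.Γ.graph.ends e₀ !b)
    (hpe : ∀ c, p ≠ some (e₀, c)) (hqe : ∀ c, q ≠ some (e₀, c)) :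
    ∃ (a' : QDObj μ) (eV : Fin a'.Γ.n ≃ Fin a.Γ.n) (eE : Fin a.Γ.m ≃ Fin a'.Γ.m),
      (jacobianDiagram μ).Adjacent a a' ∧ (∀ e, eE e ∈ a'.P.S ↔ e ∈ a.P.S) ∧
      ∀ f, eV (a'.Γ.root (flagEquiv eE (fun _ => false) f)) = a.Γ.root (Equiv.swap p q f) := by
  obtain ⟨H, l, h₁, h₂, h₃, Γ₁, ι, ι', hroot, hι, hemap⟩ := a.Γ.exists_exchange
    (card_root_of_isMaximal ha) e₀ b hp hq hpe hqe
  let t : QDObj μ := ⟨Γ₁, a.P.push ι.toSpecialization ι.map_leg (μ.map_eq ι)⟩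
  have htS : t.P.S.image ι.emap = a.P.S := by
    ext e
    rw [Finset.mem_image]
    constructor
    · rintro ⟨e', he', rfl⟩
      exact (ι.toSpecialization.mem_pullback a.P.S e').1 he'
    · intro he
      obtain ⟨e', rfl⟩ : e ∈ Set.range ι.emap := by
        rw [hι]
        rintro rfl
        exact he₀ he
      exact ⟨e', (ι.toSpecialization.mem_pullback a.P.S e').2 he, rfl⟩
  obtain ⟨P', hP', ⟨τ⟩⟩ := t.exists_lift ι' (f := e₀) (by rw [hemap]; exact hι)
  rw [hemap] at hP'
  replace hP' : P'.S = a.P.S := hP'.trans htS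
  let a' : QDObj μ := ⟨⟨a.Γ.n, a.Γ.m, H, a.Γ.weight, l, h₁, h₂, h₃⟩, P'⟩
  have hcard : Fintype.card a'.Edge = Fintype.card a.Edge := by
    rw [card_edge, card_edge]
    exact congrArg (fun S : Finset (Fin a.Γ.m) => a.Γ.m + S.card) hP'
  have ht : Fintype.card t.Edge + 1 = Fintype.card a.Edge := by
    have h1 : t.P.S.card = a.P.S.card := by
      rw [← htS, Finset.card_image_of_injective _ ι.emap_injective]
    have h2 := m_eq_of_range ι hι
    rw [card_edge, card_edge]
    change Γ₁.m + _ + 1 = _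
    omega
  refine ⟨a', Equiv.refl _, Equiv.refl _, ⟨ha, isMaximal_of_card ?_, t, ?_, ?_,
    ⟨(⟨ι, a.P.toPush _ ι.map_leg (μ.map_eq ι)⟩ : QDObj.Hom a t)⟩, ⟨(⟨ι', τ⟩ : QDObj.Hom a' t)⟩⟩,
    fun e => ?_, fun f => ?_⟩
  · rw [hcard]
    exact card_edge_of_isMaximal ha
  · rw [coneDim_jacobianDiagram, coneDim_jacobianDiagram, ht]
  · rw [coneDim_jacobianDiagram, coneDim_jacobianDiagram, ht, hcard]
  · change e ∈ P'.S ↔ _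
    rw [hP']
  · refine Eq.trans ?_ (hroot f)
    rcases f with _ | ⟨e, c⟩
    · rfl
    · simp [flagEquiv_some]
      rfl

/-- The pseudo-divisor `a` has the combinatorial type `φ`. -/
def IsMarked (a : QDObj μ) {k : ℕ} (φ : Option ((Fin k ⊕ Fin g) × Bool) → Fin (k + 1)) : Prop :=
  ∃ (eV : Fin a.Γ.n ≃ Fin (k + 1)) (eE : (Fin k ⊕ Fin g) ≃ Fin a.Γ.m) (ε : Fin k ⊕ Fin g → Bool),
    (∀ i, eE i ∈ a.P.S ↔ i.isRight) ∧ ∀ f, φ f = eV (a.Γ.root (flagEquiv eE ε f))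

theorem exists_isMarked {k : ℕ} (hk : k + 2 = 2 * g) {a : QDObj μ}
    (ha : (jacobianDiagram μ).IsMaximal a) :
    ∃ φ : Option ((Fin k ⊕ Fin g) × Bool) → Fin (k + 1), a.IsMarked φ := by
  obtain ⟨-, h1, h2, h3, -⟩ := isMaximal_structure ha
  have h4 : Fintype.card {e // e ∉ a.P.S} = k := by
    rw [Fintype.card_subtype, ← card_compl_add_card] at *
    have h5 := card_compl_add_card a
    have h6 : (Finset.univ.filter fun e => e ∉ a.P.S) = a.P.Sᶜ := by
      ext
      simp
    rw [h6]
    omega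
  let eS : Fin g ≃ {e // e ∈ a.P.S} := (Fintype.equivFinOfCardEq (by rw [Fintype.card_coe, h3])).symm
  let eT : Fin k ≃ {e // e ∉ a.P.S} := (Fintype.equivFinOfCardEq h4).symm
  let eE : (Fin k ⊕ Fin g) ≃ Fin a.Γ.m := ((Equiv.sumCongr eT eS).trans (Equiv.sumComm _ _)).trans
    (Equiv.sumCompl fun e => e ∈ a.P.S)
  refine ⟨_, finCongr (by omega), eE, fun _ => false, ?_, fun _ => rfl⟩
  rintro (t | s)
  · exact iff_of_false (eT t).2 (by simp)
  · exact iff_of_true (eS s).2 rfl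

/-- Equal types give an isomorphism of graphs matching the supports. The complements are trees, so
the divisors correspond as well and the two cones are isomorphic; any facet of one is a facet of
both. -/
theorem adjacent_of_isMarked {k : ℕ} {a a' : QDObj μ} (ha : (jacobianDiagram μ).IsMaximal a)
    (ha' : (jacobianDiagram μ).IsMaximal a') {φ : Option ((Fin k ⊕ Fin g) × Bool) → Fin (k + 1)}
    (h : a.IsMarked φ) (h' : a'.IsMarked φ) : (jacobianDiagram μ).Adjacent a a' := by
  obtain ⟨eV, eE, ε, hS, hφ⟩ := h
  obtain ⟨eV', eE', ε', hS', hφ'⟩ := h'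
  let em : Fin a'.Γ.m → Fin a.Γ.m := fun e => eE (eE'.symm e)
  have hem : Function.Surjective em := eE.surjective.comp eE'.symm.surjective
  let σ : Specialization a.Γ.graph a'.Γ.graph := Specialization.ofSection
    (fun v => eV'.symm (eV v)) em (fun e => xor (ε (eE'.symm e)) (ε' (eE'.symm e)))
    (fun v => eV.symm (eV' v)) (eE.injective.comp eE'.symm.injective) (by
      intro e c
      obtain ⟨i, rfl⟩ := eE'.surjective e
      have h1 := (hφ (some (i, xor c (ε i)))).symm.trans (hφ' (some (i, xor c (ε i))))
      simp only [flagEquiv_some, Bool.xor_assoc, Bool.xor_self, Bool.xor_false] at h1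
      simp only [em, Equiv.symm_apply_apply]
      exact eV'.symm_apply_eq.2 h1) (fun e he => (he (hem e)).elim) (fun v => by simp)
    (fun v => by simp [Reach.refl])
  let ι : StableGraph.Hom a.Γ a'.Γ := StableGraph.Hom.ofIsWeighted σ
    (eV'.symm_apply_eq.2 ((hφ none).symm.trans (hφ' none)))
    ((Specialization.isWeighted_iff_of_surjective σ hem _ _).2 fun v => by
      rw [(isMaximal_structure ha).1, (isMaximal_structure ha').1])
  have hP : a.P.push ι.toSpecialization ι.map_leg (μ.map_eq ι) = a'.P := by
    have h1 : (a.P.push ι.toSpecialization ι.map_leg (μ.map_eq ι)).S = a'.P.S := by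
      ext e
      obtain ⟨i, rfl⟩ := eE'.surjective e
      refine (ι.toSpecialization.mem_pullback a.P.S _).trans ?_
      change em _ ∈ _ ↔ _
      simp only [em, Equiv.symm_apply_apply]
      rw [hS, hS']
    refine QD.eq_of_tree (μ.degree_eq a'.Γ) h1 ?_
    rw [h1, Fintype.card_fin]
    have h2 := card_compl_add_card a'
    obtain ⟨-, h3, h4, h5, -⟩ := isMaximal_structure ha'
    omega
  have τ := a.P.toPush ι.toSpecialization ι.map_leg (μ.map_eq ι)
  rw [hP] at τ
  obtain ⟨-, h3, -, h5, -⟩ := isMaximal_structure ha'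
  -- The support has g elements, and g > 0 because n + 1 = 2g. Moving one exceptional vertex to an
  -- end provides the facet.
  obtain ⟨s, hs⟩ : a'.P.S.Nonempty := Finset.card_pos.1 (by omega)
  let t : QDObj μ := ⟨a'.Γ, a'.P.collapse (a'.P.S.erase s) (Finset.erase_subset _ _) fun _ => false⟩
  let ρ : QDObj.Hom a' t := ⟨StableGraph.Hom.id _, a'.P.toCollapse _ (Finset.erase_subset _ _) _⟩
  have hcard : Fintype.card t.Edge + 1 = Fintype.card a'.Edge := by
    rw [card_edge, card_edge]
    have := Finset.card_erase_add_one hs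
    change a'.Γ.m + (a'.P.S.erase s).card + 1 = _
    omega
  refine ⟨ha, ha', t, ?_, ?_, ⟨QDObj.Hom.comp ρ ⟨ι, τ⟩⟩, ⟨ρ⟩⟩
  · rw [coneDim_jacobianDiagram, coneDim_jacobianDiagram, hcard]
    have h6 := card_edge_of_isMaximal ha
    have h7 := card_edge_of_isMaximal ha'
    omega
  · rw [coneDim_jacobianDiagram, coneDim_jacobianDiagram, hcard]

/-- The combinatorial types which are connected to `a` form a closed family. -/
theorem closed_isMarked {k : ℕ} (a : QDObj μ)
    (κ : Flag k ≃ Option ((Fin k ⊕ Fin g) × Bool)) (hκ : ∀ t b, κ (.inl (t, b)) = some (.inl t, b)) :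
    Flag.Closed (k := k) fun φ => ∃ a' : QDObj μ, (jacobianDiagram μ).IsMaximal a' ∧
      Relation.ReflTransGen (jacobianDiagram μ).Adjacent a a' ∧
      a'.IsMarked fun f => φ (κ.symm f) where
  card_eq := by
    rintro φ ⟨a', ha', -, eV, eE, ε, -, hφ⟩ v
    have h1 : (Finset.univ.filter fun f => φ f = v).card = Nat.card {f // φ f = v} := by
      rw [Nat.card_eq_fintype_card, Fintype.card_subtype]
    rw [h1, ← card_root_of_isMaximal ha' (eV.symm v)]
    refine Nat.card_congr ((κ.trans (flagEquiv eE ε)).subtypeEquiv fun f => ?_)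
    have := hφ (κ f)
    beta_reduce at this
    rw [Equiv.symm_apply_apply] at this
    rw [this, Equiv.trans_apply, Equiv.eq_symm_apply]
  connected := by
    rintro φ ⟨a', ha', -, eV, eE, ε, hS, hφ⟩ v w
    have h1 := a'.P.connected_compl (μ.degree_eq a'.Γ) (eV.symm v) (eV.symm w)
    have h2 := Reach.map (G' := Flag.tree φ) (S' := Set.univ) eV (fun e he => ?_) h1
    · simpa using h2
    · obtain ⟨i, rfl⟩ := eE.surjective e
      rcases i with t | s
      · have h3 : ∀ b, φ (.inl (t, xor b (ε (.inl t)))) = eV (a'.Γ.graph.ends (eE (.inl t)) b) := by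
          intro b
          have h4 := hφ (some (.inl t, xor b (ε (.inl t))))
          beta_reduce at h4
          rw [← hκ, Equiv.symm_apply_apply, hκ, flagEquiv_some] at h4
          simpa [StableGraph.root] using h4
        rw [← h3, ← h3]
        exact reach_ends (G := Flag.tree φ) (Set.mem_univ t) _ _
      · simp [hS] at he
  vertices := by
    rintro φ ⟨a', ha', h, eV, eE, ε, hS, hφ⟩ σ
    exact ⟨a', ha', h, eV.trans σ, eE, ε, hS, fun f => congrArg σ (hφ f)⟩
  edges := by
    rintro φ ⟨a', ha', h, eV, eE, ε, hS, hφ⟩ τ δ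
    refine ⟨a', ha', h, eV, (Equiv.sumCongr τ (Equiv.refl _)).trans eE,
      Sum.elim (fun t => xor (δ t) (ε (.inl (τ t)))) (fun s => ε (.inr s)), ?_, ?_⟩
    · rintro (t | s)
      · simpa using hS (.inl (τ t))
      · simpa using hS (.inr s)
    · intro f
      obtain ⟨x, rfl⟩ := κ.surjective f
      beta_reduce at hφ ⊢
      rw [Equiv.symm_apply_apply]
      rcases x with ⟨t, b⟩ | l
      · have h1 := hφ (some (.inl (τ t), xor b (δ t)))
        rw [← hκ, Equiv.symm_apply_apply, hκ, flagEquiv_some] at h1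
        rw [hκ, flagEquiv_some]
        simpa using h1
      · have h1 := hφ (κ (.inr l))
        rw [Equiv.symm_apply_apply] at h1
        rw [Sum.elim_inr, h1]
        rcases h2 : κ (.inr l) with _ | ⟨t | s, b⟩
        · rfl
        · rw [← hκ] at h2
          simpa using κ.injective h2
        · rfl
  exchange := by
    rintro φ ⟨a', ha', h, eV, eE, ε, hS, hφ⟩ t b l q h1 h2 h3 h4
    beta_reduce at hφ
    have hinj := (flagEquiv eE ε).injective.comp κ.injective
    have hφ' : ∀ f, φ f = eV (a'.Γ.root (flagEquiv eE ε (κ f))) := fun f => by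
      rw [← hφ, Equiv.symm_apply_apply]
    have hend : ∀ c, φ (.inl (t, c)) = eV (a'.Γ.graph.ends (eE (.inl t)) (xor c (ε (.inl t)))) :=
      fun c => by rw [hφ', hκ, flagEquiv_some]; rfl
    have hflag : ∀ c, some (eE (.inl t), c) =
        flagEquiv eE ε (κ (.inl (t, xor c (ε (.inl t))))) := fun c => by
      rw [hκ, flagEquiv_some]
      simp
    -- The tree edge numbered `t` lies outside the support, and `ε` shifts the indices of its ends.
    -- Injectivity of the numbering shows that the exchanged flags are not halves of it.
    obtain ⟨a'', eV', eE', hadj, hS', hroot⟩ := exists_exchange ha' (e₀ := eE (.inl t))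
      (by simp [hS]) (xor b (ε (.inl t))) (p := flagEquiv eE ε (κ (.inr l)))
      (q := flagEquiv eE ε (κ q))
      (eV.injective (by rw [← hφ', ← hend, h1]))
      (eV.injective (by rw [← hφ', ← h2, hend, Bool.not_xor]))
      (fun c => by
        refine (hflag c).symm ▸ hinj.ne (by simp))
      (fun c => by
        refine (hflag c).symm ▸ hinj.ne ?_
        rintro rfl
        cases hc : xor c (ε (.inl t)) <;> cases b <;> simp_all)
    refine ⟨a'', hadj.2.1, h.tail hadj, eV'.trans eV, eE.trans eE', ε, fun i => (hS' _).trans (hS i),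
      fun f => ?_⟩
    obtain ⟨x, rfl⟩ := κ.surjective f
    beta_reduce
    rw [hφ', Equiv.symm_apply_apply, Equiv.trans_apply]
    refine (congrArg (fun x => eV (a'.Γ.root x)) (hinj.map_swap (.inr l) q x)).trans ?_
    refine congrArg eV ((hroot _).symm.trans (congrArg (fun x => eV' (a''.Γ.root x)) ?_))
    simp only [Function.comp_apply]
    rcases κ x with _ | ⟨i, c⟩
    · rfl
    · simp [flagEquiv_some]

end QDObj

/-- The leaves of the tree are the 2g halves of the edges in S and the leg, and 2g + 1 = k + 3. -/
theorem exists_flag_equiv {k : ℕ} (hk : k + 2 = 2 * g) :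
    ∃ κ : Flag k ≃ Option ((Fin k ⊕ Fin g) × Bool), ∀ t b, κ (.inl (t, b)) = some (.inl t, b) := by
  let e : Fin (k + 3) ≃ Option (Fin g × Bool) := Fintype.equivOfCardEq (by
    simp
    omega)
  let f : Fin k × Bool ⊕ Option (Fin g × Bool) ≃ Option ((Fin k ⊕ Fin g) × Bool) :=
    ((Equiv.sumCongr (Equiv.refl _) (Equiv.optionEquivSumPUnit.{0} _)).trans
      (Equiv.sumAssoc _ _ _).symm).trans
      ((Equiv.sumCongr (Equiv.sumProdDistrib _ _ _).symm (Equiv.refl _)).trans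
        (Equiv.optionEquivSumPUnit.{0} _).symm)
  exact ⟨(Equiv.sumCongr (Equiv.refl _) e).trans f, fun t b => rfl⟩

/-- From both maximal cones a chain leads to a cone of caterpillar type; two cones of the same type
are adjacent, and adjacency is symmetric. -/
theorem isConnectedThroughCodimOne_jacobianDiagram (μ : UniversalPolarization g d) :
    (jacobianDiagram μ).IsConnectedThroughCodimOne := by
  intro (a : QDObj μ) (a' : QDObj μ) ha ha'
  obtain ⟨k, hk⟩ : ∃ k, k + 2 = 2 * g := by
    have := (isMaximal_structure ha).2.1
    exact ⟨2 * g - 2, by have := a.Γ.leg.pos; omega⟩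
  obtain ⟨κ, hκ⟩ := exists_flag_equiv hk
  have key : ∀ a : QDObj μ, (jacobianDiagram μ).IsMaximal a → ∃ b : QDObj μ,
      (jacobianDiagram μ).IsMaximal b ∧ Relation.ReflTransGen (jacobianDiagram μ).Adjacent a b ∧
      b.IsMarked fun f => ⟨Flag.caterpillar k (κ.symm f), Nat.lt_succ_of_le (Flag.caterpillar_le _)⟩ := by
    intro a ha
    obtain ⟨φ, hφ⟩ := QDObj.exists_isMarked hk ha
    refine (a.closed_isMarked κ hκ).caterpillar_mem (φ := fun f => φ (κ f)) ⟨a, ha, .refl, ?_⟩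
    simpa using hφ
  obtain ⟨b, hb, hab, hbm⟩ := key a ha
  obtain ⟨b', hb', hab', hbm'⟩ := key a' ha'
  have hsymm : Std.Symm (jacobianDiagram μ).Adjacent :=
    ⟨fun _ _ ⟨hx, hy, t, h1, h2, h3, h4⟩ => ⟨hy, hx, t, h2, h1, h4, h3⟩⟩
  exact (hab.tail (QDObj.adjacent_of_isMarked hb hb' hbm hbm')).trans
    (Relation.ReflTransGen.stdSymm.symm _ _ hab')

end TropJac

end

noncomputable section

namespace TropJac

open scoped Classical

open Multigraph

/-! ### Local isometries of intervals -/

theorem eq_of_locally_eq {β : Type*} {L : ℝ} {F : ℝ → β}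
    (h : ∀ s ∈ Set.Ioo 0 L, ∃ ρ > 0, ∀ u ∈ Set.Ioo 0 L, |u - s| < ρ → F u = F s) {s u : ℝ}
    (hs : s ∈ Set.Ioo 0 L) (hu : u ∈ Set.Ioo 0 L) : F s = F u := by
  have : PreconnectedSpace (Set.Ioo 0 L) := Subtype.preconnectedSpace isPreconnected_Ioo
  have h1 : IsLocallyConstant fun x : Set.Ioo 0 L => F x := by
    rw [IsLocallyConstant.iff_eventually_eq]
    intro x
    obtain ⟨ρ, hρ, h2⟩ := h x x.2
    exact Metric.eventually_nhds_iff.2 ⟨ρ, hρ, fun y hy => h2 y y.2 hy⟩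
  exact h1.apply_eq_of_preconnectedSpace ⟨s, hs⟩ ⟨u, hu⟩

/-- A continuous injective function on an interval is strictly monotone, which removes the absolute
values: H(u) - u or H(u) + u is locally constant. -/
theorem affine_of_local_isometry {L : ℝ} (hL : 0 < L) {H : ℝ → ℝ} (hinj : Set.InjOn H (Set.Ioo 0 L))
    (h : ∀ s ∈ Set.Ioo 0 L, ∃ ρ > 0, ∀ u ∈ Set.Ioo 0 L, |u - s| < ρ → |H u - H s| = |u - s|) :
    ∃ c, (∀ u ∈ Set.Ioo 0 L, H u = c + u) ∨ ∀ u ∈ Set.Ioo 0 L, H u = c - u := by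
  have hcont : ContinuousOn H (Set.Ioo 0 L) := by
    intro s hs
    obtain ⟨ρ, hρ, h1⟩ := h s hs
    rw [Metric.continuousWithinAt_iff]
    intro ε hε
    refine ⟨min ρ ε, lt_min hρ hε, fun {u} hu hd => ?_⟩
    rw [Real.dist_eq] at hd ⊢
    rw [h1 u hu (hd.trans_le (min_le_left _ _))]
    exact hd.trans_le (min_le_right _ _)
  have hmid : L / 2 ∈ Set.Ioo 0 L := ⟨by linarith, by linarith⟩
  rcases hcont.strictMonoOn_of_injOn_Ioo hL hinj with hmono | hmono
  · refine ⟨H (L / 2) - L / 2, Or.inl fun u hu => ?_⟩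
    have := eq_of_locally_eq (F := fun u => H u - u) (fun s hs => ?_) hu hmid
    · linarith
    obtain ⟨ρ, hρ, h1⟩ := h s hs
    refine ⟨ρ, hρ, fun u hu hd => ?_⟩
    have h2 := h1 u hu hd
    rcases lt_trichotomy u s with h3 | rfl | h3
    · have := hmono hu hs h3
      rw [abs_of_neg (by linarith), abs_of_neg (by linarith)] at h2
      linarith
    · rfl
    · have := hmono hs hu h3
      rw [abs_of_pos (by linarith), abs_of_pos (by linarith)] at h2
      linarith
  · refine ⟨H (L / 2) + L / 2, Or.inr fun u hu => ?_⟩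
    have := eq_of_locally_eq (F := fun u => H u + u) (fun s hs => ?_) hu hmid
    · linarith
    obtain ⟨ρ, hρ, h1⟩ := h s hs
    refine ⟨ρ, hρ, fun u hu hd => ?_⟩
    have h2 := h1 u hu hd
    rcases lt_trichotomy u s with h3 | rfl | h3
    · have := hmono hu hs h3
      rw [abs_of_pos (by linarith), abs_of_neg (by linarith)] at h2
      linarith
    · rfl
    · have := hmono hs hu h3
      rw [abs_of_neg (by linarith), abs_of_pos (by linarith)] at h2
      linarith

namespace StableCurve

variable {g : ℕ} (X : StableCurve g)

/-! ### Points and distances on a tropical curve -/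

/-- A function on the curve given by functions on the vertices and edges. -/
def glue {β : Type*} (fv : Fin X.Γ.n → β) (fe : Fin X.Γ.m → ℝ → β)
    (h0 : ∀ e, fe e 0 = fv (X.Γ.graph.ends e false))
    (h1 : ∀ e, fe e (X.len e) = fv (X.Γ.graph.ends e true)) : X.Point → β :=
  Quot.lift (Sum.elim fv fun p => fe p.1 p.2) (by
    rintro _ _ (e | e)
    · exact h0 e
    · exact h1 e)

variable {X}

theorem onEdge_zero (e : Fin X.Γ.m) (h : (0 : ℝ) ∈ Set.Icc 0 (X.len e)) :
    X.onEdge e ⟨0, h⟩ = X.vertex (X.Γ.graph.ends e false) := Quot.sound (.left e)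

theorem onEdge_len (e : Fin X.Γ.m) (h : X.len e ∈ Set.Icc 0 (X.len e)) :
    X.onEdge e ⟨X.len e, h⟩ = X.vertex (X.Γ.graph.ends e true) := Quot.sound (.right e)

theorem onEdge_end (e : Fin X.Γ.m) (b : Bool)
    (h : (if b then X.len e else 0) ∈ Set.Icc 0 (X.len e)) :
    X.onEdge e ⟨if b then X.len e else 0, h⟩ = X.vertex (X.Γ.graph.ends e b) := by
  cases b
  · exact onEdge_zero e _
  · exact onEdge_len e _

/-- The vertex or interior point of an edge represented by a point. -/
def normalForm : X.Point → Fin X.Γ.n ⊕ (Fin X.Γ.m × ℝ) :=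
  X.glue .inl (fun e t => if t = 0 then .inl (X.Γ.graph.ends e false)
    else if t = X.len e then .inl (X.Γ.graph.ends e true) else .inr (e, t)) (by simp)
    (fun e => by simp [(X.len_pos e).ne'])

theorem normalForm_vertex (v : Fin X.Γ.n) : normalForm (X.vertex v) = .inl v := rfl

theorem normalForm_onEdge (e : Fin X.Γ.m) (a : Set.Icc 0 (X.len e))
    (ha : (a : ℝ) ∈ Set.Ioo 0 (X.len e)) : normalForm (X.onEdge e a) = .inr (e, (a : ℝ)) := by
  change (if _ then _ else _) = _
  rw [if_neg ha.1.ne', if_neg ha.2.ne]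

theorem vertex_injective : Function.Injective X.vertex := fun v w h => by
  have := congrArg normalForm h
  simpa [normalForm_vertex] using this

theorem vertex_ne_onEdge (v : Fin X.Γ.n) (e : Fin X.Γ.m) (a : Set.Icc 0 (X.len e))
    (ha : (a : ℝ) ∈ Set.Ioo 0 (X.len e)) : X.vertex v ≠ X.onEdge e a := fun h => by
  have := congrArg normalForm h
  rw [normalForm_onEdge e a ha] at this
  simp [normalForm_vertex] at this

theorem onEdge_eq_or (e : Fin X.Γ.m) (a : Set.Icc 0 (X.len e)) :
    (a : ℝ) ∈ Set.Ioo 0 (X.len e) ∨ ∃ b, X.onEdge e a = X.vertex (X.Γ.graph.ends e b) := by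
  obtain ⟨a, ha⟩ := a
  rcases ha.1.eq_or_lt with rfl | h0
  · exact Or.inr ⟨false, onEdge_zero e ha⟩
  rcases ha.2.eq_or_lt with rfl | h1
  · exact Or.inr ⟨true, onEdge_len e ha⟩
  exact Or.inl ⟨h0, h1⟩

theorem onEdge_eq_onEdge {e e' : Fin X.Γ.m} {a : Set.Icc 0 (X.len e)} {a' : Set.Icc 0 (X.len e')}
    (ha : (a : ℝ) ∈ Set.Ioo 0 (X.len e)) (h : X.onEdge e a = X.onEdge e' a') :
    e = e' ∧ (a : ℝ) = a' := by
  rcases onEdge_eq_or e' a' with ha' | ⟨b, hb⟩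
  · have := congrArg normalForm h
    rw [normalForm_onEdge e a ha, normalForm_onEdge e' a' ha'] at this
    simpa using this
  · rw [hb] at h
    exact (vertex_ne_onEdge _ e a ha h.symm).elim

theorem point_cases (p : X.Point) : (∃ v, p = X.vertex v) ∨
    ∃ (e : Fin X.Γ.m) (a : Set.Icc 0 (X.len e)), (a : ℝ) ∈ Set.Ioo 0 (X.len e) ∧ p = X.onEdge e a := by
  induction p using Quot.ind with
  | mk p =>
    rcases p with v | ⟨e, a⟩
    · exact Or.inl ⟨v, rfl⟩
    · rcases onEdge_eq_or e a with h | ⟨b, h⟩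
      · exact Or.inr ⟨e, a, h, rfl⟩
      · exact Or.inl ⟨_, h⟩

/-- Connectedness of the graph ensures that the infimum defining `dist` is taken over a nonempty set
and is not a default value. -/
theorem exists_pathLength (p q : X.Point) : ∃ L, X.PathLength p q L := by
  have hstep : ∀ e a b, (∃ L, X.PathLength p (X.onEdge e a) L) → ∃ L, X.PathLength p (X.onEdge e b) L :=
    fun e a b ⟨L, h⟩ => ⟨_, .step p e a b L h⟩
  have hends : ∀ e b c, (∃ L, X.PathLength p (X.vertex (X.Γ.graph.ends e b)) L) →
      ∃ L, X.PathLength p (X.vertex (X.Γ.graph.ends e c)) L := by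
    intro e b c h
    have h0 : ∀ b : Bool, (if b then X.len e else 0) ∈ Set.Icc 0 (X.len e) := fun b => by
      have := (X.len_pos e).le
      cases b <;> simp [this]
    rw [← onEdge_end e b (h0 b)] at h
    rw [← onEdge_end e c (h0 c)]
    exact hstep e _ _ h
  have hreach : ∀ v w, X.Γ.graph.Reach Set.univ v w →
      ((∃ L, X.PathLength p (X.vertex v) L) ↔ ∃ L, X.PathLength p (X.vertex w) L) := by
    intro v w h
    induction h with
    | rel x y h =>
      obtain ⟨e, -, rfl, rfl⟩ := h
      exact ⟨hends e _ _, hends e _ _⟩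
    | refl x => rfl
    | symm x y _ ih => exact ih.symm
    | trans x y z _ _ ih₁ ih₂ => exact ih₁.trans ih₂
  have hv : ∃ v L, X.PathLength p (X.vertex v) L := by
    rcases point_cases p with ⟨v, hv⟩ | ⟨e, a, -, ha⟩
    · exact ⟨v, 0, hv ▸ .refl p⟩
    · refine ⟨X.Γ.graph.ends e false, ?_⟩
      rw [← onEdge_zero e ⟨le_rfl, (X.len_pos e).le⟩]
      exact hstep e a _ ⟨0, ha ▸ .refl p⟩
  obtain ⟨v, hv⟩ := hv
  have hall : ∀ w, ∃ L, X.PathLength p (X.vertex w) L := fun w =>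
    (hreach v w (X.Γ.connected v w)).1 hv
  rcases point_cases q with ⟨w, rfl⟩ | ⟨e, a, -, rfl⟩
  · exact hall w
  · have := hall (X.Γ.graph.ends e false)
    rw [← onEdge_zero e ⟨le_rfl, (X.len_pos e).le⟩] at this
    exact hstep e _ a this

theorem PathLength.nonneg {p q : X.Point} {L : ℝ} (h : X.PathLength p q L) : 0 ≤ L := by
  induction h with
  | refl => exact le_rfl
  | step e a b L _ ih => positivity

theorem dist_onEdge_le (e : Fin X.Γ.m) (a b : Set.Icc 0 (X.len e)) :
    X.dist (X.onEdge e a) (X.onEdge e b) ≤ |(b : ℝ) - a| := by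
  refine csInf_le ⟨0, fun L hL => PathLength.nonneg hL⟩ ?_
  have := PathLength.step _ e a b 0 (.refl (X.onEdge e a))
  rwa [zero_add] at this

/-- Lipschitz functions give lower bounds for the distance. -/
theorem le_dist {fv : Fin X.Γ.n → ℝ} {fe : Fin X.Γ.m → ℝ → ℝ}
    {h0 : ∀ e, fe e 0 = fv (X.Γ.graph.ends e false)}
    {h1 : ∀ e, fe e (X.len e) = fv (X.Γ.graph.ends e true)}
    (h : ∀ e s t, |fe e t - fe e s| ≤ |t - s|) (p q : X.Point) :
    |X.glue fv fe h0 h1 q - X.glue fv fe h0 h1 p| ≤ X.dist p q := by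
  refine le_csInf (exists_pathLength p q) fun L hL => ?_
  change X.PathLength p q L at hL
  induction hL with
  | refl => simp
  | step e a b L _ ih =>
    refine (abs_sub_le _ (X.glue fv fe h0 h1 (X.onEdge e a)) _).trans ?_
    rw [add_comm]
    exact add_le_add ih (h e a b)

theorem abs_min_sub_min_le (ρ x y : ℝ) : |min ρ x - min ρ y| ≤ |x - y| := by
  have := abs_min_sub_min_le_max ρ x ρ y
  simpa using this

/-- The truncated distance from an interior point of an edge. -/
theorem min_le_dist_onEdge {e : Fin X.Γ.m} {s : Set.Icc 0 (X.len e)} {ρ : ℝ} (hρ : ρ ≤ s)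
    (hρ' : ρ ≤ X.len e - s) (h0 : 0 ≤ ρ) :
    (∀ t : Set.Icc 0 (X.len e), min ρ |(t : ℝ) - s| ≤ X.dist (X.onEdge e s) (X.onEdge e t)) ∧
    ∀ q, (∀ t, q ≠ X.onEdge e t) → ρ ≤ X.dist (X.onEdge e s) q := by
  have key := le_dist (X := X) (fv := fun _ => ρ)
    (fe := fun e' t => if e' = e then min ρ |t - s| else ρ)
    (h0 := fun e' => by
      split_ifs
      · exact min_eq_left (by rw [zero_sub, abs_neg]; exact hρ.trans (le_abs_self _))
      · rfl)
    (h1 := fun e' => by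
      split_ifs with h
      · subst h
        exact min_eq_left (hρ'.trans (le_abs_self _))
      · rfl)
    (fun e' a b => by
      split_ifs
      · refine (abs_min_sub_min_le _ _ _).trans ((abs_abs_sub_abs_le _ _).trans ?_)
        rw [sub_sub_sub_cancel_right]
      · simp) (X.onEdge e s)
  have hzero : ∀ t : Set.Icc 0 (X.len e), (if e = e then min ρ |(t : ℝ) - s| else ρ) =
      min ρ |(t : ℝ) - s| := fun t => if_pos rfl
  refine ⟨fun t => ?_, fun q hq => ?_⟩
  · have := key (X.onEdge e t)
    change |(if e = e then min ρ |(t : ℝ) - s| else ρ) -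
      (if e = e then min ρ |(s : ℝ) - s| else ρ)| ≤ _ at this
    rw [hzero, hzero, sub_self, abs_zero, min_eq_right h0, sub_zero] at this
    exact (le_abs_self _).trans this
  · have := key q
    have h2 : ∀ h0 h1, X.glue (fun _ => ρ) (fun e' t => if e' = e then min ρ |t - s| else ρ)
        h0 h1 q = ρ := by
      intro h0 h1
      induction q using Quot.ind with
      | mk q =>
        rcases q with v | ⟨e', t⟩
        · rfl
        · exact if_neg fun h => by subst h; exact hq t rfl
    rw [h2] at this
    change |ρ - (if e = e then min ρ |(s : ℝ) - s| else ρ)| ≤ _ at this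
    rw [hzero, sub_self, abs_zero, min_eq_right h0, sub_zero] at this
    exact (le_abs_self _).trans this

theorem dist_onEdge_of_lt {e : Fin X.Γ.m} {s t : Set.Icc 0 (X.len e)} (h : |(t : ℝ) - s| < s)
    (h' : |(t : ℝ) - s| < X.len e - s) : X.dist (X.onEdge e s) (X.onEdge e t) = |(t : ℝ) - s| := by
  refine le_antisymm (dist_onEdge_le e s t) ?_
  have := (min_le_dist_onEdge (e := e) (s := s) h.le h'.le (abs_nonneg _)).1 t
  rwa [min_self] at this

theorem exists_onEdge_of_dist_lt {e : Fin X.Γ.m} {s : Set.Icc 0 (X.len e)} {q : X.Point}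
    (h : X.dist (X.onEdge e s) q < s) (h' : X.dist (X.onEdge e s) q < X.len e - s) :
    ∃ t, q = X.onEdge e t ∧ |(t : ℝ) - s| = X.dist (X.onEdge e s) q := by
  have h0 : 0 ≤ min (s : ℝ) (X.len e - s) := le_min s.2.1 (sub_nonneg.2 s.2.2)
  obtain ⟨h1, h2⟩ := min_le_dist_onEdge (e := e) (s := s) (min_le_left _ _) (min_le_right _ _) h0
  by_cases hq : ∀ t, q ≠ X.onEdge e t
  · exact absurd (h2 q hq) (not_le.2 (lt_min h h'))
  push Not at hq
  obtain ⟨t, rfl⟩ := hq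
  refine ⟨t, rfl, le_antisymm ?_ (dist_onEdge_le e s t)⟩
  by_contra! hlt
  have h3 := h1 t
  rcases min_le_iff.1 h3 with h4 | h4
  · exact absurd h4 (not_le.2 (lt_min h h'))
  · exact absurd h4 (not_le.2 hlt)

theorem exists_radius (X : StableCurve g) : ∃ ρ > 0, ∀ e, 2 * ρ ≤ X.len e := by
  rcases isEmpty_or_nonempty (Fin X.Γ.m) with h | h
  · exact ⟨1, one_pos, fun e => h.elim e⟩
  · obtain ⟨e, he⟩ := Finite.exists_min X.len
    exact ⟨X.len e / 2, half_pos (X.len_pos e), fun e' => by linarith [he e']⟩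

/-- The position at distance `t` from the end `b` of an interval of length `L`. -/
def twist (L : ℝ) (b : Bool) (t : ℝ) : ℝ := if b then L - t else t

theorem twist_mem_Icc {L t : ℝ} (b : Bool) (h : t ∈ Set.Icc 0 L) : twist L b t ∈ Set.Icc 0 L := by
  cases b
  · exact h
  · exact ⟨sub_nonneg.2 h.2, sub_le_self _ h.1⟩

theorem twist_mem_Ioo {L t : ℝ} (b : Bool) (h : t ∈ Set.Ioo 0 L) : twist L b t ∈ Set.Ioo 0 L := by
  cases b
  · exact h
  · exact ⟨sub_pos.2 h.2, sub_lt_self _ h.1⟩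

theorem twist_twist (L : ℝ) (b c : Bool) (t : ℝ) : twist L b (twist L c t) = twist L (xor b c) t := by
  cases b <;> cases c <;> simp [twist]

theorem abs_twist_sub (L : ℝ) (b : Bool) (s t : ℝ) : |twist L b t - twist L b s| = |t - s| := by
  cases b
  · rfl
  · simp only [twist, if_true]
    rw [sub_sub_sub_cancel_left, abs_sub_comm]

theorem onEdge_twist_zero {e : Fin X.Γ.m} {b : Bool} (h : twist (X.len e) b 0 ∈ Set.Icc 0 (X.len e)) :
    X.onEdge e ⟨twist (X.len e) b 0, h⟩ = X.vertex (X.Γ.graph.ends e b) := by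
  rw [← onEdge_end e b (by cases b <;> simpa [twist] using h)]
  congr 2
  cases b <;> simp [twist]

/-- The truncated distance from a vertex. -/
theorem le_dist_vertex {v : Fin X.Γ.n} {ρ r : ℝ} (hr : 0 ≤ r) (hrρ : r ≤ ρ)
    (hρ : ∀ e, 2 * ρ ≤ X.len e) {e : Fin X.Γ.m} {b : Bool} (hv : X.Γ.graph.ends e b = v)
    (h : twist (X.len e) b r ∈ Set.Icc 0 (X.len e)) :
    r ≤ X.dist (X.vertex v) (X.onEdge e ⟨twist (X.len e) b r, h⟩) ∧
    ∀ w ≠ v, ρ - r ≤ X.dist (X.vertex w) (X.onEdge e ⟨twist (X.len e) b r, h⟩) := by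
  -- This is the distance from `v` cut off at ρ. As every edge has length at least 2ρ, the cut-off
  -- is reached before the opposite end, also for loops at `v`.
  let fe : Fin X.Γ.m → ℝ → ℝ := fun e t => min ρ (min (if X.Γ.graph.ends e false = v then t else ρ)
      (if X.Γ.graph.ends e true = v then X.len e - t else ρ))
  have h0 : 0 ≤ ρ := hr.trans hrρ
  have key := le_dist (X := X) (fv := fun w => if w = v then 0 else ρ) (fe := fe)
    (h0 := fun e => by
      have := hρ e
      simp only [fe]
      split_ifs <;> simp only [sub_zero, min_def] <;> split_ifs <;> linarith)
    (h1 := fun e => by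
      have := hρ e
      simp only [fe]
      split_ifs <;> simp only [sub_self, min_def] <;> split_ifs <;> linarith)
    (fun e s t => by
      refine (abs_min_sub_min_le _ _ _).trans ((abs_min_sub_min_le_max _ _ _ _).trans
        (max_le ?_ ?_))
      · split_ifs <;> simp
      · split_ifs
        · rw [sub_sub_sub_cancel_left, abs_sub_comm]
        · simp)
  have hval : fe e (twist (X.len e) b r) = r := by
    have := hρ e
    cases b
    · simp only [fe, twist, hv, if_true, Bool.false_eq_true, if_false]
      rw [min_eq_left (a := r), min_eq_right hrρ]
      split_ifs <;> linarith
    · simp only [fe, twist, hv, if_true, sub_sub_cancel]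
      rw [min_eq_right (b := r), min_eq_right hrρ]
      split_ifs <;> linarith
  refine ⟨?_, fun w hw => ?_⟩
  · have := key (X.vertex v) (X.onEdge e ⟨twist (X.len e) b r, h⟩)
    change |fe e (twist (X.len e) b r) - (if v = v then 0 else ρ)| ≤ _ at this
    rw [if_pos rfl, hval, sub_zero] at this
    exact (le_abs_self _).trans this
  · have := key (X.vertex w) (X.onEdge e ⟨twist (X.len e) b r, h⟩)
    change |fe e (twist (X.len e) b r) - (if w = v then 0 else ρ)| ≤ _ at this
    rw [if_neg hw, hval, abs_sub_comm] at this
    exact (le_abs_self _).trans this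

theorem dist_vertex_le {e : Fin X.Γ.m} {b : Bool} {r : ℝ} (hr : r ∈ Set.Icc 0 (X.len e)) :
    X.dist (X.vertex (X.Γ.graph.ends e b)) (X.onEdge e ⟨twist (X.len e) b r, twist_mem_Icc b hr⟩) ≤
      r := by
  have h0 : (0 : ℝ) ∈ Set.Icc 0 (X.len e) := ⟨le_rfl, (X.len_pos e).le⟩
  rw [← onEdge_twist_zero (twist_mem_Icc b h0)]
  refine (dist_onEdge_le e _ _).trans ?_
  simp only
  rw [abs_twist_sub, sub_zero, abs_of_nonneg hr.1]

theorem weight_vertex (v : Fin X.Γ.n) : X.weight (X.vertex v) = X.Γ.weight v := by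
  rw [weight, Finset.sum_filter, Finset.sum_eq_single v]
  · exact if_pos rfl
  · exact fun w _ hw => if_neg fun h => hw (vertex_injective h)
  · simp

theorem exists_vertex_of_weight {p : X.Point} (h : X.weight p ≠ 0) : ∃ v, p = X.vertex v := by
  obtain ⟨v, hv, -⟩ := Finset.exists_ne_zero_of_sum_ne_zero h
  exact ⟨v, (Finset.mem_filter.1 hv).2.symm⟩

namespace Aut

variable (α : X.Aut)

/-- The inverse automorphism. -/
def symm : X.Aut where
  toEquiv := α.toEquiv.symm
  isometry p q := by
    rw [← α.isometry, Equiv.apply_symm_apply, Equiv.apply_symm_apply]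
  map_mark := by rw [Equiv.symm_apply_eq, α.map_mark]
  map_weight p := by rw [← α.map_weight, Equiv.apply_symm_apply]

/-- Vertices are mapped to vertices. -/
theorem exists_vertex (v : Fin X.Γ.n) : ∃ w, α.toEquiv (X.vertex v) = X.vertex w := by
  by_cases hw : X.Γ.weight v = 0
  swap
  · exact exists_vertex_of_weight (by rwa [α.map_weight, weight_vertex])
  by_cases hl : v = X.Γ.leg
  · exact ⟨_, hl ▸ α.map_mark⟩
  rcases point_cases (α.toEquiv (X.vertex v)) with h | ⟨e, s, hs, h⟩
  · exact h
  -- A vertex of weight 0 without leg has valence at least 3, so at least three points at distance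
  -- `r` leave it along different half-edges. An interior point of an edge has only the two points s
  -- ± r at that distance.
  exfalso
  obtain ⟨ρ, hρ, hρ'⟩ := X.exists_radius
  have hmin : 0 < min ρ (min (s : ℝ) (X.len e - s)) := lt_min hρ (lt_min hs.1 (sub_pos.2 hs.2))
  obtain ⟨r, hr, hr1⟩ := exists_between hmin
  have hrρ : r < ρ := hr1.trans_le (min_le_left _ _)
  have hrs : r < s := hr1.trans_le ((min_le_right _ _).trans (min_le_left _ _))
  have hrs' : r < X.len e - s := hr1.trans_le ((min_le_right _ _).trans (min_le_right _ _))
  have hmem : ∀ e, r ∈ Set.Ioo 0 (X.len e) := fun e => ⟨hr, by linarith [hρ' e]⟩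
  have hmem' : ∀ e b, twist (X.len e) b r ∈ Set.Icc 0 (X.len e) := fun e b =>
    twist_mem_Icc b (Set.Ioo_subset_Icc_self (hmem e))
  have hex : ∀ p : Fin X.Γ.m × Bool, X.Γ.graph.ends p.1 p.2 = v → ∃ t : ℝ,
      (∃ h, α.toEquiv (X.onEdge p.1 ⟨_, hmem' p.1 p.2⟩) = X.onEdge e ⟨t, h⟩) ∧
        (t = s + r ∨ t = s - r) := by
    intro p hp
    have hd : X.dist (X.onEdge e s) (α.toEquiv (X.onEdge p.1 ⟨_, hmem' p.1 p.2⟩)) = r := by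
      rw [← h, α.isometry]
      refine le_antisymm ?_ (le_dist_vertex hr.le hrρ.le hρ' hp _).1
      rw [← hp]
      exact dist_vertex_le (Set.Ioo_subset_Icc_self (hmem p.1))
    obtain ⟨t, ht, ht'⟩ := exists_onEdge_of_dist_lt (hd.trans_lt hrs) (hd.trans_lt hrs')
    refine ⟨t, ⟨t.2, ht⟩, ?_⟩
    rw [hd] at ht'
    rcases abs_choice ((t : ℝ) - s) with h | h <;> rw [h] at ht'
    · left; linarith
    · right; linarith
  choose! t ht ht' using hex
  have hcard : X.Γ.graph.val v ≤ 2 := by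
    refine le_trans (Finset.card_le_card_of_injOn (t := {(s : ℝ) + r, (s : ℝ) - r})
      t ?_ ?_) Finset.card_le_two
    · intro p hp
      simpa using ht' p (by simpa using hp)
    · intro p hp q hq hpq
      have hp' : X.Γ.graph.ends p.1 p.2 = v := by simpa using hp
      have hq' : X.Γ.graph.ends q.1 q.2 = v := by simpa using hq
      obtain ⟨h1, h1'⟩ := ht p hp'
      obtain ⟨h2, h2'⟩ := ht q hq'
      replace h2 : α.toEquiv (X.onEdge p.1 ⟨_, hmem' p.1 p.2⟩) =
          α.toEquiv (X.onEdge q.1 ⟨_, hmem' q.1 q.2⟩) := by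
        rw [h1', h2']
        congr 2
      obtain ⟨h3, h4⟩ := onEdge_eq_onEdge (twist_mem_Ioo p.2 (hmem p.1)) (α.toEquiv.injective h2)
      obtain ⟨e₁, b₁⟩ := p
      obtain ⟨e₂, b₂⟩ := q
      obtain rfl : e₁ = e₂ := h3
      have := hρ' e₁
      cases b₁ <;> cases b₂ <;> simp only [twist, if_true, Bool.false_eq_true, if_false] at h4
      · rfl
      · linarith
      · linarith
      · rfl
  have := X.Γ.stable v
  rw [hw, if_neg hl] at this
  omega

/-- Interior points of edges are mapped to interior points of edges. -/
theorem exists_onEdge {e : Fin X.Γ.m} {s : Set.Icc 0 (X.len e)} (hs : (s : ℝ) ∈ Set.Ioo 0 (X.len e)) :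
    ∃ (e' : Fin X.Γ.m) (t : Set.Icc 0 (X.len e')), (t : ℝ) ∈ Set.Ioo 0 (X.len e') ∧
      α.toEquiv (X.onEdge e s) = X.onEdge e' t := by
  rcases point_cases (α.toEquiv (X.onEdge e s)) with ⟨v, hv⟩ | h
  · obtain ⟨w, hw⟩ := α.symm.exists_vertex v
    exact (vertex_ne_onEdge w e s hs (by rw [← hw, ← hv]; exact α.toEquiv.symm_apply_apply _)).elim
  · exact h

/-- On the interior of an edge an automorphism is an affine map to another edge. -/
theorem exists_affine (e : Fin X.Γ.m) : ∃ (e' : Fin X.Γ.m) (H : ℝ → ℝ),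
    (∀ u : Set.Icc 0 (X.len e), (u : ℝ) ∈ Set.Ioo 0 (X.len e) → H u ∈ Set.Ioo 0 (X.len e') ∧
      ∀ h, α.toEquiv (X.onEdge e u) = X.onEdge e' ⟨H u, h⟩) ∧
    ∃ c, (∀ u ∈ Set.Ioo 0 (X.len e), H u = c + u) ∨ ∀ u ∈ Set.Ioo 0 (X.len e), H u = c - u := by
  have hex : ∀ u : ℝ, ∃ (e' : Fin X.Γ.m) (t : ℝ), ∀ hu : u ∈ Set.Ioo 0 (X.len e),
      ∃ ht : t ∈ Set.Ioo 0 (X.len e'), α.toEquiv (X.onEdge e ⟨u, Set.Ioo_subset_Icc_self hu⟩) =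
        X.onEdge e' ⟨t, Set.Ioo_subset_Icc_self ht⟩ := by
    intro u
    by_cases hu : u ∈ Set.Ioo 0 (X.len e)
    · obtain ⟨e', t, ht, h⟩ := α.exists_onEdge (s := ⟨u, Set.Ioo_subset_Icc_self hu⟩) hu
      exact ⟨e', t, fun _ => ⟨ht, h⟩⟩
    · exact ⟨e, 0, fun h => (hu h).elim⟩
  choose E H hEH using hex
  -- Close to an interior point, distances are differences of positions. A point near `s` is
  -- therefore mapped to the same edge as `s`, with the difference of positions preserved up to
  -- sign.
  have hloc : ∀ s ∈ Set.Ioo 0 (X.len e), ∃ ρ > 0, ∀ u ∈ Set.Ioo 0 (X.len e), |u - s| < ρ →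
      E u = E s ∧ |H u - H s| = |u - s| := by
    intro s hs
    obtain ⟨ht, h⟩ := hEH s hs
    refine ⟨min (min s (X.len e - s)) (min (H s) (X.len (E s) - H s)), lt_min (lt_min hs.1
      (sub_pos.2 hs.2)) (lt_min ht.1 (sub_pos.2 ht.2)), fun u hu hd => ?_⟩
    simp only [lt_min_iff] at hd
    obtain ⟨hu', h'⟩ := hEH u hu
    have hdist := dist_onEdge_of_lt (e := e) (s := ⟨s, Set.Ioo_subset_Icc_self hs⟩)
      (t := ⟨u, Set.Ioo_subset_Icc_self hu⟩) hd.1.1 hd.1.2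
    rw [← α.isometry, h, h'] at hdist
    obtain ⟨t, ht1, ht2⟩ := exists_onEdge_of_dist_lt (hdist.trans_lt hd.2.1) (hdist.trans_lt hd.2.2)
    obtain ⟨h1, h2⟩ := onEdge_eq_onEdge hu' ht1
    refine ⟨h1, ?_⟩
    rw [hdist] at ht2
    rw [← ht2, ← h2]
  have hL := X.len_pos e
  have hmid : X.len e / 2 ∈ Set.Ioo 0 (X.len e) := ⟨by linarith, by linarith⟩
  have hE : ∀ u ∈ Set.Ioo 0 (X.len e), E u = E (X.len e / 2) := fun u hu =>
    eq_of_locally_eq (fun s hs => by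
      obtain ⟨ρ, hρ, h⟩ := hloc s hs
      exact ⟨ρ, hρ, fun u hu hd => (h u hu hd).1⟩) hu hmid
  refine ⟨E (X.len e / 2), H, fun ⟨u, hu'⟩ hu => ?_, affine_of_local_isometry hL ?_ fun s hs => ?_⟩
  · rw [← hE u hu]
    obtain ⟨ht, h⟩ := hEH u hu
    exact ⟨ht, fun _ => h⟩
  · intro u hu s hs hus
    obtain ⟨hu', h1⟩ := hEH u hu
    obtain ⟨hs', h2⟩ := hEH s hs
    have h3 : α.toEquiv (X.onEdge e ⟨u, Set.Ioo_subset_Icc_self hu⟩) =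
        α.toEquiv (X.onEdge e ⟨s, Set.Ioo_subset_Icc_self hs⟩) := by
      rw [h1, h2]
      have h4 := (hE u hu).trans (hE s hs).symm
      clear h1 h2
      generalize E u = x at *
      subst h4
      congr 2
    exact (onEdge_eq_onEdge hu (α.toEquiv.injective h3)).2
  · obtain ⟨ρ, hρ, h⟩ := hloc s hs
    exact ⟨ρ, hρ, fun u hu hd => (h u hu hd).2⟩

/-- The affine maps given by `α` and its inverse embed the two intervals into each other, so the
lengths are equal; then the additive constant can only be 0 for slope 1 and the length for slope -1.
-/
theorem exists_edge (e : Fin X.Γ.m) : ∃ (e' : Fin X.Γ.m) (b : Bool), X.len e' = X.len e ∧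
    ∀ u : Set.Icc 0 (X.len e), (u : ℝ) ∈ Set.Ioo 0 (X.len e) →
      ∀ h, α.toEquiv (X.onEdge e u) = X.onEdge e' ⟨twist (X.len e) b u, h⟩ := by
  have hbound : ∀ {L L' c : ℝ}, 0 < L → (∀ u ∈ Set.Ioo 0 L, c + u ∈ Set.Ioo 0 L') →
      0 ≤ c ∧ c + L ≤ L' := by
    intro L L' c hL h
    constructor
    · by_contra! hc
      obtain ⟨u, hu, hu'⟩ := exists_between (lt_min hL (neg_pos.2 hc))
      have := (h u ⟨hu, hu'.trans_le (min_le_left _ _)⟩).1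
      have := hu'.trans_le (min_le_right _ _)
      linarith
    · by_contra! hc
      obtain ⟨u, hu, hu'⟩ := exists_between (max_lt hL (sub_lt_iff_lt_add'.2 hc))
      have := (h u ⟨(le_max_left _ _).trans_lt hu, hu'⟩).2
      have := (le_max_right _ _).trans_lt hu
      linarith
  have hbound' : ∀ {L L' c : ℝ}, 0 < L → (∀ u ∈ Set.Ioo 0 L, c - u ∈ Set.Ioo 0 L') →
      L ≤ c ∧ c ≤ L' := by
    intro L L' c hL h
    have := hbound (c := c - L) (L' := L') hL fun u hu => by
      have := h (L - u) ⟨by linarith [hu.2], by linarith [hu.1]⟩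
      rwa [show c - L + u = c - (L - u) by ring]
    constructor <;> linarith
  have hle : ∀ {e e' : Fin X.Γ.m} {H : ℝ → ℝ}, (∀ u : Set.Icc 0 (X.len e),
      (u : ℝ) ∈ Set.Ioo 0 (X.len e) → H u ∈ Set.Ioo 0 (X.len e')) → ∀ c,
      ((∀ u ∈ Set.Ioo 0 (X.len e), H u = c + u) → 0 ≤ c ∧ c + X.len e ≤ X.len e') ∧
      ((∀ u ∈ Set.Ioo 0 (X.len e), H u = c - u) → X.len e ≤ c ∧ c ≤ X.len e') := by
    intro e e' H hH c
    refine ⟨fun h => hbound (X.len_pos e) fun u hu => ?_, fun h => hbound' (X.len_pos e) fun u hu => ?_⟩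
    · rw [← h u hu]
      exact hH ⟨u, Set.Ioo_subset_Icc_self hu⟩ hu
    · rw [← h u hu]
      exact hH ⟨u, Set.Ioo_subset_Icc_self hu⟩ hu
  obtain ⟨e', H, hH, c, hc⟩ := α.exists_affine e
  obtain ⟨e'', H', hH', c', hc'⟩ := α.symm.exists_affine e'
  have hL := X.len_pos e
  have hmid : X.len e / 2 ∈ Set.Ioo 0 (X.len e) := ⟨by linarith, by linarith⟩
  obtain rfl : e'' = e := by
    obtain ⟨h1, h2⟩ := hH ⟨_, Set.Ioo_subset_Icc_self hmid⟩ hmid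
    obtain ⟨h3, h4⟩ := hH' ⟨_, Set.Ioo_subset_Icc_self h1⟩ h1
    have h5 : α.symm.toEquiv (α.toEquiv (X.onEdge e ⟨_, Set.Ioo_subset_Icc_self hmid⟩)) =
      X.onEdge e ⟨_, Set.Ioo_subset_Icc_self hmid⟩ := α.toEquiv.symm_apply_apply _
    rw [h2 (Set.Ioo_subset_Icc_self h1), h4 (Set.Ioo_subset_Icc_self h3)] at h5
    exact (onEdge_eq_onEdge h3 h5).1
  have h1 := hle (fun u hu => (hH u hu).1) c
  have h2 := hle (fun u hu => (hH' u hu).1) c'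
  have h3 : X.len e' ≤ X.len e'' := by
    rcases hc' with h | h
    · have := h2.1 h; linarith
    · have := h2.2 h; linarith
  have h4 : X.len e'' ≤ X.len e' := by
    rcases hc with h | h
    · have := h1.1 h; linarith
    · have := h1.2 h; linarith
  refine ⟨e', if ∀ u ∈ Set.Ioo 0 (X.len e''), H u = c + u then false else true, le_antisymm h3 h4,
    fun u hu h => ?_⟩
  have h5 := (hH u hu).2 (Set.Ioo_subset_Icc_self (hH u hu).1)
  rw [h5]
  congr 2
  split_ifs with h6
  · have := h1.1 h6
    rw [h6 u hu]
    simp only [twist, Bool.false_eq_true, if_false]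
    linarith
  · have h7 := hc.resolve_left h6
    have := h1.2 h7
    rw [h7 u hu]
    simp only [twist, if_true]
    linarith

end Aut

end StableCurve

end TropJac

end

noncomputable section

namespace TropJac

open scoped Classical

open Multigraph

namespace StableCurve

variable {g : ℕ}

/-! ### Isomorphisms of tropical curves -/

/-- Isomorphisms of the stable models which preserve the edge lengths. -/
structure Iso (X Y : StableCurve g) where
  vf : Fin X.Γ.n ≃ Fin Y.Γ.n
  ef : Fin X.Γ.m ≃ Fin Y.Γ.m
  fl : Fin X.Γ.m → Bool
  ends_eq : ∀ e b, Y.Γ.graph.ends (ef e) (xor b (fl e)) = vf (X.Γ.graph.ends e b)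
  len_eq : ∀ e, Y.len (ef e) = X.len e
  map_leg : vf X.Γ.leg = Y.Γ.leg
  map_weight : ∀ v, Y.Γ.weight (vf v) = X.Γ.weight v

namespace Iso

variable {X Y : StableCurve g}

/-- The inverse isomorphism. -/
def symm (i : Iso X Y) : Iso Y X where
  vf := i.vf.symm
  ef := i.ef.symm
  fl e := i.fl (i.ef.symm e)
  ends_eq e b := by
    rw [Equiv.eq_symm_apply, ← i.ends_eq, Equiv.apply_symm_apply, Bool.xor_assoc, Bool.xor_self,
      Bool.xor_false]
  len_eq e := by rw [← i.len_eq, Equiv.apply_symm_apply]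
  map_leg := by rw [Equiv.symm_apply_eq, i.map_leg]
  map_weight v := by rw [← i.map_weight, Equiv.apply_symm_apply]

/-- The map on the points of the curves. -/
def map (i : Iso X Y) : X.Point → Y.Point :=
  -- The projection to the interval only makes the formula total; by `map_onEdge` it has no effect
  -- on actual points.
  X.glue (fun v => Y.vertex (i.vf v)) (fun e t => Y.onEdge (i.ef e)
    (Set.projIcc 0 _ (Y.len_pos _).le (twist (X.len e) (i.fl e) t)))
    (fun e => by
      have h : twist (Y.len (i.ef e)) (i.fl e) 0 ∈ Set.Icc 0 (Y.len (i.ef e)) :=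
        twist_mem_Icc _ ⟨le_rfl, (Y.len_pos _).le⟩
      rw [← i.len_eq, Set.projIcc_of_mem _ h, onEdge_twist_zero h, ← i.ends_eq, Bool.false_xor])
    (fun e => by
      have h : twist (Y.len (i.ef e)) (!i.fl e) 0 ∈ Set.Icc 0 (Y.len (i.ef e)) :=
        twist_mem_Icc _ ⟨le_rfl, (Y.len_pos _).le⟩
      have h1 : twist (Y.len (i.ef e)) (i.fl e) (Y.len (i.ef e)) =
          twist (Y.len (i.ef e)) (!i.fl e) 0 := by
        cases i.fl e <;> simp [twist]
      rw [← i.len_eq, h1, Set.projIcc_of_mem _ h, onEdge_twist_zero h, ← i.ends_eq, Bool.true_xor])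

theorem map_vertex (i : Iso X Y) (v : Fin X.Γ.n) : i.map (X.vertex v) = Y.vertex (i.vf v) := rfl

theorem map_onEdge (i : Iso X Y) {e : Fin X.Γ.m} {e' : Fin Y.Γ.m} (he : i.ef e = e')
    (a : Set.Icc 0 (X.len e)) (h : twist (X.len e) (i.fl e) a ∈ Set.Icc 0 (Y.len e')) :
    i.map (X.onEdge e a) = Y.onEdge e' ⟨twist (X.len e) (i.fl e) a, h⟩ := by
  subst he
  change Y.onEdge (i.ef e) (Set.projIcc 0 _ _ _) = _
  rw [Set.projIcc_of_mem _ h]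

theorem twist_mem (i : Iso X Y) {e : Fin X.Γ.m} {e' : Fin Y.Γ.m} (he : i.ef e = e') (b : Bool)
    (a : Set.Icc 0 (X.len e)) : twist (X.len e) b a ∈ Set.Icc 0 (Y.len e') := by
  rw [← he, i.len_eq]
  exact twist_mem_Icc _ a.2

theorem symm_map_map (i : Iso X Y) (p : X.Point) : i.symm.map (i.map p) = p := by
  rcases point_cases p with ⟨v, rfl⟩ | ⟨e, a, -, rfl⟩
  · rw [map_vertex, map_vertex]
    exact congrArg X.vertex (i.vf.symm_apply_apply v)
  · rw [i.map_onEdge rfl a (i.twist_mem rfl _ a)]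
    have h1 : i.symm.ef (i.ef e) = e := i.ef.symm_apply_apply e
    have h2 : twist (Y.len (i.ef e)) (i.symm.fl (i.ef e)) (twist (X.len e) (i.fl e) a) = a := by
      change twist _ (i.fl (i.ef.symm (i.ef e))) _ = _
      rw [i.ef.symm_apply_apply, i.len_eq, twist_twist, Bool.xor_self]
      rfl
    rw [i.symm.map_onEdge h1 _ (by rw [h2]; exact a.2)]
    congr 1
    exact Subtype.ext h2

theorem map_injective (i : Iso X Y) : Function.Injective i.map :=
  Function.LeftInverse.injective i.symm_map_map

theorem map_symm_map (i : Iso X Y) (p : Y.Point) : i.map (i.symm.map p) = p :=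
  i.symm.map_injective (i.symm_map_map _)

theorem pathLength_map (i : Iso X Y) {p q : X.Point} {L : ℝ} (h : X.PathLength p q L) :
    Y.PathLength (i.map p) (i.map q) L := by
  induction h with
  | refl => exact .refl _
  | step e a b L _ ih =>
    rw [i.map_onEdge rfl a (i.twist_mem rfl _ a)] at ih
    rw [i.map_onEdge rfl b (i.twist_mem rfl _ b)]
    have := PathLength.step _ _ _ ⟨twist (X.len e) (i.fl e) b, i.twist_mem rfl _ b⟩ L ih
    simp only at this
    rwa [abs_twist_sub] at this

theorem dist_map (i : Iso X Y) (p q : X.Point) : Y.dist (i.map p) (i.map q) = X.dist p q := by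
  refine congrArg sInf (Set.ext fun L => ⟨fun h => ?_, fun h => i.pathLength_map h⟩)
  have := i.symm.pathLength_map (show Y.PathLength (i.map p) (i.map q) L from h)
  rwa [symm_map_map, symm_map_map] at this

theorem weight_map (i : Iso X Y) (p : X.Point) : Y.weight (i.map p) = X.weight p := by
  by_cases h : ∃ v, p = X.vertex v
  · obtain ⟨v, rfl⟩ := h
    rw [map_vertex, weight_vertex, weight_vertex, i.map_weight]
  · have h1 : X.weight p = 0 := by_contra fun h1 => h (exists_vertex_of_weight h1)
    rw [h1]
    by_contra h2
    obtain ⟨w, hw⟩ := exists_vertex_of_weight h2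
    refine h ⟨i.vf.symm w, ?_⟩
    rw [← i.symm_map_map p, hw]
    rfl

/-- An isomorphism of a curve to itself is an automorphism. -/
def toAut (i : Iso X X) : X.Aut where
  toEquiv := ⟨i.map, i.symm.map, i.symm_map_map, i.map_symm_map⟩
  isometry := i.dist_map
  map_mark := (i.map_vertex _).trans (congrArg X.vertex i.map_leg)
  map_weight := i.weight_map

/-- The specialization given by an isomorphism. -/
def hom (i : Iso X Y) : StableGraph.Hom X.Γ Y.Γ :=
  StableGraph.Hom.ofIsWeighted (Specialization.ofSection i.vf i.ef.symm (fun e => i.fl (i.ef.symm e))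
    i.vf.symm i.ef.symm.injective (fun e b => by
      rw [← i.ends_eq, Equiv.apply_symm_apply])
    (fun e he => (he (i.ef.symm.surjective e)).elim) i.vf.apply_symm_apply
    (fun v => by rw [i.vf.symm_apply_apply]; exact Reach.refl _)) i.map_leg
    ((Specialization.isWeighted_iff_of_surjective _ i.ef.symm.surjective _ _).2 i.map_weight)

/-- The isomorphism given by an invertible specialization. -/
def ofHom (ι : StableGraph.Hom X.Γ Y.Γ) (hι : Function.Surjective ι.emap)
    (hlen : ∀ e, X.len (ι.emap e) = Y.len e) : Iso X Y where
  vf := Equiv.ofBijective ι.vmap ⟨ι.vmap_injective hι, ι.vmap_surjective⟩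
  ef := (Equiv.ofBijective ι.emap ⟨ι.emap_injective, hι⟩).symm
  fl e := ι.flip ((Equiv.ofBijective ι.emap ⟨ι.emap_injective, hι⟩).symm e)
  ends_eq e b := by
    obtain ⟨e, rfl⟩ := hι e
    have h : (Equiv.ofBijective ι.emap ⟨ι.emap_injective, hι⟩).symm (ι.emap e) = e :=
      (Equiv.ofBijective ι.emap ⟨ι.emap_injective, hι⟩).symm_apply_apply e
    rw [h]
    exact (ι.vmap_ends e b).symm
  len_eq e := by
    obtain ⟨e, rfl⟩ := hι e
    have h : (Equiv.ofBijective ι.emap ⟨ι.emap_injective, hι⟩).symm (ι.emap e) = e :=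
      (Equiv.ofBijective ι.emap ⟨ι.emap_injective, hι⟩).symm_apply_apply e
    rw [h, hlen]
  map_leg := ι.map_leg
  map_weight := (Specialization.isWeighted_iff_of_surjective _ hι _ _).1 ι.isWeighted

/-- The isomorphism `i` induces the specialization `ι` of the graphs. -/
structure Induces (i : Iso X Y) (ι : Specialization X.Γ.graph Y.Γ.graph) : Prop where
  vmap : ∀ v, ι.vmap v = i.vf v
  emap : ∀ e, i.ef (ι.emap e) = e
  flip : ∀ e, i.fl (ι.emap e) = ι.flip e

theorem induces_hom (i : Iso X Y) : i.Induces i.hom.toSpecialization where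
  vmap _ := rfl
  emap e := i.ef.apply_symm_apply e
  flip _ := rfl

theorem induces_ofHom (ι : StableGraph.Hom X.Γ Y.Γ) (hι : Function.Surjective ι.emap)
    (hlen : ∀ e, X.len (ι.emap e) = Y.len e) : (ofHom ι hι hlen).Induces ι.toSpecialization where
  vmap _ := rfl
  emap e := (Equiv.ofBijective ι.emap ⟨ι.emap_injective, hι⟩).symm_apply_apply e
  flip e := congrArg ι.flip
    ((Equiv.ofBijective ι.emap ⟨ι.emap_injective, hι⟩).symm_apply_apply e)

/-- The identity. -/
def refl (X : StableCurve g) : Iso X X :=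
  ⟨.refl _, .refl _, fun _ => false, fun _ _ => by simp, fun _ => rfl, rfl, fun _ => rfl⟩

theorem induces_refl : (refl X).Induces (Specialization.id X.Γ.graph) :=
  ⟨fun _ => rfl, fun _ => rfl, fun _ => rfl⟩

theorem refl_map (p : X.Point) : (refl X).map p = p := by
  rcases point_cases p with ⟨v, rfl⟩ | ⟨e, a, -, rfl⟩
  · rfl
  · exact (refl X).map_onEdge rfl a a.2

/-- The composition of isomorphisms. -/
def trans {Z : StableCurve g} (i : Iso X Y) (j : Iso Y Z) : Iso X Z where
  vf := i.vf.trans j.vf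
  ef := i.ef.trans j.ef
  fl e := xor (i.fl e) (j.fl (i.ef e))
  ends_eq e b := by
    rw [Equiv.trans_apply, ← Bool.xor_assoc, j.ends_eq, i.ends_eq, Equiv.trans_apply]
  len_eq e := by rw [Equiv.trans_apply, j.len_eq, i.len_eq]
  map_leg := by rw [Equiv.trans_apply, i.map_leg, j.map_leg]
  map_weight v := by rw [Equiv.trans_apply, j.map_weight, i.map_weight]

theorem trans_map {Z : StableCurve g} (i : Iso X Y) (j : Iso Y Z) (p : X.Point) :
    (i.trans j).map p = j.map (i.map p) := by
  rcases point_cases p with ⟨v, rfl⟩ | ⟨e, a, -, rfl⟩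
  · rfl
  · have h : twist (X.len e) ((i.trans j).fl e) a =
        twist (Y.len (i.ef e)) (j.fl (i.ef e)) (twist (X.len e) (i.fl e) a) := by
      rw [i.len_eq, twist_twist, Bool.xor_comm]
      rfl
    rw [i.map_onEdge rfl a (i.twist_mem rfl _ a), j.map_onEdge rfl _ (j.twist_mem rfl _ _),
      (i.trans j).map_onEdge rfl a ((i.trans j).twist_mem rfl _ a)]
    exact congrArg _ (Subtype.ext h)

end Iso

/-- Automorphisms of a curve come from automorphisms of the stable model. -/
theorem Aut.exists_iso {X : StableCurve g} (α : X.Aut) : ∃ i : Iso X X, ∀ p, i.map p = α.toEquiv p := by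
  choose vf hvf using α.exists_vertex
  choose ef fl hlen hef using α.exists_edge
  have hvinj : Function.Injective vf := fun v w h => by
    have := (hvf v).trans (h ▸ (hvf w).symm)
    exact vertex_injective (α.toEquiv.injective this)
  -- Midpoints of edges go to midpoints, whatever the orientation, so edges with the same image
  -- share their midpoint.
  have heinj : Function.Injective ef := fun e e' h => by
    have hmid : ∀ e, X.len e / 2 ∈ Set.Ioo 0 (X.len e) := fun e => by
      have := X.len_pos e
      exact ⟨by linarith, by linarith⟩
    have hhalf : ∀ e, ∀ h, α.toEquiv (X.onEdge e ⟨_, Set.Ioo_subset_Icc_self (hmid e)⟩) =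
        X.onEdge (ef e) ⟨X.len (ef e) / 2, h⟩ := fun e h => by
      have h1 : twist (X.len e) (fl e) (X.len e / 2) = X.len (ef e) / 2 := by
        rw [hlen]
        cases fl e <;> simp [twist, sub_half]
      rw [hef e ⟨_, Set.Ioo_subset_Icc_self (hmid e)⟩ (hmid e) (by rw [h1]; exact h)]
      exact congrArg _ (Subtype.ext h1)
    have h1 := hhalf e (Set.Ioo_subset_Icc_self (hmid _))
    have h2 := hhalf e' (Set.Ioo_subset_Icc_self (hmid _))
    rw [← h] at h2
    exact (onEdge_eq_onEdge (hmid e) (α.toEquiv.injective (h1.trans h2.symm))).1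
  have hmem : ∀ e b (a : Set.Icc 0 (X.len e)), twist (X.len e) b a ∈ Set.Icc 0 (X.len (ef e)) :=
    fun e b a => by rw [hlen]; exact twist_mem_Icc _ a.2
  have hends : ∀ e b, X.Γ.graph.ends (ef e) (xor b (fl e)) = vf (X.Γ.graph.ends e b) := by
    intro e b
    -- A point at distance at most ρ/3 from the end `b` of `e` has its image equally close to the
    -- image of that end. This image lies near an end of `ef e`, at distance at least 2ρ/3 from
    -- every other vertex.
    by_contra hne
    obtain ⟨ρ, hρ, hρ'⟩ := X.exists_radius
    have hr : ρ / 3 ∈ Set.Ioo 0 (X.len e) := ⟨by positivity, by linarith [hρ' e]⟩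
    have hr' : ρ / 3 ∈ Set.Icc 0 (X.len (ef e)) := by
      rw [hlen]
      exact Set.Ioo_subset_Icc_self hr
    have h1 := (le_dist_vertex (e := ef e) (b := xor b (fl e)) hr.1.le (by linarith) hρ' rfl
      (twist_mem_Icc _ hr')).2 _ (Ne.symm hne)
    have h2 := dist_vertex_le (b := b) (Set.Ioo_subset_Icc_self hr)
    have h3 : twist (X.len e) (fl e) (twist (X.len e) b (ρ / 3)) =
        twist (X.len (ef e)) (xor b (fl e)) (ρ / 3) := by
      rw [twist_twist, hlen, Bool.xor_comm]
    rw [← α.isometry, hvf, hef e ⟨_, twist_mem_Icc b (Set.Ioo_subset_Icc_self hr)⟩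
      (twist_mem_Ioo b hr) (hmem e _ ⟨_, twist_mem_Icc b (Set.Ioo_subset_Icc_self hr)⟩)] at h2
    simp only [h3] at h2
    linarith
  let i : Iso X X :=
    { vf := Equiv.ofBijective vf (Finite.injective_iff_bijective.1 hvinj)
      ef := Equiv.ofBijective ef (Finite.injective_iff_bijective.1 heinj)
      fl := fl
      ends_eq := hends
      len_eq := hlen
      map_leg := vertex_injective ((hvf _).symm.trans α.map_mark)
      map_weight := fun v => by
        rw [Equiv.ofBijective_apply, ← weight_vertex, ← hvf, α.map_weight, weight_vertex] }
  refine ⟨i, fun p => ?_⟩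
  rcases point_cases p with ⟨v, rfl⟩ | ⟨e, a, ha, rfl⟩
  · exact (hvf v).symm
  · rw [i.map_onEdge rfl a (i.twist_mem rfl _ a)]
    exact (hef e a ha _).symm

end StableCurve

/-! ### Specializations of pseudo-divisors on edges -/

namespace QD

variable {V E V' E' : Type} [Fintype V] [Fintype E] [DecidableEq E] [Fintype V']
  [Fintype E'] [DecidableEq E'] {G : Multigraph V E} {H : Multigraph V' E'} {v₀ : V} {v₀' : V'}
  {μ : V → ℝ} {μ' : V' → ℝ} {d : ℤ} {ι : Specialization G H} {P : QD G v₀ μ d} {Q : QD H v₀' μ' d}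

/-- Compatibility with `ι` places the image over the right edge; which half it is follows from the
ends, since an exceptional vertex is not the image of a vertex of the graph. -/
theorem HomOver.emap_inr (τ : HomOver ι P Q) {e : E'} (he : e ∈ Q.S) (k : Bool) :
    τ.emap (.inr (⟨e, he⟩, k)) = .inr (⟨ι.emap e, τ.subset e he⟩, xor k (ι.flip e)) ∧
      τ.vmap (.inr ⟨ι.emap e, τ.subset e he⟩) = .inr ⟨e, he⟩ := by
  have h1 := τ.overEdge_emap (.inr (⟨e, he⟩, k))
  have h2 := τ.vmap_ends (.inr (⟨e, he⟩, k))
  rw [τ.flip_eq] at h2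
  rcases h3 : τ.emap (.inr (⟨e, he⟩, k)) with x | ⟨x, l⟩
  · rw [h3] at h1
    exact (x.2 (by rw [show (x : E) = ι.emap e from h1]; exact τ.subset e he)).elim
  · rw [h3] at h1 h2
    obtain rfl : x = ⟨ι.emap e, τ.subset e he⟩ := Subtype.ext h1
    have h4 : xor l (ι.flip e) = k := by
      have := h2 l
      simp only [subdiv, if_true, τ.vmap_inl, overEdge] at this
      by_contra hne
      rw [if_neg hne] at this
      simp at this
    refine ⟨?_, ?_⟩
    · rw [← h4, Bool.xor_assoc, Bool.xor_self, Bool.xor_false]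
    · have := h2 !l
      simp only [subdiv, overEdge, Bool.not_eq_eq_eq_not, Bool.eq_not_self, if_false] at this
      rw [this, if_neg]
      rw [← h4]
      cases l <;> cases ι.flip e <;> simp

/-- Exactly one half `k` of the subdivided edge survives, and the exceptional vertex moves to the
opposite end `!k`. -/
theorem HomOver.emap_inl (τ : HomOver ι P Q) {e : E'} (he : e ∉ Q.S) (he' : ι.emap e ∈ P.S) :
    ∃ k, τ.emap (.inl ⟨e, he⟩) = .inr (⟨ι.emap e, he'⟩, k) ∧
      τ.vmap (.inr ⟨ι.emap e, he'⟩) = .inl (ι.vmap (G.ends (ι.emap e) !k)) := by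
  have h1 := τ.overEdge_emap (.inl ⟨e, he⟩)
  have h2 := τ.vmap_ends (.inl ⟨e, he⟩)
  rw [τ.flip_eq] at h2
  rcases h3 : τ.emap (.inl ⟨e, he⟩) with x | ⟨x, l⟩
  · rw [h3] at h1
    exact (x.2 (by rw [show (x : E) = ι.emap e from h1]; exact he')).elim
  · rw [h3] at h1 h2
    obtain rfl : x = ⟨ι.emap e, he'⟩ := Subtype.ext h1
    refine ⟨l, rfl, ?_⟩
    have := h2 !l
    simp only [subdiv, overEdge, Bool.not_eq_eq_eq_not, Bool.eq_not_self, if_false] at this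
    rw [this, ι.vmap_ends]

theorem HomOver.emap_inl_of_notMem (τ : HomOver ι P Q) {e : E'} (he : e ∉ Q.S)
    (he' : ι.emap e ∉ P.S) : τ.emap (.inl ⟨e, he⟩) = .inl ⟨ι.emap e, he'⟩ := by
  have h1 := τ.overEdge_emap (.inl ⟨e, he⟩)
  rcases h3 : τ.emap (.inl ⟨e, he⟩) with x | ⟨x, l⟩
  · rw [h3] at h1
    exact congrArg _ (Subtype.ext h1)
  · rw [h3] at h1
    exact (he' (by rw [← show (x : E) = ι.emap e from h1]; exact x.2)).elim

end QD

end TropJac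

end

noncomputable section

namespace TropJac

open scoped Classical

open Multigraph

theorem totalLength_apply_of_mem {E : Type} [Fintype E] [DecidableEq E] {S : Finset E}
    (x : orthant (SubEdge S)) {e : E} (he : e ∈ S) :
    (totalLength S x).1 e = x.1 (.inr (⟨e, he⟩, false)) + x.1 (.inr (⟨e, he⟩, true)) := by
  have h : (Finset.univ.filter fun f => overEdge S f = e) =
      {.inr (⟨e, he⟩, false), .inr (⟨e, he⟩, true)} := by
    ext f
    rcases f with f | ⟨f, k⟩
    · exact iff_of_false (fun h => f.2 (by
        rw [show (f : E) = e from (Finset.mem_filter.1 h).2]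
        exact he)) (by simp)
    · rw [Finset.mem_filter]
      cases k <;> simp [overEdge, Subtype.ext_iff]
  change ∑ f with overEdge S f = e, x.1 f = _
  rw [h, Finset.sum_pair (by simp)]

theorem totalLength_apply_of_notMem {E : Type} [Fintype E] [DecidableEq E] {S : Finset E}
    (x : orthant (SubEdge S)) {e : E} (he : e ∉ S) :
    (totalLength S x).1 e = x.1 (.inl ⟨e, he⟩) := by
  have h : (Finset.univ.filter fun f => overEdge S f = e) = {.inl ⟨e, he⟩} := by
    ext f
    rcases f with f | ⟨f, k⟩
    · rw [Finset.mem_filter]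
      simp [overEdge, Subtype.ext_iff]
    · exact iff_of_false (fun h => he ((Finset.mem_filter.1 h).2 ▸ f.2)) (by simp)
  change ∑ f with overEdge S f = e, x.1 f = _
  rw [h, Finset.sum_singleton]

namespace StableCurve

variable {g : ℕ} {d : ℤ} {μ : UniversalPolarization g d} {X Y : StableCurve g}

/-! ### The divisor of a point of the Jacobian -/

/-- The lengths of the edges of the subdivision of a curve given by a point of a polyhedron. -/
def coords (P : X.Cell μ) (x : X.Polyhedron P) : orthant (SubEdge P.S) :=
  ⟨Sum.elim (fun e => X.len e) fun p => twist (X.len p.1) p.2 (x p.1), by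
    rintro (e | ⟨e, k⟩)
    · exact (X.len_pos e).le
    · exact (twist_mem_Icc k (x e).2).1⟩

theorem coords_inl (P : X.Cell μ) (x : X.Polyhedron P) (e : {e // e ∉ P.S}) :
    (coords P x).1 (.inl e) = X.len e := rfl

theorem coords_inr (P : X.Cell μ) (x : X.Polyhedron P) (e : {e // e ∈ P.S}) (k : Bool) :
    (coords P x).1 (.inr (e, k)) = twist (X.len e) k (x e) := rfl

theorem totalLength_coords (P : X.Cell μ) (x : X.Polyhedron P) :
    totalLength P.S (coords P x) = ⟨X.len, fun e => (X.len_pos e).le⟩ := by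
  apply Subtype.ext
  funext e
  by_cases he : e ∈ P.S
  · rw [totalLength_apply_of_mem _ he, coords_inr, coords_inr]
    simp [twist]
  · rw [totalLength_apply_of_notMem _ he, coords_inl]

theorem exists_coords (P : X.Cell μ) (z : orthant (SubEdge P.S))
    (hz : ∀ e, (totalLength P.S z).1 e = X.len e) : ∃ x, coords P x = z := by
  have h : ∀ e : {e // e ∈ P.S}, z.1 (.inr (e, false)) + z.1 (.inr (e, true)) = X.len e := fun e => by
    rw [← hz, totalLength_apply_of_mem _ e.2]
  refine ⟨fun e => ⟨z.1 (.inr (e, false)), z.2 _, ?_⟩, Subtype.ext (funext ?_)⟩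
  · have := z.2 (.inr (e, true))
    linarith [h e]
  · rintro (e | ⟨e, k⟩)
    · rw [coords_inl, ← hz, totalLength_apply_of_notMem _ e.2]
    · rw [coords_inr]
      have := h e
      cases k
      · rfl
      · simp only [twist, if_true]
        linarith

/-- The points of the curve which correspond to the vertices of the subdivision. -/
def position (z : Σ P : X.Cell μ, X.Polyhedron P) : SubVertex (Fin X.Γ.n) z.1.S → X.Point :=
  Sum.elim X.vertex fun e => X.onEdge e (z.2 e)

theorem divisor_eq (z : Σ P : X.Cell μ, X.Polyhedron P) (p : X.Point) :
    X.divisor z p = ∑ s with position z s = p, z.1.D s := by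
  rw [Finset.sum_filter, Fintype.sum_sum_type, ← Finset.sum_filter, ← Finset.sum_filter]
  rfl

variable {z : Σ P : X.Cell μ, X.Polyhedron P} {y : Σ P : Y.Cell μ, Y.Polyhedron P}

/-- The positions are preserved by specializations which preserve the lengths. -/
theorem position_vmap {i : Iso X Y} {ι : Specialization X.Γ.graph Y.Γ.graph} (hi : i.Induces ι)
    (τ : QD.HomOver ι z.1 y.1) (hτ : extendByZero τ.emap (coords y.1 y.2) = coords z.1 z.2)
    (s : SubVertex (Fin X.Γ.n) z.1.S) : position y (τ.vmap s) = i.map (position z s) := by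
  have hc := ((extendByZero_eq_iff τ.emap_injective _ _).1 hτ).1
  rcases s with v | ⟨e, he⟩
  · rw [τ.vmap_inl, hi.vmap]
    rfl
  obtain ⟨e, rfl⟩ : ∃ e', ι.emap e' = e := ⟨i.ef e, i.ef.injective (hi.emap _)⟩
  change _ = i.map (X.onEdge (ι.emap e) (z.2 ⟨_, he⟩))
  rw [i.map_onEdge (hi.emap e) _ (i.twist_mem (hi.emap e) _ _)]
  by_cases he' : e ∈ y.1.S
  · obtain ⟨h1, h2⟩ := τ.emap_inr he' false
    rw [h2]
    have h3 := hc (.inr (⟨e, he'⟩, false))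
    rw [h1, coords_inr, coords_inr, Bool.false_xor, ← hi.flip] at h3
    exact congrArg (Y.onEdge e) (Subtype.ext h3.symm)
  · obtain ⟨k, h1, h2⟩ := τ.emap_inl he' he
    rw [h2]
    -- The surviving half `k` carries the whole length of the edge, so the exceptional vertex is
    -- positioned at the end `!k`.
    have h3 := hc (.inl ⟨e, he'⟩)
    rw [h1, coords_inr, coords_inl] at h3
    have h4 : X.len (ι.emap e) = Y.len e := by
      rw [← i.len_eq, hi.emap]
    have h5 : twist (X.len (ι.emap e)) (!k) 0 ∈ Set.Icc 0 (X.len (ι.emap e)) :=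
      twist_mem_Icc _ ⟨le_rfl, (X.len_pos _).le⟩
    have h6 : ((z.2 ⟨ι.emap e, he⟩ : Set.Icc 0 (X.len (ι.emap e))) : ℝ) =
        twist (X.len (ι.emap e)) (!k) 0 := by
      change twist (X.len (ι.emap e)) k _ = Y.len e at h3
      cases k
      · simpa [twist, h4] using h3
      · simp only [twist, if_true, h4] at h3
        simp only [twist, Bool.not_true, Bool.false_eq_true, if_false]
        linarith
    change Y.vertex _ = _
    rw [hi.vmap, ← i.map_vertex, ← onEdge_twist_zero h5, i.map_onEdge (hi.emap e) _
      (i.twist_mem (hi.emap e) _ _)]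
    exact congrArg (Y.onEdge e) (Subtype.ext (congrArg (twist (X.len (ι.emap e)) _) h6.symm))

/-- The divisor is preserved by specializations which preserve the lengths. -/
theorem divisor_map {i : Iso X Y} {ι : Specialization X.Γ.graph Y.Γ.graph} (hi : i.Induces ι)
    (τ : QD.HomOver ι z.1 y.1) (hτ : extendByZero τ.emap (coords y.1 y.2) = coords z.1 z.2)
    (p : X.Point) : Y.divisor y (i.map p) = X.divisor z p := by
  rw [divisor_eq, divisor_eq]
  have h1 : ∀ s', y.1.D s' = ∑ s with τ.vmap s = s', z.1.D s := fun s' => by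
    rw [τ.map_divisor]
    exact Finset.sum_congr (Finset.ext fun s => by simp) fun _ _ => rfl
  simp only [h1]
  rw [Finset.sum_filter]
  have h2 : ∀ s', (if position y s' = i.map p then ∑ s with τ.vmap s = s', z.1.D s else 0) =
      ∑ s, if τ.vmap s = s' then (if position z s = p then z.1.D s else 0) else 0 := by
    intro s'
    rw [Finset.sum_filter]
    split_ifs with h
    · refine Finset.sum_congr rfl fun s _ => ?_
      split_ifs with h3 h4
      · rfl
      · rw [← h3, position_vmap hi τ hτ] at h
        exact (h4 (i.map_injective h)).elim
      · rfl
    · rw [Finset.sum_eq_zero]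
      intro s _
      split_ifs with h3 h4
      · refine (h ?_).elim
        rw [← h3, position_vmap hi τ hτ, h4]
      · rfl
      · rfl
  simp only [h2]
  rw [Finset.sum_comm, Finset.sum_filter]
  refine Finset.sum_congr rfl fun s _ => ?_
  rw [Finset.sum_ite_eq, if_pos (Finset.mem_univ _)]

/-- The exceptional vertices lie in the interior of the edges. -/
def IsInterior (z : Σ P : X.Cell μ, X.Polyhedron P) : Prop :=
  ∀ e : {e // e ∈ z.1.S}, ((z.2 e : Set.Icc 0 (X.len e)) : ℝ) ∈ Set.Ioo 0 (X.len e)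

theorem IsInterior.divisor_vertex (hz : IsInterior z) (v : Fin X.Γ.n) :
    X.divisor z (X.vertex v) = z.1.D (.inl v) := by
  rw [divisor, Finset.sum_filter, Finset.sum_eq_single v, if_pos rfl, Finset.sum_filter,
    Finset.sum_eq_zero, add_zero]
  · intro e _
    exact if_neg fun h => vertex_ne_onEdge v _ _ (hz e) h.symm
  · intro w _ hw
    exact if_neg fun h => hw (vertex_injective h)
  · simp

theorem IsInterior.divisor_onEdge (hz : IsInterior z) (e : {e // e ∈ z.1.S}) :
    X.divisor z (X.onEdge e (z.2 e)) = -1 := by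
  rw [divisor, Finset.sum_filter, Finset.sum_eq_zero, Finset.sum_filter, Finset.sum_eq_single e,
    if_pos rfl, z.1.exceptional, zero_add]
  · intro e' _ he'
    exact if_neg fun h => he' (Subtype.ext (onEdge_eq_onEdge (hz e') h).1)
  · simp
  · intro v _
    exact if_neg fun h => vertex_ne_onEdge v _ _ (hz e) h

theorem IsInterior.exists_of_divisor_ne_zero (hz : IsInterior z) {e : Fin X.Γ.m}
    {t : Set.Icc 0 (X.len e)} (ht : (t : ℝ) ∈ Set.Ioo 0 (X.len e))
    (h : X.divisor z (X.onEdge e t) ≠ 0) : ∃ he : e ∈ z.1.S, z.2 ⟨e, he⟩ = t := by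
  by_contra hne
  refine h ?_
  rw [divisor, Finset.sum_filter, Finset.sum_eq_zero, Finset.sum_filter, Finset.sum_eq_zero, add_zero]
  · intro e' _
    refine if_neg fun h' => hne ?_
    obtain ⟨h1, h2⟩ := onEdge_eq_onEdge (hz e') h'
    obtain ⟨e', he'⟩ := e'
    obtain rfl : e' = e := h1
    exact ⟨he', Subtype.ext h2⟩
  · intro v _
    exact if_neg fun h => vertex_ne_onEdge v _ _ ht h

/-- Interior points of the polyhedra are determined by their divisors. -/
theorem IsInterior.eq_of_divisor_eq {z' : Σ P : X.Cell μ, X.Polyhedron P} (hz : IsInterior z)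
    (hz' : IsInterior z') (h : ∀ p, X.divisor z p = X.divisor z' p) : z = z' := by
  have key : ∀ {z z' : Σ P : X.Cell μ, X.Polyhedron P}, IsInterior z → IsInterior z' →
      (∀ p, X.divisor z p = X.divisor z' p) → ∀ e : {e // e ∈ z.1.S},
      ∃ he : (e : Fin X.Γ.m) ∈ z'.1.S, z'.2 ⟨e, he⟩ = z.2 e := by
    intro z z' hz hz' h e
    refine hz'.exists_of_divisor_ne_zero (hz e) ?_
    rw [← h, hz.divisor_onEdge]
    decide
  have hP : z.1 = z'.1 := by
    refine QD.ext' (Finset.ext fun e => ⟨fun he => (key hz hz' h ⟨e, he⟩).1,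
      fun he => (key hz' hz (fun p => (h p).symm) ⟨e, he⟩).1⟩) fun v => ?_
    rw [← hz.divisor_vertex, ← hz'.divisor_vertex, h]
  obtain ⟨P, x⟩ := z
  obtain ⟨P', x'⟩ := z'
  obtain rfl : P = P' := hP
  congr 1
  funext e
  obtain ⟨he, h1⟩ := key hz hz' h e
  exact h1.symm

/-- Every point lies in the interior of a face. -/
theorem exists_isInterior (z : Σ P : X.Cell μ, X.Polyhedron P) :
    ∃ z₀ : Σ P : X.Cell μ, X.Polyhedron P, IsInterior z₀ ∧
      ∃ τ : QD.HomOver (Specialization.id X.Γ.graph) z.1 z₀.1,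
        extendByZero τ.emap (coords z₀.1 z₀.2) = coords z.1 z.2 := by
  obtain ⟨P, x⟩ := z
  let S₀ := P.S.filter fun e => ∀ he : e ∈ P.S, (x ⟨e, he⟩ : ℝ) ∈ Set.Ioo 0 (X.len e)
  have hS₀ : S₀ ⊆ P.S := Finset.filter_subset _ _
  -- At position 0 the half with index `false` has length zero, so the half `true` survives; at the
  -- other end it is the reverse.
  let h : Fin X.Γ.m → Bool := fun e => if ∃ he : e ∈ P.S, (x ⟨e, he⟩ : ℝ) = 0 then true else false
  refine ⟨⟨P.collapse S₀ hS₀ h, fun e => x ⟨e, hS₀ e.2⟩⟩,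
    fun e => (Finset.mem_filter.1 e.2).2 (hS₀ e.2), P.toCollapse S₀ hS₀ h, ?_⟩
  have hout : ∀ e (he : e ∈ P.S), e ∉ S₀ → (x ⟨e, he⟩ : ℝ) = twist (X.len e) (!h e) 0 := by
    intro e he he'
    have h1 : ¬ (x ⟨e, he⟩ : ℝ) ∈ Set.Ioo 0 (X.len e) := fun h1 =>
      he' (Finset.mem_filter.2 ⟨he, fun _ => h1⟩)
    by_cases h2 : (x ⟨e, he⟩ : ℝ) = 0
    · have : h e = true := if_pos ⟨he, h2⟩
      simp [this, h2, twist]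
    · have h3 : h e = false := if_neg fun ⟨_, h3⟩ => h2 h3
      simp only [h3, twist, Bool.not_false, if_true, sub_zero]
      by_contra h4
      exact h1 ⟨(x ⟨e, he⟩).2.1.lt_of_ne' h2, (x ⟨e, he⟩).2.2.lt_of_ne h4⟩
  rw [extendByZero_eq_iff (QD.HomOver.toSpecialization _).emap_injective]
  constructor
  · rintro (e | ⟨e, k⟩)
    · change (coords P x).1 (Specialization.collapseEmap hS₀ h (.inl e)) = X.len e
      simp only [Specialization.collapseEmap]
      split_ifs with he
      · rw [coords_inr]
        change twist (X.len e) (h e) (x ⟨e, he⟩) = _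
        rw [hout e he e.2, twist_twist]
        simp [twist]
      · rfl
    · rfl
  · intro f hf
    have h1 := (not_congr (Specialization.mem_range_collapseEmap_iff hS₀ h f)).1 hf
    push Not at h1
    obtain ⟨e, k, rfl, h2, h3⟩ := h1
    rw [coords_inr, hout e e.2 h2, twist_twist]
    have : k = !h e := by cases hk : h e <;> cases k <;> simp_all
    rw [this]
    simp [twist]

/-! ### The Jacobian as a fibre of the universal Jacobian -/

/-- The point of the universal Jacobian given by a point of a polyhedron. -/
def toJtrop (z : Σ P : X.Cell μ, X.Polyhedron P) : Jtrop μ :=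
  (jacobianDiagram μ).incl (⟨X.Γ, z.1⟩ : QDObj μ) (coords z.1 z.2)

theorem toJtrop_eq (ι : StableGraph.Hom X.Γ Y.Γ) (τ : QD.HomOver ι.toSpecialization z.1 y.1)
    (hτ : extendByZero τ.emap (coords y.1 y.2) = coords z.1 z.2) : toJtrop z = toJtrop y := by
  have := (jacobianDiagram μ).incl_map
    (show (jacobianDiagram μ).Hom (⟨Y.Γ, y.1⟩ : QDObj μ) (⟨X.Γ, z.1⟩ : QDObj μ) from
      (⟨ι, τ⟩ : QDObj.Hom _ _)) (coords y.1 y.2)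
  rw [toJtrop, ← hτ]
  exact this

theorem forget_toJtrop (z : Σ P : X.Cell μ, X.Polyhedron P) :
    forget μ (toJtrop z) = X.moduliPoint :=
  congrArg ((moduliDiagram g).incl X.Γ) (totalLength_coords z.1 z.2)

end StableCurve

end TropJac

end

/-! ### The fibre as a quotient of the disjoint union of polyhedra. -/

noncomputable section

namespace TropJac

open scoped Classical

open Multigraph

namespace StableCurve

variable {g : ℕ} {d : ℤ} {μ : UniversalPolarization g d} {X Y : StableCurve g}

/-- In terms of edge lengths the face maps of polyhedra are the face morphisms of the cones, so
`toJtrop` respects the gluing. -/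
theorem extendByZero_coords {P P' : X.Cell μ}
    (τ : QD.HomOver (Specialization.id X.Γ.graph) P P') (x : X.Polyhedron P') :
    extendByZero τ.emap (coords P' x) = coords P (X.faceMap τ x) := by
  have hpos : ∀ (e : Fin X.Γ.m) (he : e ∈ P.S) (he' : e ∈ P'.S), X.faceMap τ x ⟨e, he⟩ = x ⟨e, he'⟩ :=
    fun e he he' => dif_pos he'
  have hneg : ∀ (e : Fin X.Γ.m) (he : e ∈ P.S) (he' : e ∉ P'.S) (k : Bool),
      τ.emap (.inl ⟨e, he'⟩) = .inr (⟨e, he⟩, k) →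
      (X.faceMap τ x ⟨e, he⟩ : ℝ) = twist (X.len e) (!k) 0 := by
    intro e he he' k hk
    have h1 : X.faceMap τ x ⟨e, he⟩ = if τ.emap (.inl ⟨e, he'⟩) = .inr (⟨e, he⟩, false)
      then ⟨X.len e, Set.right_mem_Icc.2 (X.len_pos e).le⟩
      else ⟨0, Set.left_mem_Icc.2 (X.len_pos e).le⟩ := dif_neg he'
    rw [h1, hk]
    cases k <;> simp [twist]
  rw [extendByZero_eq_iff τ.emap_injective]
  constructor
  · rintro (⟨e, he'⟩ | ⟨⟨e, he'⟩, k⟩)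
    · by_cases he : e ∈ P.S
      · obtain ⟨k, h1, -⟩ := τ.emap_inl he' he
        refine (congrArg (coords P (X.faceMap τ x)).1 h1).trans ?_
        rw [coords_inr, coords_inl]
        change twist (X.len e) k (X.faceMap τ x ⟨e, he⟩) = X.len e
        rw [hneg e he he' k h1, twist_twist]
        simp [twist]
      · exact congrArg (coords P (X.faceMap τ x)).1 (τ.emap_inl_of_notMem he' he)
    · obtain ⟨h1, -⟩ := τ.emap_inr he' k
      refine (congrArg (coords P (X.faceMap τ x)).1 h1).trans ?_
      rw [coords_inr, coords_inr]
      change twist (X.len e) (xor k false) (X.faceMap τ x ⟨e, τ.subset e he'⟩) = _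
      rw [hpos e (τ.subset e he') he', Bool.xor_false]
  · rintro (⟨e, he⟩ | ⟨⟨e, he⟩, k⟩) hf
    · have he' : e ∉ P'.S := fun h => he (τ.subset e h)
      exact (hf ⟨_, τ.emap_inl_of_notMem he' he⟩).elim
    · by_cases he' : e ∈ P'.S
      · refine (hf ⟨_, (τ.emap_inr he' k).1.trans ?_⟩).elim
        change (Sum.inr ((⟨e, he⟩ : {e // e ∈ P.S}), xor k false) : SubEdge P.S) = _
        rw [Bool.xor_false]
      · obtain ⟨l, h1, -⟩ := τ.emap_inl he' he
        have hkl : k = !l := by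
          by_contra hkl
          obtain rfl : k = l := by cases k <;> cases l <;> simp_all
          exact hf ⟨_, h1⟩
        rw [coords_inr]
        change twist (X.len e) k (X.faceMap τ x ⟨e, he⟩) = 0
        rw [hneg e he he' l h1, twist_twist, hkl]
        simp [twist]

theorem toJtrop_eq_of_glueCell {z z' : Σ P : X.Cell μ, X.Polyhedron P} (h : X.GlueCell μ z z') :
    toJtrop z = toJtrop z' := by
  obtain ⟨τ, x⟩ := h
  exact (toJtrop_eq (z := ⟨_, X.faceMap τ x⟩) (y := ⟨_, x⟩) (StableGraph.Hom.id X.Γ) τ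
    (extendByZero_coords τ x)).symm

/-- Points whose divisors correspond under an automorphism have the same image. -/
theorem toJtrop_eq_of_divisor (α : X.Aut) {z z' : Σ P : X.Cell μ, X.Polyhedron P}
    (h : ∀ p, X.divisor z' (α.toEquiv p) = X.divisor z p) : toJtrop z = toJtrop z' := by
  obtain ⟨i, hi⟩ := α.exists_iso
  obtain ⟨z₀, hz₀, τ₀, h₀⟩ := exists_isInterior z
  obtain ⟨z₁, hz₁, τ₁, h₁⟩ := exists_isInterior z'
  have hdiv₀ : ∀ p, X.divisor z₀ p = X.divisor z p := fun p => by
    have := divisor_map Iso.induces_refl τ₀ h₀ p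
    rwa [Iso.refl_map] at this
  have hdiv₁ : ∀ p, X.divisor z₁ p = X.divisor z' p := fun p => by
    have := divisor_map Iso.induces_refl τ₁ h₁ p
    rwa [Iso.refl_map] at this
  let ι := i.hom
  have hι := i.induces_hom
  have hlen : ∀ e, X.len (ι.emap e) = X.len e := fun e => by
    rw [← i.len_eq, hι.emap]
  let P := z₀.1.push ι.toSpecialization ι.map_leg (μ.map_eq ι)
  let τ := z₀.1.toPush ι.toSpecialization ι.map_leg (μ.map_eq ι)
  have hmem : ∀ e, e ∈ P.S → ι.emap e ∈ z₀.1.S := fun e => (ι.toSpecialization.mem_pullback z₀.1.S e).1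
  -- The interior representative `z₀` is transported along the isomorphism `i`. The result is
  -- interior and has the same divisor as `z₁`, so it equals `z₁`.
  let w : Σ P : X.Cell μ, X.Polyhedron P := ⟨P, fun e => ⟨twist (X.len (ι.emap e)) (ι.flip e)
    (z₀.2 ⟨ι.emap e, hmem e e.2⟩), by
      rw [← hlen]
      exact twist_mem_Icc _ (z₀.2 _).2⟩⟩
  have hw : IsInterior w := fun e => by
    have h1 : (w.2 e : ℝ) ∈ Set.Ioo 0 (X.len (ι.emap e)) :=
      twist_mem_Ioo (ι.flip e) (hz₀ ⟨ι.emap e, hmem e e.2⟩)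
    exact ⟨h1.1, h1.2.trans_eq (hlen e)⟩
  have hτ : extendByZero τ.emap (coords w.1 w.2) = coords z₀.1 z₀.2 := by
    rw [extendByZero_eq_iff τ.emap_injective]
    constructor
    · rintro (⟨e, he⟩ | ⟨⟨e, he⟩, k⟩)
      · have h2 : ι.emap e ∉ z₀.1.S := fun h2 =>
          he ((ι.toSpecialization.mem_pullback z₀.1.S e).2 h2)
        rw [τ.emap_inl_of_notMem he h2]
        exact hlen e
      · rw [(τ.emap_inr he k).1, coords_inr, coords_inr]
        have h1 : ∀ {L L' : ℝ} (t : ℝ), L = L' →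
            twist L (xor k (ι.flip e)) t = twist L' k (twist L (ι.flip e) t) := by
          rintro L _ t rfl
          rw [twist_twist]
        exact h1 _ (hlen e)
    · intro f hf
      refine (hf ((QD.range_toPush _ _ _ _ f).2 ?_)).elim
      exact i.ef.symm.surjective _
  have hdiv : ∀ p, X.divisor w p = X.divisor z₁ p := fun p => by
    obtain ⟨q, rfl⟩ : ∃ q, i.map q = p := ⟨_, i.map_symm_map p⟩
    rw [divisor_map hι τ hτ, hdiv₀, hdiv₁, hi, h]
  calc toJtrop z = toJtrop z₀ := toJtrop_eq (StableGraph.Hom.id X.Γ) τ₀ h₀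
    _ = toJtrop w := toJtrop_eq ι τ hτ
    _ = toJtrop z₁ := by rw [hw.eq_of_divisor_eq hz₁ hdiv]
    _ = toJtrop z' := (toJtrop_eq (StableGraph.Hom.id X.Γ) τ₁ h₁).symm

/-- Points with the same image are in the same orbit. -/
theorem sameOrbit_of_toJtrop_eq {z z' : Σ P : X.Cell μ, X.Polyhedron P}
    (h : toJtrop z = toJtrop z') : X.SameOrbit μ (Quot.mk _ z) (Quot.mk _ z') := by
  obtain ⟨c, f, f', ζ, hf, hf'⟩ := spanProperty_jacobianDiagram μ _ _ _ _ h
  change QDObj μ at c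
  change QDObj.Hom (⟨X.Γ, z.1⟩ : QDObj μ) c at f
  change QDObj.Hom (⟨X.Γ, z'.1⟩ : QDObj μ) c at f'
  change orthant c.Edge at ζ
  -- All edges of the curve have positive length, so no edge of the stable model is contracted: both
  -- specializations to the graph of `c` are isomorphisms.
  have key : ∀ {z : Σ P : X.Cell μ, X.Polyhedron P} (f : QDObj.Hom (⟨X.Γ, z.1⟩ : QDObj μ) c),
      extendByZero f.τ.emap ζ = coords z.1 z.2 →
      Function.Surjective f.ι.emap ∧ ∀ e, X.len (f.ι.emap e) = (totalLength c.P.S ζ).1 e := by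
    intro z f hf
    have h1 := totalLength_extendByZero f.ι.emap_injective f.τ.emap_injective f.τ.overEdge_emap ζ
    rw [hf] at h1
    have h2 := (extendByZero_eq_iff f.ι.emap_injective _ _).1
      (h1.symm.trans (totalLength_coords z.1 z.2))
    refine ⟨fun e => ?_, h2.1⟩
    by_contra he
    exact (X.len_pos e).ne' (h2.2 e he)
  obtain ⟨hs, hl⟩ := key f hf
  obtain ⟨hs', hl'⟩ := key f' hf'
  -- With the total lengths of `ζ`, the graph of `c` becomes a curve isomorphic to `X` in two ways;
  -- the first isomorphism followed by the inverse of the second is the automorphism sought.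
  let Y : StableCurve g := ⟨c.Γ, (totalLength c.P.S ζ).1, fun e => by
    rw [← hl]
    exact X.len_pos _⟩
  obtain ⟨y, hy⟩ := exists_coords (X := Y) c.P ζ fun e => rfl
  have hi := Iso.induces_ofHom (X := X) (Y := Y) f.ι hs hl
  have hi' := Iso.induces_ofHom (X := X) (Y := Y) f'.ι hs' hl'
  change extendByZero f.τ.emap _ = _ at hf
  change extendByZero f'.τ.emap _ = _ at hf'
  rw [← hy] at hf hf'
  refine ⟨((Iso.ofHom (X := X) (Y := Y) f.ι hs hl).trans
    (Iso.ofHom (X := X) (Y := Y) f'.ι hs' hl').symm).toAut, z, z', rfl, rfl, fun p => ?_⟩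
  change X.divisor z' (Iso.map _ p) = _
  rw [Iso.trans_map]
  have h1 := divisor_map (z := z') (y := (⟨c.P, y⟩ : Σ P : Y.Cell μ, Y.Polyhedron P)) hi' f'.τ hf'
    ((Iso.ofHom (X := X) (Y := Y) f'.ι hs' hl').symm.map
      ((Iso.ofHom (X := X) (Y := Y) f.ι hs hl).map p))
  rw [Iso.map_symm_map] at h1
  rw [← h1]
  exact divisor_map (z := z) (y := (⟨c.P, y⟩ : Σ P : Y.Cell μ, Y.Polyhedron P)) hi f.τ hf p

/-- Every point of the fibre comes from a point of a polyhedron. -/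
theorem exists_toJtrop_eq {q : Jtrop μ} (hq : forget μ q = X.moduliPoint) :
    ∃ z : Σ P : X.Cell μ, X.Polyhedron P, toJtrop z = q := by
  induction q using Quot.ind with
  | mk q =>
    obtain ⟨a, ζ⟩ := q
    change QDObj μ at a
    change orthant a.Edge at ζ
    let ζt : orthant (Fin a.Γ.m) := totalLength (E := Fin a.Γ.m) a.P.S ζ
    obtain ⟨c, f, f', ξ, hf, hf'⟩ := spanProperty_moduliDiagram g a.Γ X.Γ ζt
      ⟨X.len, fun e => (X.len_pos e).le⟩ hq
    change StableGraph g at c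
    change StableGraph.Hom a.Γ c at f
    change StableGraph.Hom X.Γ c at f'
    change orthant (Fin c.m) at ξ
    change extendByZero f.emap ξ = totalLength a.P.S ζ at hf
    change extendByZero f'.emap ξ = ⟨X.len, fun e => (X.len_pos e).le⟩ at hf'
    -- Positive lengths make `f'` invertible. Composing `f` with its inverse gives a specialization
    -- to the stable model of `X`, along which the pseudo-divisor is pushed forward.
    have hs : Function.Surjective f'.emap := fun e => by
      by_contra he
      exact (X.len_pos e).ne' (((extendByZero_eq_iff f'.emap_injective _ _).1 hf').2 e he)
    obtain ⟨χ, -, hχ, -⟩ := f'.exists_factor (StableGraph.Hom.id X.Γ)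
      (by rw [hs.range_eq]; exact Set.subset_univ _)
    let ι := χ.comp f
    have hι : extendByZero ι.emap ⟨X.len, fun e => (X.len_pos e).le⟩ = totalLength a.P.S ζ := by
      rw [← hf]
      have h1 : extendByZero χ.emap ⟨X.len, fun e => (X.len_pos e).le⟩ = ξ := by
        rw [← hf', extendByZero_eq_iff χ.emap_injective]
        constructor
        · intro e
          have := ((extendByZero_eq_iff f'.emap_injective _ _).1 hf').1 (χ.emap e)
          rw [hf', ← this, hχ]
          rfl
        · intro e he
          refine (he ⟨f'.emap e, f'.emap_injective ?_⟩).elim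
          rw [hχ]
          rfl
      rw [← h1]
      exact (extendByZero_comp (i := χ.emap) (j := f.emap) χ.emap_injective f.emap_injective _).symm
    let P := a.P.push ι.toSpecialization ι.map_leg (μ.map_eq ι)
    let τ := a.P.toPush ι.toSpecialization ι.map_leg (μ.map_eq ι)
    let ζ' : orthant (SubEdge P.S) := ⟨fun k => ζ.1 (τ.emap k), fun k => ζ.2 _⟩
    -- The contracted edges have total length zero in `ζ`, hence so do all their parts, and nothing
    -- is lost by restricting to the remaining coordinates.
    have hζ : extendByZero τ.emap ζ' = ζ := by
      rw [extendByZero_eq_iff τ.emap_injective]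
      refine ⟨fun _ => rfl, fun k hk => ?_⟩
      have h1 : overEdge a.P.S k ∉ Set.range ι.emap := fun h1 =>
        hk ((QD.range_toPush _ _ _ _ k).2 h1)
      have h2 := ((extendByZero_eq_iff ι.emap_injective _ _).1 hι).2 _ h1
      exact (Finset.sum_eq_zero_iff_of_nonneg fun f _ => ζ.2 f).1 h2 k (by simp)
    have hlen : ∀ e, (totalLength P.S ζ').1 e = X.len e := by
      intro e
      have h1 := totalLength_extendByZero ι.emap_injective τ.emap_injective τ.overEdge_emap ζ'
      rw [hζ] at h1
      exact (((extendByZero_eq_iff ι.emap_injective _ _).1 h1.symm).1 e).symm.trans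
        (((extendByZero_eq_iff ι.emap_injective _ _).1 hι).1 e)
    obtain ⟨x, hx⟩ := exists_coords P ζ' hlen
    refine ⟨⟨P, x⟩, ?_⟩
    have := (jacobianDiagram μ).incl_map
      (show (jacobianDiagram μ).Hom (⟨X.Γ, P⟩ : QDObj μ) a from (⟨ι, τ⟩ : QDObj.Hom _ _)) ζ'
    rw [toJtrop]
    simp only
    rw [hx, ← this]
    exact congrArg ((jacobianDiagram μ).incl a) hζ

theorem continuous_coords (P : X.Cell μ) : Continuous (coords P) := by
  refine Continuous.subtype_mk (continuous_pi fun k => ?_) _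
  rcases k with e | ⟨e, k⟩
  · exact continuous_const
  · have h : Continuous fun x : X.Polyhedron P => ((x e : Set.Icc 0 (X.len e)) : ℝ) :=
      continuous_subtype_val.comp (continuous_apply e)
    cases k
    · exact h
    · exact continuous_const.sub h

/-- The polyhedron is compact, so `coords` is closed into the Hausdorff orthant, and the orthant
maps to the colimit by a closed map. -/
theorem isClosedMap_toJtrop (P : X.Cell μ) :
    IsClosedMap fun x : X.Polyhedron P => toJtrop (⟨P, x⟩ : Σ P : X.Cell μ, X.Polyhedron P) := by
  have hJ := isGeneralizedConeComplex_jacobianDiagram μ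
  have h1 : IsClosedMap ((jacobianDiagram μ).incl (⟨X.Γ, P⟩ : QDObj μ)) :=
    (jacobianDiagram μ).isClosedMap_incl (spanProperty_jacobianDiagram μ) hJ.1 hJ.2.1
      (fun {i j} (f : QDObj.Hom j i) => continuous_extendByZero f.τ.emap_injective)
      (fun {i j} (f : QDObj.Hom j i) => isClosedMap_extendByZero f.τ.emap_injective) _
  have h2 : IsClosedMap (coords P) := (continuous_coords P).isClosedMap
  exact IsClosedMap.comp (g := (jacobianDiagram μ).incl (⟨X.Γ, P⟩ : QDObj μ)) h1 h2

/-- The fibre of the universal Jacobian is the Jacobian modulo automorphisms. -/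
theorem nonempty_fibre_homeomorph (X : StableCurve g) (μ : UniversalPolarization g d) :
    Nonempty (forget μ ⁻¹' {X.moduliPoint} ≃ₜ X.JacobianModAut μ) := by
  let Φ : (Σ P : X.Cell μ, X.Polyhedron P) → forget μ ⁻¹' {X.moduliPoint} :=
    fun z => ⟨toJtrop z, forget_toJtrop z⟩
  let q : (Σ P : X.Cell μ, X.Polyhedron P) → X.JacobianModAut μ := fun z => Quot.mk _ (Quot.mk _ z)
  have hΦc : Continuous Φ := by
    refine Continuous.subtype_mk (continuous_sigma fun P => ?_) _
    have h1 : Continuous ((jacobianDiagram μ).incl (⟨X.Γ, P⟩ : QDObj μ)) :=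
      (jacobianDiagram μ).continuous_incl _
    exact Continuous.comp (g := (jacobianDiagram μ).incl (⟨X.Γ, P⟩ : QDObj μ)) h1
      (continuous_coords P)
  have hΦcl : IsClosedMap Φ := by
    intro C hC
    have h1 : IsClosed (toJtrop '' C) := by
      have h2 : toJtrop '' C = ⋃ P : X.Cell μ, (fun x => toJtrop (⟨P, x⟩ : Σ P : X.Cell μ,
          X.Polyhedron P)) '' (Sigma.mk P ⁻¹' C) := by
        ext w
        simp only [Set.mem_image, Set.mem_iUnion, Set.mem_preimage, Sigma.exists]
      rw [h2]
      exact isClosed_iUnion_of_finite fun P =>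
        isClosedMap_toJtrop P _ (hC.preimage continuous_sigmaMk)
    have h3 : Φ '' C = Subtype.val ⁻¹' (toJtrop '' C) := by
      ext w
      simp only [Set.mem_image, Set.mem_preimage]
      exact ⟨fun ⟨z, hz, h⟩ => ⟨z, hz, congrArg Subtype.val h⟩,
        fun ⟨z, hz, h⟩ => ⟨z, hz, Subtype.ext h⟩⟩
    rw [h3]
    exact h1.preimage continuous_subtype_val
  have hΦs : Function.Surjective Φ := fun w => by
    obtain ⟨z, hz⟩ := exists_toJtrop_eq w.2
    exact ⟨z, Subtype.ext hz⟩
  -- Both the fibre and the Jacobian modulo automorphisms are topological quotients of the disjoint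
  -- union of the polyhedra; it remains to compare the identifications.
  have hΦ : Topology.IsQuotientMap Φ := hΦcl.isQuotientMap hΦc hΦs
  have hq : Topology.IsQuotientMap q :=
    (isQuotientMap_quot_mk (r := X.SameOrbit μ)).comp (isQuotientMap_quot_mk (r := X.GlueCell μ))
  let F : X.Jacobian μ → Jtrop μ := Quot.lift toJtrop fun _ _ h => toJtrop_eq_of_glueCell h
  have hF : ∀ y y', X.SameOrbit μ y y' → F y = F y' := by
    rintro _ _ ⟨α, z, z', rfl, rfl, h⟩
    exact toJtrop_eq_of_divisor α h
  -- `Quot` divides by the equivalence relation generated by `SameOrbit`. That relation need not be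
  -- known to be transitive: equality in the quotient descends along `F`, and equality in the fibre
  -- gives a single orbit relation.
  have hker : ∀ z z', Φ z = Φ z' ↔ q z = q z' := fun z z' =>
    ⟨fun h => Quot.sound (sameOrbit_of_toJtrop_eq (congrArg Subtype.val h)),
      fun h => Subtype.ext (congrArg (Quot.lift F hF) h)⟩
  exact ⟨(Topology.IsQuotientMap.homeomorph (f := ⟨Φ, hΦc⟩) hΦ).symm.trans
    ((Homeomorph.Quotient.congrRight hker).trans
      (Topology.IsQuotientMap.homeomorph (f := ⟨q, hq.continuous⟩) hq))⟩

end StableCurve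

end TropJac

end

theorem mainTheorem2 (g : ℕ) (d : ℤ) (μ : TropJac.UniversalPolarization g d) :
    (TropJac.moduliDiagram g).IsGeneralizedConeComplex ∧
    (TropJac.jacobianDiagram μ).IsGeneralizedConeComplex ∧
    (TropJac.jacobianDiagram μ).HasPureDimension (4 * (g : ℤ) - 2) ∧
    (TropJac.jacobianDiagram μ).IsConnectedThroughCodimOne ∧
    TropJac.ConeDiagram.IsMorphism (TropJac.jacobianDiagram μ) (TropJac.moduliDiagram g)
      (TropJac.forget μ) ∧
    ∀ X : TropJac.StableCurve g,
      Nonempty (TropJac.forget μ ⁻¹' {X.moduliPoint} ≃ₜ X.JacobianModAut μ) := by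
  refine ⟨TropJac.isGeneralizedConeComplex_moduliDiagram g,
    TropJac.isGeneralizedConeComplex_jacobianDiagram μ, TropJac.hasPureDimension_jacobianDiagram μ,
    TropJac.isConnectedThroughCodimOne_jacobianDiagram μ, TropJac.isMorphism_forget μ,
    fun X => X.nonempty_fibre_homeomorph μ⟩
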